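/- Let $d\ge 1$, let $\Omega\subset\mathbb{R}^d$ be a bounded Lipschitz domain and $s\in(0,1)$. Let $W=H_0^s(\Omega)$ be the closure of $C_c^\infty(\Omega)$ with respect to the norm of one of the following inner products $(\cdot,\cdot)_W$: (a) that of $H^s(\Omega)$, i.e. $(u,w)_W=\int_\Omega uw\,dx+\frac{c_{d,s}}{2}\int_\Omega\int_\Omega\frac{(u(x)-u(y))(w(x)-w(y))}{|x-y|^{d+2s}}\,dy\,dx$ with $c_{d,s}=\frac{s2^{2s}\Gamma(s+d/2)}{\pi^{d/2}\Gamma(1-s)}$; (b) if $s\neq\frac12$, that of $H^s(\mathbb{R}^d)$, i.e. the same formula with $\Omega$ replaced by $\mathbb{R}^d$, applied to extensions by zero; (c) if $s\ne\frac12$, the spectral one, $(u,w)_W=\sum_n\lambda_n^s u_nw_n$ with $u_n=\int_\Omega u\phi_n\,dx$, $w_n=\int_\Omega w\phi_n\,dx$, where $(\phi_n)$ is an orthonormal basis of $L^2(\Omega)$ of eigenfunctions of the Dirichlet Laplacian with eigenvalues $\lambda_n$. For compact $K\subset\Omega$ let $\operatorname{cap}_s(K)=\inf\{\|w\|_W^2: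 w\in C_c^\infty(\Omega),\ w\ge 1_K\}$; for open $O\subseteq\Omega$ let $\operatorname{cap}_s(O)=\sup\{\operatorname{cap}_s(K):K\subset O\text{ compact}\}$; for other $B\subseteq\Omega$ let $\operatorname{cap}_s(B)=\inf\{\operatorname{cap}_s(O): B\subseteq O\subseteq\Omega,\ O\text{ open}\}$. A property holds quasi everywhere (q.e.) in $\Omega$ if it holds outside a set of capacity zero. A function $w$ is quasi continuous if for every $\epsilon>0$ there is an open $O\subseteq\Omega$ with $\operatorname{cap}_s(O)<\epsilon$ such that $w|_{\Omega\setminus O}$ is continuous; a set $A\subseteq\Omega$ is quasi open if for every $\epsilon>0$ there is an open $O\subseteq\Omega$ with $\operatorname{cap}_s(O)<\epsilon$ and $A\cup O$ open. Elements of $W$ are identified with their quasi continuous representatives, and inequalities between them are understood q.e. Let $\mathcal{M}_0(\Omega)$ be the set of Borel measures $\mu:\mathcal B(\Omega)\to[0,\infty]$ such that $\mu(B)=0$ whenever $\operatorname{cap}_s(B)=0$, and $\mu(B)=\inf\{\mu(A):A\text{ quasi open},\,B\subseteq A\}$ for every Borel set $B\subseteq\Omega$. Let $$\mathcal{K}(\Omega)=\Big\{w\in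 W: w\ge 0,\ (w,v)_W\le\int_\Omega v\,dx\ \text{ for all } 0\le v\in W\Big\}.$$ Let $z\in W$. Then $z\in\mathcal{K}(\Omega)$ if and only if there is $\mu\in\mathcal{M}_0(\Omega)$ such that $z\in W\cap L^2_\mu(\Omega)$ and $$(z,v)_W+\int_\Omega zv\,d\mu=\int_\Omega v\,dx\qquad\text{for all } v\in W\cap L^2_\mu(\Omega).$$ In this case the measure $\mu\in\mathcal{M}_0(\Omega)$ is unique, there is a unique Radon measure $\eta$ on $\Omega$ with $\int_\Omega\varphi\,d\eta=\int_\Omega\varphi\,dx-(z,\varphi)_W$ for all $\varphi\in C_c^\infty(\Omega)$, and for every Borel set $B\subseteq\Omega$ $$\mu(B)=\begin{cases}\int_B\frac{d\eta}{z}&\text{if }\operatorname{cap}_s(B\cap\{z=0\})=0,\\ \infty&\text{if }\operatorname{cap}_s(B\cap\{z=0\})>0,\end{cases}\qquad\text{and}\qquad \eta(B\cap\{z>0\})=\int_B z\,d\mu .$$ -/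

import Mathlib

open MeasureTheory Set Filter Topology
open scoped ENNReal NNReal ContDiff

noncomputable section

namespace FracCap

/-- `ℝ^d` with its Euclidean norm. -/
abbrev Eucl (d : ℕ) : Type := EuclideanSpace ℝ (Fin d)

/-- A bounded Lipschitz domain: a nonempty connected bounded open set which, near each of its
boundary points, is the strict epigraph, in some direction `e`, of a Lipschitz function of the
component of the variable orthogonal to `e`. -/
structure IsBoundedLipschitzDomain {d : ℕ} (Ω : Set (Eucl d)) : Prop where
  isOpen : IsOpen Ω
  isConnected : IsConnected Ω
  isBounded : Bornology.IsBounded Ω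
  lipschitz_boundary : ∀ x₀ ∈ frontier Ω, ∃ e : Eucl d, ‖e‖ = 1 ∧
    ∃ (L : ℝ≥0) (γ : Eucl d → ℝ), LipschitzWith L γ ∧
      ∃ U ∈ 𝓝 x₀, ∀ x ∈ U, (x ∈ Ω ↔ γ (x - (inner ℝ e x) • e) < inner ℝ e x)

/-- `C_c^∞(Ω)`. -/
def testFunctions {d : ℕ} (Ω : Set (Eucl d)) : Set (Eucl d → ℝ) :=
  {φ | ContDiff ℝ ∞ φ ∧ HasCompactSupport φ ∧ tsupport φ ⊆ Ω}

/-- The constant `c_{d,s} = s 2^{2s} Γ(s + d/2) / (π^{d/2} Γ(1-s))`. -/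
def fracConst (d : ℕ) (s : ℝ) : ℝ :=
  s * 2 ^ (2 * s) * Real.Gamma (s + d / 2) / (Real.pi ^ ((d : ℝ) / 2) * Real.Gamma (1 - s))

/-- Membership in `H^s(A)`. -/
def MemHs {d : ℕ} (s : ℝ) (A : Set (Eucl d)) (w : Eucl d → ℝ) : Prop :=
  MemLp w 2 (volume.restrict A) ∧
  MemLp (fun p : Eucl d × Eucl d => |w p.1 - w p.2| / ‖p.1 - p.2‖ ^ ((d : ℝ) / 2 + s)) 2
    ((volume.restrict A).prod (volume.restrict A))

/-- The inner product of `H^s(A)`. -/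
def hsInner {d : ℕ} (s : ℝ) (A : Set (Eucl d)) (u w : Eucl d → ℝ) : ℝ :=
  (∫ x in A, u x * w x) +
    fracConst d s / 2 *
      ∫ x in A, ∫ y in A, (u x - u y) * (w x - w y) / ‖x - y‖ ^ ((d : ℝ) + 2 * s)

/-- `w ∈ H_0^1(Ω)` (the `H^1`-closure of `C_c^∞(Ω)`) with weak gradient `G`. -/
def IsH10WithGradient {d : ℕ} (Ω : Set (Eucl d)) (w : Eucl d → ℝ) (G : Eucl d → Eucl d) : Prop :=
  MemLp w 2 (volume.restrict Ω) ∧ MemLp G 2 (volume.restrict Ω) ∧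
  ∀ ε > 0, ∃ ψ ∈ testFunctions Ω,
    (∫ x in Ω, (w x - ψ x) ^ 2) + (∫ x in Ω, ‖G x - gradient ψ x‖ ^ 2) < ε

/-- `w` satisfies `-Δ w = lam w` in `Ω` with zero Dirichlet boundary values, in the weak sense. -/
def IsDirichletEigen {d : ℕ} (Ω : Set (Eucl d)) (w : Eucl d → ℝ) (lam : ℝ) : Prop :=
  ∃ G : Eucl d → Eucl d, IsH10WithGradient Ω w G ∧
    ∀ ψ ∈ testFunctions Ω,
      ∫ x in Ω, inner ℝ (G x) (gradient ψ x) = lam * ∫ x in Ω, w x * ψ x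

/-- The admissible choices of the inner product: that of `H^s(Ω)`, for every `s`, and, for
`s ≠ 1/2`, that of `H^s(ℝ^d)` (after extension by zero) and the spectral one, which is given by an
orthonormal basis of `L²(Ω)` of eigenfunctions of the Dirichlet Laplacian. -/
inductive InnerChoice {d : ℕ} (Ω : Set (Eucl d)) (s : ℝ) : Type
  | integral : InnerChoice Ω s
  | wholeSpace (hs : s ≠ 1 / 2) : InnerChoice Ω s
  | spectral (hs : s ≠ 1 / 2) (e : HilbertBasis ℕ ℝ (Lp ℝ 2 (volume.restrict Ω))) (lam : ℕ → ℝ)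
      (he : ∀ n, IsDirichletEigen Ω (e n) (lam n)) : InnerChoice Ω s

section

variable {d : ℕ} {Ω : Set (Eucl d)} {s : ℝ}

/-- The functions for which the chosen norm is finite: `H^s(Ω)`, the functions whose extension by
zero is in `H^s(ℝ^d)`, or the spectral space. -/
def InnerChoice.Finite : InnerChoice Ω s → (Eucl d → ℝ) → Prop
  | .integral, w => MemHs s Ω w
  | .wholeSpace _, w => MemHs s univ (Ω.indicator w)
  | .spectral _ e lam _, w => MemLp w 2 (volume.restrict Ω) ∧
      Summable fun n => lam n ^ s * (∫ x in Ω, w x * e n x) ^ 2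

/-- The chosen inner product `(u, w)_W`. -/
def InnerChoice.prod : InnerChoice Ω s → (Eucl d → ℝ) → (Eucl d → ℝ) → ℝ
  | .integral, u, w => hsInner s Ω u w
  | .wholeSpace _, u, w => hsInner s univ (Ω.indicator u) (Ω.indicator w)
  | .spectral _ e lam _, u, w =>
      ∑' n, lam n ^ s * (∫ x in Ω, u x * e n x) * (∫ x in Ω, w x * e n x)

/-- The squared norm `‖w‖_W²`. -/
def InnerChoice.normSq (p : InnerChoice Ω s) (w : Eucl d → ℝ) : ℝ := p.prod w w

/-- `w` is a representative of an element of `W`, the closure of `C_c^∞(Ω)` in the chosen norm.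
As the admissible norms are equivalent on `C_c^∞(Ω)` for a bounded Lipschitz domain, this is
`H_0^s(Ω)` for each choice. -/
def MemSobolev (p : InnerChoice Ω s) (w : Eucl d → ℝ) : Prop :=
  p.Finite w ∧ ∀ ε > 0, ∃ φ ∈ testFunctions Ω, p.normSq (w - φ) < ε

/-- The capacity of a compact set `K ⊆ Ω`. -/
def capCompact (p : InnerChoice Ω s) (K : Set (Eucl d)) : ℝ≥0∞ :=
  ⨅ φ ∈ {φ | φ ∈ testFunctions Ω ∧ ∀ x, K.indicator (fun _ => (1 : ℝ)) x ≤ φ x},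
    ENNReal.ofReal (p.normSq φ)

/-- The capacity of an open set `O ⊆ Ω`. -/
def capOpen (p : InnerChoice Ω s) (O : Set (Eucl d)) : ℝ≥0∞ :=
  ⨆ K ∈ {K : Set (Eucl d) | IsCompact K ∧ K ⊆ O}, capCompact p K

/-- The capacity `cap_s(B)` of a set `B ⊆ Ω`. -/
def cap (p : InnerChoice Ω s) (B : Set (Eucl d)) : ℝ≥0∞ :=
  ⨅ O ∈ {O : Set (Eucl d) | IsOpen O ∧ B ⊆ O ∧ O ⊆ Ω}, capOpen p O

/-- The property `P` holds quasi everywhere in `Ω`. -/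
def QuasiEverywhere (p : InnerChoice Ω s) (P : Eucl d → Prop) : Prop :=
  ∃ A ⊆ Ω, cap p A = 0 ∧ ∀ x ∈ Ω \ A, P x

/-- `w` is quasi continuous in `Ω`. -/
def QuasiContinuous (p : InnerChoice Ω s) (w : Eucl d → ℝ) : Prop :=
  ∀ ε > 0, ∃ O ⊆ Ω, IsOpen O ∧ cap p O < ε ∧ ContinuousOn w (Ω \ O)

/-- `A ⊆ Ω` is quasi open. -/
def QuasiOpen (p : InnerChoice Ω s) (A : Set (Eucl d)) : Prop :=
  A ⊆ Ω ∧ ∀ ε > 0, ∃ O ⊆ Ω, IsOpen O ∧ IsOpen (A ∪ O) ∧ cap p O < ε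

/-- The space `W`, its elements being given by their quasi continuous representatives. Only the
values in `Ω` matter. -/
def W (p : InnerChoice Ω s) : Set (Eucl d → ℝ) :=
  {w | MemSobolev p w ∧ QuasiContinuous p w}

/-- The set `𝓜₀(Ω)`. A Borel measure on `Ω` is given as a measure on `ℝ^d` that does not charge
the complement of `Ω`. -/
structure IsCapacitaryMeasure (p : InnerChoice Ω s) (μ : Measure (Eucl d)) : Prop where
  compl_eq_zero : μ Ωᶜ = 0
  eq_zero_of_cap : ∀ B ⊆ Ω, MeasurableSet B → cap p B = 0 → μ B = 0
  eq_iInf : ∀ B ⊆ Ω, MeasurableSet B → μ B = ⨅ A ∈ {A | QuasiOpen p A ∧ B ⊆ A}, μ A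

/-- `z ∈ W ∩ L²_μ(Ω)` solves the relaxed Dirichlet problem
`(z, v)_W + ∫_Ω z v dμ = ∫_Ω v dx` for all `v ∈ W ∩ L²_μ(Ω)`. -/
structure SolvesRelaxed (p : InnerChoice Ω s) (μ : Measure (Eucl d)) (z : Eucl d → ℝ) : Prop where
  mem : z ∈ W p
  memLp : MemLp z 2 μ
  eq : ∀ v ∈ W p, MemLp v 2 μ → p.prod z v + ∫ x in Ω, z x * v x ∂μ = ∫ x in Ω, v x

/-- The set `𝓚(Ω)`. -/
def K (p : InnerChoice Ω s) : Set (Eucl d → ℝ) :=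
  {w | w ∈ W p ∧ QuasiEverywhere p (fun x => 0 ≤ w x) ∧
    ∀ v ∈ W p, QuasiEverywhere p (fun x => 0 ≤ v x) → p.prod w v ≤ ∫ x in Ω, v x}

/-- `η` is a Radon measure on `Ω` (a Borel measure on `Ω` finite on compact subsets of `Ω`, hence
regular) representing the functional `1 - (z, ·)_W`. -/
structure Represents (p : InnerChoice Ω s) (η : Measure (Eucl d)) (z : Eucl d → ℝ) : Prop where
  compl_eq_zero : η Ωᶜ = 0
  finite_on_compacts : ∀ C ⊆ Ω, IsCompact C → η C < ⊤
  integral_eq : ∀ φ ∈ testFunctions Ω, ∫ x in Ω, φ x ∂η = (∫ x in Ω, φ x) - p.prod z φ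

end

end FracCap

end

open MeasureTheory Set Filter Topology
open scoped ENNReal NNReal ContDiff

noncomputable section

namespace FracCap

/-! Each of the three inner products is a symmetric form that controls the `L²` norm, is lower
semicontinuous under `L²` convergence, and does not increase under contractions of the values.
`IsRegularForm` isolates these properties, and the theorem is proved for every form that has them
(`mem_K_iff_and_formula`). The contraction is required only for `softAbs`, because it keeps test
functions smooth; the absolute value is reached in the limit.

Potential theory. Capacitary potentials may be added, and the triangle inequality holds for norms
rather than for squared norms; so the square root of the capacity is an outer measure, `capOuter`,
and "quasi everywhere" means "almost everywhere" for it. The weak type inequality `capOuter_le` then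
gives quasi everywhere convergence of subsequences and quasi continuous representatives.

From `z` to `μ`. For `z` in `K p` the functional `φ ↦ ∫ φ - (z, φ)` is nonnegative on nonnegative
test functions, hence given by a Radon measure `η`. It is bounded in the norm of `W`, so `η` ignores
sets of capacity zero and represents the functional on all of `W`. The equation asks for `z μ = η`
where `z > 0`; where `z = 0` the measure must be as large as possible. This suggests `η / z` plus `∞
· cap` on `{z = 0}`, which is `relaxing`. Square integrability for it forces `v = 0` quasi
everywhere on `{z = 0}`, whence `∫ z v dμ = ∫ v dη`.

From `μ` to `z`. Testing with the negative part shows `z ≥ 0`. A nonnegative `v` in `W` need not be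
in `L²_μ`, but `min v (n z)` is, and the remainder `g = (v - n z)⁺` satisfies `n (z, g) ≤ ‖v‖² / 4`;
letting `n → ∞` gives `z ∈ K p` (`mem_K`). The same truncation of test functions gives `z μ = η` on
`{z > 0}` (`restrict_eq_withDensity`). Uniqueness also needs `μ B = ∞` as soon as `B` meets `{z =
0}` in positive capacity. For `0 ≤ v` in `W ∩ L²_μ` the remainders tend to `0` in norm, so `v = 0`
quasi everywhere on `{z = 0}` (`quasi_eq_zero`); a quasi open set of finite measure supports enough
such `v` to meet `{z = 0}` only in capacity zero.

Regularity of the forms. For the two Gagliardo forms everything is pointwise, by Fatou's lemma. For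
the spectral form, `λ ^ s` is a positive multiple of the integral of `t ^ (s - 1) λ / (t + λ)` over
`t > 0`, and the form with weights `t λ / (t + λ)` is the infimum over `v` of the Dirichlet energy
of `v` plus `t ‖u - v‖²`. A contraction applied to both `u` and `v` decreases each term. -/

variable {d : ℕ} {Ω : Set (Eucl d)} {s : ℝ} {p : InnerChoice Ω s}

/-! ### Regularised absolute value -/

/-- A smooth `1`-Lipschitz approximation of the absolute value, vanishing at `0`. -/
def softAbs (δ t : ℝ) : ℝ := √(t ^ 2 + δ ^ 2) - δ

lemma softAbs_zero {δ : ℝ} (hδ : 0 < δ) : softAbs δ 0 = 0 := by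
  simp [softAbs, Real.sqrt_sq hδ.le]

lemma softAbs_nonneg (δ t : ℝ) : 0 ≤ softAbs δ t := by
  have : δ ≤ √(t ^ 2 + δ ^ 2) := Real.le_sqrt_of_sq_le (by nlinarith [sq_nonneg t])
  simp only [softAbs]; linarith

lemma abs_sub_le_softAbs {δ : ℝ} (t : ℝ) : |t| - δ ≤ softAbs δ t := by
  have : |t| ≤ √(t ^ 2 + δ ^ 2) := Real.abs_le_sqrt (by nlinarith [sq_nonneg δ])
  simp only [softAbs]; linarith

lemma softAbs_le_abs {δ : ℝ} (hδ : 0 < δ) (t : ℝ) : softAbs δ t ≤ |t| := by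
  have : √(t ^ 2 + δ ^ 2) ≤ |t| + δ := by
    rw [Real.sqrt_le_left (by positivity)]
    nlinarith [sq_abs t, abs_nonneg t]
  simp only [softAbs]; linarith

lemma abs_softAbs_sub_abs_le {δ : ℝ} (hδ : 0 < δ) (t : ℝ) : abs (softAbs δ t - |t|) ≤ δ := by
  rw [abs_le]
  constructor
  · linarith [abs_sub_le_softAbs (δ := δ) t]
  · linarith [softAbs_le_abs hδ t]

lemma abs_softAbs_sub_le {δ : ℝ} (hδ : 0 < δ) (a b : ℝ) :
    |softAbs δ a - softAbs δ b| ≤ |a - b| := by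
  have key : ∀ a b : ℝ, √(a ^ 2 + δ ^ 2) ≤ |a - b| + √(b ^ 2 + δ ^ 2) := by
    intro a b
    rw [Real.sqrt_le_left (by positivity)]
    have h1 : (√(b ^ 2 + δ ^ 2)) ^ 2 = b ^ 2 + δ ^ 2 := Real.sq_sqrt (by positivity)
    have h2 : |b| ≤ √(b ^ 2 + δ ^ 2) := Real.abs_le_sqrt (by nlinarith [sq_nonneg δ])
    have h3 : (a - b) * b ≤ |a - b| * |b| := by rw [← abs_mul]; exact le_abs_self _
    nlinarith [sq_abs (a - b), abs_nonneg (a - b),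
      mul_le_mul_of_nonneg_left h2 (abs_nonneg (a - b))]
  simp only [softAbs]
  rw [abs_le]
  have h1 := key a b
  have h2 := key b a
  rw [abs_sub_comm b a] at h2
  constructor <;> linarith

lemma contDiff_softAbs {δ : ℝ} (hδ : 0 < δ) : ContDiff ℝ ∞ (softAbs δ) := by
  unfold softAbs
  refine ContDiff.sub (ContDiff.sqrt (by fun_prop) ?_) contDiff_const
  intro t
  positivity

lemma continuous_softAbs (δ : ℝ) : Continuous (softAbs δ) := by
  unfold softAbs
  fun_prop

/-! ### Test functions -/

lemma zero_mem_testFunctions : (0 : Eucl d → ℝ) ∈ testFunctions Ω :=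
  ⟨contDiff_const, HasCompactSupport.zero, by simp [tsupport]⟩

lemma add_mem_testFunctions {φ ψ : Eucl d → ℝ} (hφ : φ ∈ testFunctions Ω)
    (hψ : ψ ∈ testFunctions Ω) : φ + ψ ∈ testFunctions Ω :=
  ⟨hφ.1.add hψ.1, hφ.2.1.add hψ.2.1, (tsupport_add φ ψ).trans (union_subset hφ.2.2 hψ.2.2)⟩

lemma smul_mem_testFunctions {φ : Eucl d → ℝ} (hφ : φ ∈ testFunctions Ω) (c : ℝ) :
    c • φ ∈ testFunctions Ω := by
  have h : tsupport (c • φ) ⊆ tsupport φ := closure_mono (Function.support_const_smul_subset c φ)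
  exact ⟨contDiff_const.smul hφ.1, hφ.2.1.mono' (subset_closure.trans h), h.trans hφ.2.2⟩

lemma sub_mem_testFunctions {φ ψ : Eucl d → ℝ} (hφ : φ ∈ testFunctions Ω)
    (hψ : ψ ∈ testFunctions Ω) : φ - ψ ∈ testFunctions Ω := by
  have := add_mem_testFunctions hφ (smul_mem_testFunctions hψ (-1))
  rwa [neg_one_smul, ← sub_eq_add_neg] at this

lemma comp_mem_testFunctions {φ : Eucl d → ℝ} (hφ : φ ∈ testFunctions Ω) {h : ℝ → ℝ}
    (hh : ContDiff ℝ ∞ h) (h0 : h 0 = 0) : (fun x => h (φ x)) ∈ testFunctions Ω :=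
  ⟨hh.comp hφ.1, hφ.2.1.comp_left h0,
    (closure_mono (Function.support_comp_subset h0 φ)).trans hφ.2.2⟩

lemma convex_testFunctions : Convex ℝ (testFunctions Ω) := by
  intro φ hφ ψ hψ a b _ _ _
  exact add_mem_testFunctions (smul_mem_testFunctions hφ a) (smul_mem_testFunctions hψ b)

/-- Smooth cut-off functions. -/
lemma exists_testFunction_eq_one {K U : Set (Eucl d)} (hK : IsCompact K) (hU : IsOpen U)
    (hKU : K ⊆ U) : ∃ ψ ∈ testFunctions U, (∀ x, 0 ≤ ψ x ∧ ψ x ≤ 1) ∧ ∀ x ∈ K, ψ x = 1 := by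
  obtain ⟨L, hL, hKL, hLU⟩ := exists_compact_between hK hU hKU
  obtain ⟨f, hf1, hf0, hf⟩ := exists_contMDiffMap_one_nhds_of_subset_interior
    (modelWithCornersSelf ℝ (Eucl d)) (n := ⊤) hK.isClosed hKL
  have hsub : tsupport (f : Eucl d → ℝ) ⊆ L := by
    refine closure_minimal ?_ hL.isClosed
    intro x hx
    by_contra hxL
    exact hx (hf0 x hxL)
  exact ⟨f, ⟨f.contMDiff.contDiff, HasCompactSupport.of_support_subset_isCompact hL
    (subset_closure.trans hsub), hsub.trans hLU⟩, fun x => hf x,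
    fun x hx => hf1.self_of_nhdsSet x hx⟩

/-- An open set is the union of an increasing sequence of compact sets. -/
lemma exists_compact_exhaustion {O : Set (Eucl d)} (hO : IsOpen O) :
    ∃ K : ℕ → Set (Eucl d), (∀ n, IsCompact (K n)) ∧ (∀ n, K n ⊆ O) ∧ Monotone K ∧
      ∀ x ∈ O, ∃ n, x ∈ K n := by
  obtain ⟨F, hF, hFO, hFU, hFm⟩ := hO.exists_iUnion_isClosed
  refine ⟨fun n => F n ∩ Metric.closedBall 0 n,
    fun n => (isCompact_closedBall 0 (n : ℝ)).inter_left (hF n),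
    fun n => inter_subset_left.trans (hFO n), fun n m hnm => inter_subset_inter (hFm hnm)
    (Metric.closedBall_subset_closedBall (by exact_mod_cast hnm)), fun x hx => ?_⟩
  rw [← hFU] at hx
  obtain ⟨n, hn⟩ := mem_iUnion.1 hx
  obtain ⟨m, hm⟩ := exists_nat_ge ‖x‖
  refine ⟨max n m, hFm (le_max_left _ _) hn, ?_⟩
  rw [mem_closedBall_zero_iff]
  exact hm.trans (by exact_mod_cast le_max_right n m)

/-! ### Forms on which normal contractions operate -/

/-- The properties of the form `(·, ·)_W` on which the theory of capacities rests. -/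
structure IsRegularForm (p : InnerChoice Ω s) : Prop where
  isOpen : IsOpen Ω
  volume_ne_top : volume Ω ≠ ⊤
  memLp : ∀ {w}, p.Finite w → MemLp w 2 (volume.restrict Ω)
  add : ∀ {u v}, p.Finite u → p.Finite v → p.Finite (u + v)
  smul : ∀ (c : ℝ) {u}, p.Finite u → p.Finite (c • u)
  prod_comm : ∀ u v, p.prod u v = p.prod v u
  prod_add : ∀ {u v w}, p.Finite u → p.Finite v → p.Finite w →
    p.prod u (v + w) = p.prod u v + p.prod u w
  prod_smul : ∀ (c : ℝ) {u v}, p.Finite u → p.Finite v → p.prod u (c • v) = c * p.prod u v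
  nonneg : ∀ {u}, p.Finite u → 0 ≤ p.normSq u
  coercive : ∃ C : ℝ, 0 < C ∧ ∀ {u}, p.Finite u →
    eLpNorm u 2 (volume.restrict Ω) ≤ ENNReal.ofReal (C * √(p.normSq u))
  -- Closedness, in the form of lower semicontinuity. Completeness, weak convergence and the
  -- independence of representatives are all drawn from this field together with `coercive`.
  fatou : ∀ {f : ℕ → Eucl d → ℝ} {w : Eucl d → ℝ} {C : ℝ}, (∀ n, p.Finite (f n)) →
    (∀ n, p.normSq (f n) ≤ C) → MemLp w 2 (volume.restrict Ω) →
    Tendsto (fun n => eLpNorm (f n - w) 2 (volume.restrict Ω)) atTop (𝓝 0) →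
    p.Finite w ∧ p.normSq w ≤ C
  test : ∀ {φ}, φ ∈ testFunctions Ω → p.Finite φ
  contraction : ∀ {u} {δ : ℝ}, 0 < δ → p.Finite u →
    p.Finite (fun x => softAbs δ (u x)) ∧ p.normSq (fun x => softAbs δ (u x)) ≤ p.normSq u

namespace IsRegularForm

lemma neg (hp : IsRegularForm p) {u : Eucl d → ℝ} (hu : p.Finite u) : p.Finite (-u) := by
  simpa using hp.smul (-1) hu

lemma sub (hp : IsRegularForm p) {u v : Eucl d → ℝ} (hu : p.Finite u) (hv : p.Finite v) :
    p.Finite (u - v) := by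
  rw [sub_eq_add_neg]
  exact hp.add hu (hp.neg hv)

lemma prod_neg (hp : IsRegularForm p) {u v : Eucl d → ℝ} (hu : p.Finite u) (hv : p.Finite v) :
    p.prod u (-v) = -p.prod u v := by
  simpa using hp.prod_smul (-1) hu hv

lemma prod_sub (hp : IsRegularForm p) {u v w : Eucl d → ℝ} (hu : p.Finite u) (hv : p.Finite v)
    (hw : p.Finite w) : p.prod u (v - w) = p.prod u v - p.prod u w := by
  rw [sub_eq_add_neg, hp.prod_add hu hv (hp.neg hw), hp.prod_neg hu hw, ← sub_eq_add_neg]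

lemma normSq_add (hp : IsRegularForm p) {u v : Eucl d → ℝ} (hu : p.Finite u) (hv : p.Finite v) :
    p.normSq (u + v) = p.normSq u + 2 * p.prod u v + p.normSq v := by
  have huv := hp.add hu hv
  simp only [InnerChoice.normSq]
  rw [hp.prod_add huv hu hv, hp.prod_comm _ u, hp.prod_comm _ v, hp.prod_add hu hu hv,
    hp.prod_add hv hu hv, hp.prod_comm v u]
  ring

lemma normSq_smul (hp : IsRegularForm p) (c : ℝ) {u : Eucl d → ℝ} (hu : p.Finite u) :
    p.normSq (c • u) = c ^ 2 * p.normSq u := by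
  simp only [InnerChoice.normSq]
  rw [hp.prod_smul c (hp.smul c hu) hu, hp.prod_comm, hp.prod_smul c hu hu]
  ring

lemma normSq_neg (hp : IsRegularForm p) {u : Eucl d → ℝ} (hu : p.Finite u) :
    p.normSq (-u) = p.normSq u := by
  simpa using hp.normSq_smul (-1) hu

lemma normSq_sub (hp : IsRegularForm p) {u v : Eucl d → ℝ} (hu : p.Finite u) (hv : p.Finite v) :
    p.normSq (u - v) = p.normSq u - 2 * p.prod u v + p.normSq v := by
  rw [sub_eq_add_neg, hp.normSq_add hu (hp.neg hv), hp.prod_neg hu hv, hp.normSq_neg hv]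
  ring

lemma normSq_sub_comm (hp : IsRegularForm p) {u v : Eucl d → ℝ} (hu : p.Finite u)
    (hv : p.Finite v) : p.normSq (u - v) = p.normSq (v - u) := by
  rw [← hp.normSq_neg (hp.sub hu hv), neg_sub]

lemma zero (hp : IsRegularForm p) : p.Finite (0 : Eucl d → ℝ) := hp.test zero_mem_testFunctions

lemma normSq_add_le (hp : IsRegularForm p) {u v : Eucl d → ℝ} (hu : p.Finite u)
    (hv : p.Finite v) : p.normSq (u + v) ≤ 2 * p.normSq u + 2 * p.normSq v := by
  have h1 := hp.nonneg (hp.sub hu hv)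
  rw [hp.normSq_sub hu hv] at h1
  rw [hp.normSq_add hu hv]
  linarith

lemma normSq_sub_le (hp : IsRegularForm p) {u v : Eucl d → ℝ} (hu : p.Finite u)
    (hv : p.Finite v) : p.normSq (u - v) ≤ 2 * p.normSq u + 2 * p.normSq v := by
  rw [sub_eq_add_neg, ← hp.normSq_neg hv]
  exact hp.normSq_add_le hu (hp.neg hv)

/-- The Cauchy–Schwarz inequality. -/
lemma prod_le (hp : IsRegularForm p) {u v : Eucl d → ℝ} (hu : p.Finite u) (hv : p.Finite v) :
    p.prod u v ≤ √(p.normSq u) * √(p.normSq v) := by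
  have key : ∀ t : ℝ, 0 ≤ p.normSq v * (t * t) + (-(2 * p.prod u v)) * t + p.normSq u := by
    intro t
    have h := hp.nonneg (hp.sub hu (hp.smul t hv))
    rw [hp.normSq_sub hu (hp.smul t hv), hp.prod_smul t hu hv, hp.normSq_smul t hv] at h
    linarith
  have h := discrim_le_zero key
  rw [← Real.sqrt_mul (hp.nonneg hu)]
  apply Real.le_sqrt_of_sq_le
  simp only [discrim] at h
  linarith

lemma abs_prod_le (hp : IsRegularForm p) {u v : Eucl d → ℝ} (hu : p.Finite u)
    (hv : p.Finite v) : |p.prod u v| ≤ √(p.normSq u) * √(p.normSq v) := by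
  rw [abs_le']
  refine ⟨hp.prod_le hu hv, ?_⟩
  rw [← hp.prod_neg hu hv, ← hp.normSq_neg hv]
  exact hp.prod_le hu (hp.neg hv)

lemma sqrt_normSq_add_le (hp : IsRegularForm p) {u v : Eucl d → ℝ} (hu : p.Finite u)
    (hv : p.Finite v) : √(p.normSq (u + v)) ≤ √(p.normSq u) + √(p.normSq v) := by
  rw [Real.sqrt_le_left (by positivity), hp.normSq_add hu hv]
  nlinarith [hp.prod_le hu hv, Real.sq_sqrt (hp.nonneg hu), Real.sq_sqrt (hp.nonneg hv)]

/-- That the form only sees almost everywhere classes is not an axiom: it is `fatou` for the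
constant sequence `u`, which converges in `L²` to `v` as well. -/
lemma finite_congr (hp : IsRegularForm p) {u v : Eucl d → ℝ} (hu : p.Finite u)
    (h : u =ᵐ[volume.restrict Ω] v) : p.Finite v ∧ p.normSq v ≤ p.normSq u := by
  refine hp.fatou (f := fun _ => u) (fun _ => hu) (fun _ => le_rfl)
    ((memLp_congr_ae h).1 (hp.memLp hu)) ?_
  have : eLpNorm (u - v) 2 (volume.restrict Ω) = 0 := by
    have h' : u - v =ᵐ[volume.restrict Ω] 0 := by
      filter_upwards [h] with x hx
      simp [hx]
    rw [eLpNorm_congr_ae h', eLpNorm_zero]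
  rw [this]
  exact tendsto_const_nhds

lemma normSq_eq_zero_of_ae (hp : IsRegularForm p) {u : Eucl d → ℝ}
    (h : u =ᵐ[volume.restrict Ω] 0) : p.Finite u ∧ p.normSq u = 0 := by
  obtain ⟨h1, h2⟩ := hp.finite_congr hp.zero h.symm
  have h0 : p.normSq (0 : Eucl d → ℝ) = 0 := by
    simpa using hp.normSq_smul 0 hp.zero
  exact ⟨h1, le_antisymm (h2.trans h0.le) (hp.nonneg h1)⟩

lemma normSq_congr (hp : IsRegularForm p) {u v : Eucl d → ℝ} (hu : p.Finite u)
    (h : u =ᵐ[volume.restrict Ω] v) : p.normSq v = p.normSq u :=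
  le_antisymm (hp.finite_congr hu h).2
    (hp.finite_congr (hp.finite_congr hu h).1 h.symm).2

lemma tendsto_eLpNorm (hp : IsRegularForm p) {f : ℕ → Eucl d → ℝ}
    (hf : ∀ n, p.Finite (f n)) (h : Tendsto (fun n => p.normSq (f n)) atTop (𝓝 0)) :
    Tendsto (fun n => eLpNorm (f n) 2 (volume.restrict Ω)) atTop (𝓝 0) := by
  obtain ⟨C, hC, hcoer⟩ := hp.coercive
  have h2 : Tendsto (fun n => ENNReal.ofReal (C * √(p.normSq (f n)))) atTop (𝓝 0) := by
    have := ((Real.continuous_sqrt.tendsto 0).comp h).const_mul C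
    simp only [Real.sqrt_zero, mul_zero] at this
    simpa using ENNReal.tendsto_ofReal this
  exact tendsto_of_tendsto_of_tendsto_of_le_of_le tendsto_const_nhds h2 (fun _ => zero_le)
    (fun n => hcoer (hf n))

/-- A bounded sequence that tends to `0` in `L²` tends to `0` weakly. -/
lemma tendsto_prod_zero (hp : IsRegularForm p) {g : ℕ → Eucl d → ℝ} {v : Eucl d → ℝ} {C : ℝ}
    (hg : ∀ n, p.Finite (g n)) (hC : ∀ n, p.normSq (g n) ≤ C) (hv : p.Finite v)
    (hlim : Tendsto (fun n => eLpNorm (g n) 2 (volume.restrict Ω)) atTop (𝓝 0)) :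
    Tendsto (fun n => p.prod v (g n)) atTop (𝓝 0) := by
  have hC0 : 0 ≤ C := (hp.nonneg (hg 0)).trans (hC 0)
  have key : ∀ v, p.Finite v → ∀ ε > 0, ∀ᶠ n in atTop, p.prod v (g n) < ε := by
    intro v hv ε hε
    by_contra hcon
    rw [Filter.not_eventually] at hcon
    obtain ⟨k, hk, hkε⟩ := extraction_of_frequently_atTop hcon
    simp only [not_lt] at hkε
    -- If `(v, g) ≥ ε` along a subsequence, then `v - τ g` still tends to `v` in `L²`, but its
    -- energy is at most `‖v‖² - 2τε + τ²C`. With `τC ≤ ε` this is below `‖v‖²`, against lower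
    -- semicontinuity.
    set τ := ε / (C + 1) with hτ
    have hτ0 : 0 < τ := by positivity
    have hτC : τ * C ≤ ε := by
      rw [hτ, div_mul_eq_mul_div, div_le_iff₀ (by positivity)]
      nlinarith
    have h := (hp.fatou (f := fun n => v - τ • g (k n)) (w := v)
      (C := p.normSq v - 2 * (τ * ε) + τ ^ 2 * C)
      (fun n => hp.sub hv (hp.smul τ (hg _))) (fun n => ?_) (hp.memLp hv) ?_).2
    · nlinarith [mul_pos hτ0 hε]
    · rw [hp.normSq_sub hv (hp.smul τ (hg _)), hp.prod_smul τ hv (hg _), hp.normSq_smul τ (hg _)]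
      have h1 := mul_le_mul_of_nonneg_left (hkε n) hτ0.le
      have h2 := mul_le_mul_of_nonneg_left (hC (k n)) (sq_nonneg τ)
      linarith
    · have h1 : ∀ n, eLpNorm (v - τ • g (k n) - v) 2 (volume.restrict Ω)
          = ENNReal.ofReal τ * eLpNorm (g (k n)) 2 (volume.restrict Ω) := by
        intro n
        have : v - τ • g (k n) - v = (-τ) • g (k n) := by simp
        rw [this, eLpNorm_const_smul, enorm_neg, Real.enorm_eq_ofReal hτ0.le]
      simp only [h1]
      have h2 := ENNReal.Tendsto.const_mul (hlim.comp hk.tendsto_atTop)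
        (Or.inr (ENNReal.ofReal_ne_top (r := τ)))
      simpa using h2
  rw [Metric.tendsto_atTop']
  intro ε hε
  have h1 := key v hv ε hε
  have h2 := key (-v) (hp.neg hv) ε hε
  obtain ⟨N, hN⟩ := (h1.and h2).exists_forall_of_atTop
  refine ⟨N, fun n hn => ?_⟩
  obtain ⟨ha, hb⟩ := hN n hn.le
  rw [hp.prod_comm, hp.prod_neg (hg n) hv, hp.prod_comm] at hb
  rw [Real.dist_eq, sub_zero, abs_lt]
  constructor <;> linarith

/-- The `L²`-limit of a bounded sequence in a convex set is in the strong closure of that set. -/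
lemma exists_normSq_sub_lt (hp : IsRegularForm p) {S : Set (Eucl d → ℝ)} (hS : Convex ℝ S)
    (hfin : ∀ φ ∈ S, p.Finite φ) {f : ℕ → Eucl d → ℝ} (hf : ∀ n, f n ∈ S) {C : ℝ}
    (hC : ∀ n, p.normSq (f n) ≤ C) {w : Eucl d → ℝ} (hw : MemLp w 2 (volume.restrict Ω))
    (hlim : Tendsto (fun n => eLpNorm (f n - w) 2 (volume.restrict Ω)) atTop (𝓝 0)) :
    p.Finite w ∧ p.normSq w ≤ C ∧ ∀ ε > 0, ∃ φ ∈ S, p.normSq (w - φ) < ε := by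
  obtain ⟨hwf, hwC⟩ := hp.fatou (fun n => hfin _ (hf n)) hC hw hlim
  refine ⟨hwf, hwC, ?_⟩
  by_contra hcon
  push Not at hcon
  obtain ⟨ε, hε, hcon⟩ := hcon
  set T : Set ℝ := (fun φ => p.normSq (w - φ)) '' S with hT
  have hTne : T.Nonempty := ⟨_, f 0, hf 0, rfl⟩
  have hTbdd : BddBelow T := ⟨ε, by rintro _ ⟨φ, hφ, rfl⟩; exact hcon φ hφ⟩
  set I := sInf T with hI
  have hIε : ε ≤ I := le_csInf hTne (by rintro _ ⟨φ, hφ, rfl⟩; exact hcon φ hφ)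
  have hI0 : 0 < I := hε.trans_le hIε
  have hC0 : 0 ≤ C := (hp.nonneg hwf).trans hwC
  -- `D` bounds the energy of `f n - φ` for an almost minimal `φ`. Moving from `φ` towards `f n` by
  -- the fraction `θ` changes the squared distance `X` to `w` into at most `X - 2θX + θ²D`, up to a
  -- term that vanishes by weak convergence. As `θD ≤ I ≤ X`, this is at most `X - θI`, which is
  -- below the infimum `I` once `X < I + θI/2`.
  set D := 8 * C + 2 * (I + 1) with hD
  have hD0 : 0 < D := by positivity
  set θ := min 1 (I / D) with hθ
  have hθ0 : 0 < θ := lt_min one_pos (by positivity)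
  have hθ1 : θ ≤ 1 := min_le_left _ _
  have hθD : θ * D ≤ I := by
    have := min_le_right 1 (I / D)
    rwa [← hθ, le_div_iff₀ hD0] at this
  have hη : 0 < min 1 (θ * I / 2) := lt_min one_pos (by positivity)
  obtain ⟨_, ⟨φ, hφ, rfl⟩, hφI⟩ := exists_lt_of_csInf_lt hTne (lt_add_of_pos_right I hη)
  have hφf := hfin φ hφ
  have hX : I ≤ p.normSq (w - φ) := csInf_le hTbdd ⟨φ, hφ, rfl⟩
  have hgf : ∀ n, p.Finite (f n - w) := fun n => hp.sub (hfin _ (hf n)) hwf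
  have hgC : ∀ n, p.normSq (f n - w) ≤ 4 * C := by
    intro n
    linarith [hp.normSq_sub_le (hfin _ (hf n)) hwf, hC n]
  have hweak := hp.tendsto_prod_zero hgf hgC (hp.sub hwf hφf) hlim
  have hineq : ∀ n, I ≤ p.normSq (w - φ)
      - 2 * θ * (p.prod (w - φ) (f n - w) + p.normSq (w - φ)) + θ ^ 2 * D := by
    intro n
    have hmem : φ + θ • (f n - φ) ∈ S := hS.add_smul_sub_mem hφ (hf n) ⟨hθ0.le, hθ1⟩
    have hnf := hp.sub (hfin _ (hf n)) hφf
    have h1 : I ≤ p.normSq (w - (φ + θ • (f n - φ))) := csInf_le hTbdd ⟨_, hmem, rfl⟩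
    have h2 : w - (φ + θ • (f n - φ)) = (w - φ) - θ • (f n - φ) := by abel
    have h3 : f n - φ = (f n - w) + (w - φ) := by abel
    have h4 : p.prod (w - φ) (f n - φ) = p.prod (w - φ) (f n - w) + p.normSq (w - φ) := by
      rw [h3, hp.prod_add (hp.sub hwf hφf) (hgf n) (hp.sub hwf hφf)]
      rfl
    have h5 : p.normSq (f n - φ) ≤ D := by
      have h6 := hp.normSq_add_le (hgf n) (hp.sub hwf hφf)
      rw [← h3] at h6
      have h7 := min_le_left 1 (θ * I / 2)
      have h8 := hgC n
      simp only at hφI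
      linarith
    rw [h2, hp.normSq_sub (hp.sub hwf hφf) (hp.smul θ hnf), hp.prod_smul θ (hp.sub hwf hφf) hnf,
      hp.normSq_smul θ hnf, h4] at h1
    have := mul_le_mul_of_nonneg_left h5 (sq_nonneg θ)
    linarith
  have hlimit : Tendsto (fun n => p.normSq (w - φ)
      - 2 * θ * (p.prod (w - φ) (f n - w) + p.normSq (w - φ)) + θ ^ 2 * D) atTop
      (𝓝 (p.normSq (w - φ) - 2 * θ * (0 + p.normSq (w - φ)) + θ ^ 2 * D)) :=
    ((hweak.add_const _).const_mul _).const_sub _ |>.add_const _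
  have hfinal := ge_of_tendsto' hlimit hineq
  have h9 := min_le_right 1 (θ * I / 2)
  simp only at hφI
  nlinarith [mul_le_mul_of_nonneg_left hX hθ0.le, mul_le_mul_of_nonneg_left hθD hθ0.le,
    mul_pos hθ0 hI0]

end IsRegularForm

/-! ### Convergence in `L²` -/

lemma tendsto_eLpNorm_add {α : Type*} [MeasurableSpace α] {μ : Measure α} {f g : ℕ → α → ℝ}
    (hf : ∀ n, AEStronglyMeasurable (f n) μ) (hg : ∀ n, AEStronglyMeasurable (g n) μ)
    (hf0 : Tendsto (fun n => eLpNorm (f n) 2 μ) atTop (𝓝 0))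
    (hg0 : Tendsto (fun n => eLpNorm (g n) 2 μ) atTop (𝓝 0)) :
    Tendsto (fun n => eLpNorm (f n + g n) 2 μ) atTop (𝓝 0) := by
  have h := hf0.add hg0
  rw [add_zero] at h
  exact tendsto_of_tendsto_of_tendsto_of_le_of_le tendsto_const_nhds h (fun _ => zero_le)
    (fun n => eLpNorm_add_le (hf n) (hg n) (by norm_num))

lemma tendsto_eLpNorm_smul {α : Type*} [MeasurableSpace α] {μ : Measure α} {f : ℕ → α → ℝ}
    (c : ℝ) (hf0 : Tendsto (fun n => eLpNorm (f n) 2 μ) atTop (𝓝 0)) :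
    Tendsto (fun n => eLpNorm (c • f n) 2 μ) atTop (𝓝 0) := by
  have h := ENNReal.Tendsto.const_mul hf0 (Or.inr (enorm_ne_top (x := c)))
  simpa [eLpNorm_const_smul] using h

lemma tendsto_eLpNorm_seq_smul {α : Type*} [MeasurableSpace α] {μ : Measure α} {f : α → ℝ}
    {c : ℕ → ℝ} (hc : Tendsto c atTop (𝓝 0)) (hf : MemLp f 2 μ) :
    Tendsto (fun n => eLpNorm (c n • f) 2 μ) atTop (𝓝 0) := by
  have h1 : Tendsto (fun n => ‖c n‖ₑ) atTop (𝓝 0) := by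
    have := (continuous_enorm.tendsto (0 : ℝ)).comp hc
    rwa [enorm_zero] at this
  have h := ENNReal.Tendsto.mul_const h1 (Or.inr hf.eLpNorm_ne_top)
  simpa [eLpNorm_const_smul] using h

/-- `softAbs δ` is uniformly within `δ` of the absolute value, which is itself a contraction;
constants are square integrable because the measure is finite. -/
lemma tendsto_eLpNorm_softAbs_sub {α : Type*} [MeasurableSpace α] {μ : Measure α}
    [IsFiniteMeasure μ] {f : ℕ → α → ℝ} {w : α → ℝ} {δ : ℕ → ℝ}
    (hf : ∀ n, AEStronglyMeasurable (f n) μ) (hw : AEStronglyMeasurable w μ)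
    (hδ : ∀ n, 0 < δ n) (hδ0 : Tendsto δ atTop (𝓝 0))
    (h : Tendsto (fun n => eLpNorm (f n - w) 2 μ) atTop (𝓝 0)) :
    Tendsto (fun n => eLpNorm ((fun x => softAbs (δ n) (f n x)) - fun x => |w x|) 2 μ)
      atTop (𝓝 0) := by
  have h1 : Tendsto (fun n => eLpNorm (δ n • fun _ : α => (1 : ℝ)) 2 μ) atTop (𝓝 0) :=
    tendsto_eLpNorm_seq_smul hδ0 (memLp_const 1)
  have h2 := h1.add h
  rw [add_zero] at h2
  refine tendsto_of_tendsto_of_tendsto_of_le_of_le tendsto_const_nhds h2 (fun _ => zero_le)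
    (fun n => ?_)
  have h3 : eLpNorm (fun x => |f n x - w x|) 2 μ = eLpNorm (f n - w) 2 μ :=
    eLpNorm_norm (f n - w)
  rw [← h3]
  refine le_trans ?_ (eLpNorm_add_le (aestronglyMeasurable_const.const_smul (δ n))
    ((hf n).sub hw).norm (by norm_num))
  refine eLpNorm_mono_real (fun x => ?_)
  have h4 := abs_softAbs_sub_abs_le (hδ n) (f n x)
  have h5 := abs_abs_sub_abs_le_abs_sub (f n x) (w x)
  simp only [Pi.sub_apply, Pi.add_apply, Pi.smul_apply, smul_eq_mul, mul_one, Real.norm_eq_abs]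
  exact (abs_sub_le _ |f n x| _).trans (add_le_add h4 h5)

lemma tendsto_one_div_nat_succ : Tendsto (fun n : ℕ => 1 / ((n : ℝ) + 1)) atTop (𝓝 0) :=
  tendsto_one_div_add_atTop_nhds_zero_nat

namespace IsRegularForm

lemma isFiniteMeasure (hp : IsRegularForm p) : IsFiniteMeasure (volume.restrict Ω) :=
  isFiniteMeasure_restrict.2 hp.volume_ne_top

lemma abs (hp : IsRegularForm p) {w : Eucl d → ℝ} (hw : p.Finite w) :
    p.Finite (fun x => |w x|) ∧ p.normSq (fun x => |w x|) ≤ p.normSq w := by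
  have := hp.isFiniteMeasure
  refine hp.fatou (f := fun (n : ℕ) x => softAbs (1 / ((n : ℝ) + 1)) (w x))
    (fun n => (hp.contraction (by positivity) hw).1)
    (fun n => (hp.contraction (by positivity) hw).2) (hp.memLp hw).abs ?_
  refine tendsto_eLpNorm_softAbs_sub (f := fun _ => w) (fun _ => (hp.memLp hw).1) (hp.memLp hw).1
    (fun n => by positivity) tendsto_one_div_nat_succ ?_
  simp

/-! ### The Sobolev space -/

lemma memSobolev_test (hp : IsRegularForm p) {φ : Eucl d → ℝ} (hφ : φ ∈ testFunctions Ω) :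
    MemSobolev p φ := by
  refine ⟨hp.test hφ, fun ε hε => ⟨φ, hφ, ?_⟩⟩
  rw [sub_self, (hp.normSq_eq_zero_of_ae (EventuallyEq.rfl)).2]
  exact hε

lemma memSobolev_add (hp : IsRegularForm p) {u v : Eucl d → ℝ} (hu : MemSobolev p u)
    (hv : MemSobolev p v) : MemSobolev p (u + v) := by
  refine ⟨hp.add hu.1 hv.1, fun ε hε => ?_⟩
  obtain ⟨φ, hφ, h1⟩ := hu.2 (ε / 4) (by positivity)
  obtain ⟨ψ, hψ, h2⟩ := hv.2 (ε / 4) (by positivity)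
  refine ⟨φ + ψ, add_mem_testFunctions hφ hψ, ?_⟩
  rw [add_sub_add_comm]
  have := hp.normSq_add_le (hp.sub hu.1 (hp.test hφ)) (hp.sub hv.1 (hp.test hψ))
  linarith

lemma memSobolev_smul (hp : IsRegularForm p) (c : ℝ) {u : Eucl d → ℝ} (hu : MemSobolev p u) :
    MemSobolev p (c • u) := by
  refine ⟨hp.smul c hu.1, fun ε hε => ?_⟩
  obtain ⟨φ, hφ, h1⟩ := hu.2 (ε / (c ^ 2 + 1)) (by positivity)
  refine ⟨c • φ, smul_mem_testFunctions hφ c, ?_⟩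
  rw [← smul_sub, hp.normSq_smul c (hp.sub hu.1 (hp.test hφ))]
  rw [lt_div_iff₀ (by positivity)] at h1
  nlinarith [hp.nonneg (hp.sub hu.1 (hp.test hφ))]

lemma memSobolev_neg (hp : IsRegularForm p) {u : Eucl d → ℝ} (hu : MemSobolev p u) :
    MemSobolev p (-u) := by
  simpa using hp.memSobolev_smul (-1) hu

lemma memSobolev_sub (hp : IsRegularForm p) {u v : Eucl d → ℝ} (hu : MemSobolev p u)
    (hv : MemSobolev p v) : MemSobolev p (u - v) := by
  rw [sub_eq_add_neg]
  exact hp.memSobolev_add hu (hp.memSobolev_neg hv)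

lemma memSobolev_sum (hp : IsRegularForm p) {ι : Type*} (t : Finset ι) {u : ι → Eucl d → ℝ}
    (hu : ∀ i ∈ t, MemSobolev p (u i)) :
    MemSobolev p (∑ i ∈ t, u i) ∧
      √(p.normSq (∑ i ∈ t, u i)) ≤ ∑ i ∈ t, √(p.normSq (u i)) := by
  classical
  induction t using Finset.induction_on with
  | empty =>
    refine ⟨by simpa using hp.memSobolev_test zero_mem_testFunctions, ?_⟩
    simp [(hp.normSq_eq_zero_of_ae (EventuallyEq.rfl (f := (0 : Eucl d → ℝ)))).2]
  | insert i t hi ih =>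
    obtain ⟨h1, h2⟩ := ih (fun j hj => hu j (Finset.mem_insert_of_mem hj))
    have h3 := hu i (Finset.mem_insert_self i t)
    rw [Finset.sum_insert hi, Finset.sum_insert hi]
    exact ⟨hp.memSobolev_add h3 h1, (hp.sqrt_normSq_add_le h3.1 h1.1).trans (by gcongr)⟩

lemma memSobolev_congr (hp : IsRegularForm p) {u v : Eucl d → ℝ} (hu : MemSobolev p u)
    (h : u =ᵐ[volume.restrict Ω] v) : MemSobolev p v := by
  refine ⟨(hp.finite_congr hu.1 h).1, fun ε hε => ?_⟩
  obtain ⟨φ, hφ, h1⟩ := hu.2 ε hε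
  refine ⟨φ, hφ, lt_of_le_of_lt ?_ h1⟩
  exact (hp.finite_congr (hp.sub hu.1 (hp.test hφ)) (h.sub EventuallyEq.rfl)).2

/-- Approximation by test functions at a prescribed rate. -/
lemma exists_seq_test (hp : IsRegularForm p) {w : Eucl d → ℝ} (hw : MemSobolev p w)
    {ε : ℕ → ℝ} (hε : ∀ n, 0 < ε n) (hε0 : Tendsto ε atTop (𝓝 0)) :
    ∃ φ : ℕ → Eucl d → ℝ, (∀ n, φ n ∈ testFunctions Ω) ∧ (∀ n, p.normSq (w - φ n) < ε n) ∧
      Tendsto (fun n => eLpNorm (φ n - w) 2 (volume.restrict Ω)) atTop (𝓝 0) := by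
  choose φ hφ hlt using fun n => hw.2 (ε n) (hε n)
  refine ⟨φ, hφ, hlt, ?_⟩
  refine hp.tendsto_eLpNorm (fun n => hp.sub (hp.test (hφ n)) hw.1) ?_
  refine tendsto_of_tendsto_of_tendsto_of_le_of_le tendsto_const_nhds hε0
    (fun n => hp.nonneg (hp.sub (hp.test (hφ n)) hw.1)) (fun n => ?_)
  rw [hp.normSq_sub_comm (hp.test (hφ n)) hw.1]
  exact (hlt n).le

/-- The regularised absolute values of approximating test functions are test functions of bounded
energy, but they are only known to converge in `L²`. Convexity of the set of test functions turns
this into approximation in norm, by `exists_normSq_sub_lt`. -/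
lemma memSobolev_abs (hp : IsRegularForm p) {w : Eucl d → ℝ} (hw : MemSobolev p w) :
    MemSobolev p (fun x => |w x|) := by
  have := hp.isFiniteMeasure
  obtain ⟨φ, hφ, hlt, hlim⟩ := hp.exists_seq_test hw (ε := fun n : ℕ => 1 / ((n : ℝ) + 1))
    (fun n => by positivity) tendsto_one_div_nat_succ
  refine ⟨(hp.abs hw.1).1, ?_⟩
  refine (hp.exists_normSq_sub_lt (C := 2 * p.normSq w + 2) convex_testFunctions
    (fun φ hφ => hp.test hφ) (f := fun (n : ℕ) x => softAbs (1 / ((n : ℝ) + 1)) (φ n x))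
    (fun n => comp_mem_testFunctions (hφ n) (contDiff_softAbs (by positivity))
      (softAbs_zero (by positivity))) (fun n => ?_) (hp.memLp hw.1).abs ?_).2.2
  · refine ((hp.contraction (by positivity) (hp.test (hφ n))).2).trans ?_
    have h1 := hp.normSq_sub_le hw.1 (hp.sub hw.1 (hp.test (hφ n)))
    rw [sub_sub_cancel] at h1
    have h2 : 1 / ((n : ℝ) + 1) ≤ 1 := by
      rw [div_le_one (by positivity)]
      linarith [(Nat.cast_nonneg n : (0 : ℝ) ≤ n)]
    linarith [hlt n]
  · exact tendsto_eLpNorm_softAbs_sub (fun n => (hp.memLp (hp.test (hφ n))).1) (hp.memLp hw.1).1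
      (fun n => by positivity) tendsto_one_div_nat_succ hlim

lemma posPart_eq (w : Eucl d → ℝ) :
    (fun x => max (w x) 0) = (1 / 2 : ℝ) • (w + fun x => |w x|) := by
  ext x
  simp only [Pi.smul_apply, Pi.add_apply, smul_eq_mul]
  rcases le_total 0 (w x) with h | h
  · rw [max_eq_left h, abs_of_nonneg h]; ring
  · rw [max_eq_right h, abs_of_nonpos h]; ring

lemma memSobolev_posPart (hp : IsRegularForm p) {w : Eucl d → ℝ} (hw : MemSobolev p w) :
    MemSobolev p (fun x => max (w x) 0) := by
  rw [posPart_eq]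
  exact hp.memSobolev_smul _ (hp.memSobolev_add hw (hp.memSobolev_abs hw))

/-- `(g, g⁺) ≥ (g⁺, g⁺)`. -/
lemma normSq_posPart_le (hp : IsRegularForm p) {g : Eucl d → ℝ} (hg : p.Finite g) :
    p.normSq (fun x => max (g x) 0) ≤ p.prod g (fun x => max (g x) 0) := by
  obtain ⟨ha, hle⟩ := hp.abs hg
  have hga := hp.add hg ha
  rw [posPart_eq, hp.normSq_smul _ hga, hp.prod_smul _ hg hga, hp.normSq_add hg ha,
    hp.prod_add hg hg ha]
  change _ ≤ 1 / 2 * (p.normSq g + _)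
  linarith

/-- Completeness. -/
lemma exists_limit (hp : IsRegularForm p) {f : ℕ → Eucl d → ℝ} (hf : ∀ n, p.Finite (f n))
    {b : ℕ → ℝ} (hb : Tendsto b atTop (𝓝 0))
    (h : ∀ N n m, N ≤ n → N ≤ m → p.normSq (f n - f m) ≤ b N) :
    ∃ w, p.Finite w ∧ Tendsto (fun n => p.normSq (f n - w)) atTop (𝓝 0) := by
  obtain ⟨C, hC, hcoer⟩ := hp.coercive
  have hLp := fun n => hp.memLp (hf n)
  have hcauchy : CauchySeq fun n => (hLp n).toLp (f n) := by
    refine cauchySeq_of_le_tendsto_0 (fun N => C * √(b N)) (fun n m N hn hm => ?_) ?_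
    · rw [Lp.dist_def, ← ENNReal.toReal_ofReal (by positivity : 0 ≤ C * √(b N))]
      refine ENNReal.toReal_mono ENNReal.ofReal_ne_top ?_
      rw [eLpNorm_congr_ae (((hLp n).coeFn_toLp).sub ((hLp m).coeFn_toLp))]
      refine (hcoer (hp.sub (hf n) (hf m))).trans ?_
      gcongr
      exact h N n m hn hm
    · simpa using ((Real.continuous_sqrt.tendsto 0).comp hb).const_mul C
  obtain ⟨w', hw⟩ := cauchySeq_tendsto_of_complete hcauchy
  set w : Eucl d → ℝ := ⇑w' with hw'
  have hlim : Tendsto (fun n => eLpNorm (f n - w) 2 (volume.restrict Ω)) atTop (𝓝 0) := by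
    rw [Lp.tendsto_Lp_iff_tendsto_eLpNorm'] at hw
    refine hw.congr (fun n => ?_)
    exact eLpNorm_congr_ae (((hLp n).coeFn_toLp).sub EventuallyEq.rfl)
  -- The Cauchy bound on `f n - f (m + n)` is uniform in `m` and survives the `L²` limit `m → ∞`, so
  -- the `L²` limit is also the limit in norm.
  have key : ∀ n, p.Finite (f n - w) ∧ p.normSq (f n - w) ≤ b n := by
    intro n
    refine hp.fatou (f := fun m => f n - f (m + n)) (fun m => hp.sub (hf n) (hf _))
      (fun m => h n n _ le_rfl (Nat.le_add_left _ _)) ((hLp n).sub (Lp.memLp w')) ?_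
    have h1 := hlim.comp (tendsto_add_atTop_nat n)
    refine h1.congr (fun m => ?_)
    simp only [Function.comp]
    rw [← eLpNorm_neg]
    congr 1
    abel
  have hwf : p.Finite w := by
    have := hp.sub (hf 0) (key 0).1
    rwa [sub_sub_cancel] at this
  exact ⟨w, hwf, tendsto_of_tendsto_of_tendsto_of_le_of_le tendsto_const_nhds hb
    (fun n => hp.nonneg (key n).1) (fun n => (key n).2)⟩

end IsRegularForm

/-! ### Capacity -/

lemma capCompact_le {K : Set (Eucl d)} {φ : Eucl d → ℝ} (hφ : φ ∈ testFunctions Ω)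
    (h0 : ∀ x, 0 ≤ φ x) (h1 : ∀ x ∈ K, 1 ≤ φ x) :
    capCompact p K ≤ ENNReal.ofReal (p.normSq φ) := by
  refine iInf₂_le φ ⟨hφ, fun x => ?_⟩
  by_cases hx : x ∈ K
  · simpa [hx] using h1 x hx
  · simpa [hx] using h0 x

lemma exists_of_capCompact_lt {K : Set (Eucl d)} {c : ℝ≥0∞} (h : capCompact p K < c) :
    ∃ φ ∈ testFunctions Ω, (∀ x, 0 ≤ φ x) ∧ (∀ x ∈ K, 1 ≤ φ x) ∧
      ENNReal.ofReal (p.normSq φ) < c := by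
  simp only [capCompact, iInf_lt_iff] at h
  obtain ⟨φ, ⟨hφ, hφ1⟩, hlt⟩ := h
  refine ⟨φ, hφ, fun x => le_trans ?_ (hφ1 x), fun x hx => ?_, hlt⟩
  · exact indicator_nonneg (fun _ _ => zero_le_one) x
  · simpa [hx] using hφ1 x

lemma capCompact_mono {K L : Set (Eucl d)} (h : K ⊆ L) : capCompact p K ≤ capCompact p L := by
  refine le_of_forall_gt fun c hc => ?_
  obtain ⟨φ, hφ, h0, h1, hlt⟩ := exists_of_capCompact_lt hc
  exact (capCompact_le hφ h0 (fun x hx => h1 x (h hx))).trans_lt hlt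

lemma capCompact_le_capOpen {K O : Set (Eucl d)} (hK : IsCompact K) (h : K ⊆ O) :
    capCompact p K ≤ capOpen p O :=
  le_iSup₂_of_le K ⟨hK, h⟩ le_rfl

lemma capOpen_mono {O U : Set (Eucl d)} (h : O ⊆ U) : capOpen p O ≤ capOpen p U :=
  iSup₂_le fun _ hK => capCompact_le_capOpen hK.1 (hK.2.trans h)

lemma cap_le_capOpen {B O : Set (Eucl d)} (hO : IsOpen O) (hBO : B ⊆ O) (hOΩ : O ⊆ Ω) :
    cap p B ≤ capOpen p O :=
  iInf₂_le O ⟨hO, hBO, hOΩ⟩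

lemma cap_eq_capOpen {O : Set (Eucl d)} (hO : IsOpen O) (hOΩ : O ⊆ Ω) :
    cap p O = capOpen p O :=
  le_antisymm (cap_le_capOpen hO subset_rfl hOΩ)
    (le_iInf₂ fun _ hU => capOpen_mono hU.2.1)

lemma exists_open_of_cap_lt {B : Set (Eucl d)} {c : ℝ≥0∞} (h : cap p B < c) :
    ∃ O, IsOpen O ∧ B ⊆ O ∧ O ⊆ Ω ∧ capOpen p O < c := by
  simp only [cap, iInf_lt_iff] at h
  obtain ⟨O, ⟨h1, h2, h3⟩, hlt⟩ := h
  exact ⟨O, h1, h2, h3, hlt⟩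

lemma cap_mono {A B : Set (Eucl d)} (h : A ⊆ B) : cap p A ≤ cap p B :=
  le_iInf₂ fun _ hO => cap_le_capOpen hO.1 (h.trans hO.2.1) hO.2.2

namespace IsRegularForm

/-- An element of the Sobolev space that is at least `1` almost everywhere on an open set bounds
the capacity of that set. -/
lemma capOpen_le_normSq (hp : IsRegularForm p) {U : Set (Eucl d)} (hU : IsOpen U) (hUΩ : U ⊆ Ω)
    {u : Eucl d → ℝ} (hu : MemSobolev p u) (h1 : ∀ᵐ x ∂volume.restrict Ω, x ∈ U → 1 ≤ |u x|) :
    capOpen p U ≤ ENNReal.ofReal (p.normSq u) := by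
  have := hp.isFiniteMeasure
  refine iSup₂_le fun K hK => ?_
  obtain ⟨ψ, hψU, hψ01, hψK⟩ := exists_testFunction_eq_one hK.1 hU hK.2
  have hψ : ψ ∈ testFunctions Ω := ⟨hψU.1, hψU.2.1, hψU.2.2.trans hUΩ⟩
  obtain ⟨φ, hφ, hlt, hlim⟩ := hp.exists_seq_test hu (ε := fun n : ℕ => 1 / ((n : ℝ) + 1))
    (fun n => by positivity) tendsto_one_div_nat_succ
  set δ : ℕ → ℝ := fun n => 1 / ((n : ℝ) + 1) with hδ
  have hδ0 : ∀ n, 0 < δ n := fun n => by simp only [hδ]; positivity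
  have hδ1 : ∀ n, δ n ≤ 1 := fun n => by
    simp only [hδ]
    rw [div_le_one (by positivity)]
    linarith [(Nat.cast_nonneg n : (0 : ℝ) ≤ n)]
  set w : Eucl d → ℝ := fun x => |u x| with hw
  set g : ℕ → Eucl d → ℝ := fun n x => softAbs (δ n) (φ n x) with hg
  -- With the true absolute value, half of `ψ + g + |ψ - g|` is `max ψ g`, which is at least `1` on
  -- `K`. The regularisation loses at most `δ n / 2` there, and the extra `δ n • ψ` makes up for it
  -- because `ψ = 1` on `K`.
  set k : ℕ → Eucl d → ℝ := fun n x => softAbs (δ n) ((ψ - g n) x) with hk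
  set f : ℕ → Eucl d → ℝ := fun n => (1 / 2 : ℝ) • (ψ + g n + k n) + δ n • ψ with hf
  have hgt : ∀ n, g n ∈ testFunctions Ω := fun n =>
    comp_mem_testFunctions (hφ n) (contDiff_softAbs (hδ0 n)) (softAbs_zero (hδ0 n))
  have hkt : ∀ n, k n ∈ testFunctions Ω := fun n =>
    comp_mem_testFunctions (sub_mem_testFunctions hψ (hgt n)) (contDiff_softAbs (hδ0 n))
      (softAbs_zero (hδ0 n))
  have hft : ∀ n, f n ∈ testFunctions Ω := fun n =>
    add_mem_testFunctions (smul_mem_testFunctions (add_mem_testFunctions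
      (add_mem_testFunctions hψ (hgt n)) (hkt n)) _) (smul_mem_testFunctions hψ _)
  set S : Set (Eucl d → ℝ) :=
    {φ | φ ∈ testFunctions Ω ∧ (∀ x, 0 ≤ φ x) ∧ ∀ x ∈ K, 1 ≤ φ x} with hS
  have hSconv : Convex ℝ S := by
    intro a ha b hb α β hα hβ hαβ
    refine ⟨convex_testFunctions ha.1 hb.1 hα hβ hαβ, fun x => ?_, fun x hx => ?_⟩
    · have := mul_nonneg hα (ha.2.1 x)
      have := mul_nonneg hβ (hb.2.1 x)
      simp only [Pi.add_apply, Pi.smul_apply, smul_eq_mul]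
      linarith
    · have := mul_le_mul_of_nonneg_left (ha.2.2 x hx) hα
      have := mul_le_mul_of_nonneg_left (hb.2.2 x hx) hβ
      simp only [Pi.add_apply, Pi.smul_apply, smul_eq_mul]
      linarith
  have hfS : ∀ n, f n ∈ S := by
    intro n
    have hg0 : ∀ x, 0 ≤ g n x := fun x => softAbs_nonneg _ _
    have hk0 : ∀ x, 0 ≤ k n x := fun x => softAbs_nonneg _ _
    refine ⟨hft n, fun x => ?_, fun x hx => ?_⟩
    · simp only [hf, Pi.add_apply, Pi.smul_apply, smul_eq_mul]
      have := mul_nonneg (hδ0 n).le (hψ01 x).1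
      linarith [hg0 x, hk0 x, (hψ01 x).1]
    · simp only [hf, Pi.add_apply, Pi.smul_apply, smul_eq_mul]
      have h2 : |ψ x - g n x| - δ n ≤ k n x := abs_sub_le_softAbs _
      rw [hψK x hx] at h2 ⊢
      linarith [le_abs_self (1 - g n x), hδ0 n]
  have hφn : ∀ n, p.normSq (φ n) ≤ 2 * p.normSq u + 2 := by
    intro n
    have h2 := hp.normSq_sub_le hu.1 (hp.sub hu.1 (hp.test (hφ n)))
    rw [sub_sub_cancel] at h2
    linarith [hlt n, hδ1 n]
  have hgn : ∀ n, p.normSq (g n) ≤ 2 * p.normSq u + 2 := fun n =>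
    (hp.contraction (hδ0 n) (hp.test (hφ n))).2.trans (hφn n)
  have hu0 := hp.nonneg hu.1
  have hψ0 := hp.nonneg (hp.test hψ)
  set M := 2 * p.normSq u + 2 with hM
  have hkn : ∀ n, p.normSq (k n) ≤ 2 * p.normSq ψ + 2 * M := fun n =>
    (hp.contraction (hδ0 n) (hp.sub (hp.test hψ) (hp.test (hgt n)))).2.trans
      ((hp.normSq_sub_le (hp.test hψ) (hp.test (hgt n))).trans (by linarith [hgn n]))
  have hfn : ∀ n, p.normSq (f n) ≤ 2 * (1 / 4 * (2 * (2 * p.normSq ψ + 2 * M)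
      + 2 * (2 * p.normSq ψ + 2 * M))) + 2 * p.normSq ψ := by
    intro n
    have e1 := hp.normSq_add_le (hp.test (smul_mem_testFunctions (add_mem_testFunctions
      (add_mem_testFunctions hψ (hgt n)) (hkt n)) (1 / 2)))
      (hp.test (smul_mem_testFunctions hψ (δ n)))
    rw [hp.normSq_smul _ (hp.test (add_mem_testFunctions
      (add_mem_testFunctions hψ (hgt n)) (hkt n))), hp.normSq_smul _ (hp.test hψ)] at e1
    have e2 := hp.normSq_add_le (hp.test (add_mem_testFunctions hψ (hgt n))) (hp.test (hkt n))
    have e3 := hp.normSq_add_le (hp.test hψ) (hp.test (hgt n))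
    have e4 : δ n ^ 2 * p.normSq ψ ≤ 1 * p.normSq ψ := by
      gcongr
      exact pow_le_one₀ (hδ0 n).le (hδ1 n)
    have e5 := hkn n
    have e6 := hgn n
    have e7 : (1 / 2 : ℝ) ^ 2 = 1 / 4 := by norm_num
    rw [e7] at e1
    change p.normSq (f n) ≤ _ at e1
    linarith
  have hwS := hp.memSobolev_abs hu
  have mg : ∀ n, AEStronglyMeasurable (g n) (volume.restrict Ω) :=
    fun n => (hp.memLp (hp.test (hgt n))).1
  have mk : ∀ n, AEStronglyMeasurable (k n) (volume.restrict Ω) :=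
    fun n => (hp.memLp (hp.test (hkt n))).1
  have mψ := hp.memLp (hp.test hψ)
  have mw := hp.memLp hwS.1
  have hglim : Tendsto (fun n => eLpNorm (g n - w) 2 (volume.restrict Ω)) atTop (𝓝 0) :=
    tendsto_eLpNorm_softAbs_sub (fun n => (hp.memLp (hp.test (hφ n))).1) (hp.memLp hu.1).1
      hδ0 tendsto_one_div_nat_succ hlim
  have hklim : Tendsto (fun n => eLpNorm (k n - fun x => |(ψ - w) x|) 2 (volume.restrict Ω))
      atTop (𝓝 0) := by
    refine tendsto_eLpNorm_softAbs_sub (fun n => mψ.1.sub (mg n)) (mψ.1.sub mw.1)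
      hδ0 tendsto_one_div_nat_succ ?_
    refine hglim.congr (fun n => ?_)
    rw [← eLpNorm_neg]
    congr 1
    abel
  have hflim : Tendsto (fun n => eLpNorm (f n - w) 2 (volume.restrict Ω)) atTop (𝓝 0) := by
    have hψw : AEStronglyMeasurable (fun x => |(ψ - w) x|) (volume.restrict Ω) :=
      (mψ.1.sub mw.1).norm
    have t1 := tendsto_eLpNorm_add
      (fun n => (((mg n).sub mw.1).const_smul (1 / 2 : ℝ)).add
        (((mk n).sub hψw).const_smul (1 / 2 : ℝ)))
      (fun n => mψ.1.const_smul (δ n))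
      (tendsto_eLpNorm_add (fun n => ((mg n).sub mw.1).const_smul (1 / 2 : ℝ))
        (fun n => ((mk n).sub hψw).const_smul (1 / 2 : ℝ)) (tendsto_eLpNorm_smul (1 / 2) hglim)
        (tendsto_eLpNorm_smul (1 / 2) hklim))
      (tendsto_eLpNorm_seq_smul tendsto_one_div_nat_succ mψ)
    refine t1.congr (fun n => eLpNorm_congr_ae ?_)
    filter_upwards [h1] with x hx
    simp only [hf, Pi.add_apply, Pi.smul_apply, Pi.sub_apply, smul_eq_mul]
    -- The hypothesis on `u` is used here: almost everywhere `ψ ≤ |u|`, so the maximum of `ψ` and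
    -- `|u|` is `|u|`, and the admissible functions `f n` tend to `|u|` in `L²`.
    have hψw : ψ x ≤ w x := by
      by_cases hxU : x ∈ U
      · exact (hψ01 x).2.trans (hx hxU)
      · rw [image_eq_zero_of_notMem_tsupport (fun h => hxU (hψU.2.2 h))]
        exact abs_nonneg _
    have hwx : |u x| = w x := rfl
    have habs : |ψ x - w x| = w x - ψ x := by rw [abs_of_nonpos (by linarith), neg_sub]
    rw [hwx, habs]
    ring
  obtain ⟨-, -, happ⟩ := hp.exists_normSq_sub_lt hSconv (fun φ hφ => hp.test hφ.1) hfS hfn mw hflim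
  have hle : ∀ η : ℝ, 0 < η → capCompact p K ≤ ENNReal.ofReal ((√(p.normSq u) + η) ^ 2) := by
    intro η hη
    obtain ⟨φ, hφ, hφlt⟩ := happ (η ^ 2) (by positivity)
    refine (capCompact_le hφ.1 hφ.2.1 hφ.2.2).trans (ENNReal.ofReal_le_ofReal ?_)
    have hφf := hp.test hφ.1
    have h2 := hp.sqrt_normSq_add_le hwS.1 (hp.sub hφf hwS.1)
    rw [add_sub_cancel, hp.normSq_sub_comm hφf hwS.1] at h2
    have h3 : √(p.normSq (w - φ)) ≤ η := by
      rw [Real.sqrt_le_left hη.le]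
      exact hφlt.le
    have h4 : √(p.normSq w) ≤ √(p.normSq u) := Real.sqrt_le_sqrt (hp.abs hu.1).2
    rw [← Real.sq_sqrt (hp.nonneg hφf)]
    gcongr
    linarith
  have hlim2 : Tendsto (fun η : ℝ => ENNReal.ofReal ((√(p.normSq u) + η) ^ 2)) (𝓝[>] 0)
      (𝓝 (ENNReal.ofReal ((√(p.normSq u) + 0) ^ 2))) := by
    refine Tendsto.mono_left (ENNReal.continuous_ofReal.comp (by fun_prop) |>.tendsto 0)
      nhdsWithin_le_nhds
  rw [add_zero, Real.sq_sqrt hu0] at hlim2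
  exact ge_of_tendsto hlim2 (eventually_nhdsWithin_of_forall hle)

lemma tendsto_ae_of_eLpNorm (hp : IsRegularForm p) {f : ℕ → Eucl d → ℝ} {w : Eucl d → ℝ}
    (hf : ∀ n, p.Finite (f n)) (hw : p.Finite w)
    (h : Tendsto (fun n => p.normSq (f n - w)) atTop (𝓝 0)) :
    ∃ k : ℕ → ℕ, StrictMono k ∧
      ∀ᵐ x ∂volume.restrict Ω, Tendsto (fun n => f (k n) x) atTop (𝓝 (w x)) :=
  (tendstoInMeasure_of_tendsto_eLpNorm (by norm_num) (fun n => (hp.memLp (hf n)).1)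
    (hp.memLp hw).1 (hp.tendsto_eLpNorm (fun n => hp.sub (hf n) hw) h)).exists_seq_tendsto_ae

/-- The capacitary potential of an open set of finite capacity. -/
lemma exists_potential (hp : IsRegularForm p) {O : Set (Eucl d)} (hO : IsOpen O)
    (hfin : capOpen p O ≠ ⊤) :
    ∃ w, MemSobolev p w ∧ (∀ᵐ x ∂volume.restrict Ω, x ∈ O → 1 ≤ w x) ∧
      ENNReal.ofReal (p.normSq w) ≤ capOpen p O := by
  obtain ⟨K, hKc, hKO, hKm, hKU⟩ := exists_compact_exhaustion hO
  have hKcap : ∀ n, capCompact p (K n) ≤ capOpen p O := fun n =>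
    capCompact_le_capOpen (hKc n) (hKO n)
  have hKfin : ∀ n, capCompact p (K n) ≠ ⊤ := fun n => ne_top_of_le_ne_top hfin (hKcap n)
  set i : ℕ → ℝ := fun n => (capCompact p (K n)).toReal with hi
  set c : ℝ := (capOpen p O).toReal with hc
  have hic : ∀ n, i n ≤ c := fun n => ENNReal.toReal_mono hfin (hKcap n)
  have him : Monotone i := fun n m hnm => ENNReal.toReal_mono (hKfin m) (capCompact_mono (hKm hnm))
  set δ : ℕ → ℝ := fun n => 1 / ((n : ℝ) + 1) with hδ
  have hδ0 : ∀ n, 0 < δ n := fun n => by simp only [hδ]; positivity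
  have hδm : Antitone δ := fun n m hnm => by
    simp only [hδ]
    gcongr
  have hex : ∀ n, ∃ φ ∈ testFunctions Ω, (∀ x, 0 ≤ φ x) ∧ (∀ x ∈ K n, 1 ≤ φ x) ∧
      p.normSq φ < i n + δ n := by
    intro n
    have h1 : capCompact p (K n) < ENNReal.ofReal (i n + δ n) := by
      rw [← ENNReal.ofReal_toReal (hKfin n)]
      exact (ENNReal.ofReal_lt_ofReal_iff (add_pos_of_nonneg_of_pos ENNReal.toReal_nonneg
        (hδ0 n))).2 (lt_add_of_pos_right _ (hδ0 n))
    obtain ⟨φ, hφ, h2, h3, h4⟩ := exists_of_capCompact_lt h1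
    exact ⟨φ, hφ, h2, h3, (ENNReal.ofReal_lt_ofReal_iff (add_pos_of_nonneg_of_pos
      ENNReal.toReal_nonneg (hδ0 n))).1 h4⟩
  choose φ hφ hφ0 hφ1 hφn using hex
  obtain ⟨L, hL⟩ : ∃ L, Tendsto i atTop (𝓝 L) :=
    ⟨_, tendsto_atTop_ciSup him ⟨c, by rintro _ ⟨n, rfl⟩; exact hic n⟩⟩
  have hiL : ∀ n, i n ≤ L := fun n => him.ge_of_tendsto hL n
  have hcauchy : ∀ n m, n ≤ m → p.normSq (φ n - φ m) ≤ 2 * (L - i n) + 4 * δ n := by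
    intro n m hnm
    have hn := hp.test (hφ n)
    have hm := hp.test (hφ m)
    -- The midpoint is admissible for the smaller compact set. The parallelogram identity then
    -- bounds the energy of the difference by `2 (i m - i n) + 2 δ n + 2 δ m`, so almost minimisers
    -- form a Cauchy sequence.
    have h1 : i n ≤ p.normSq ((1 / 2 : ℝ) • (φ n + φ m)) := by
      have ht := smul_mem_testFunctions (add_mem_testFunctions (hφ n) (hφ m)) (1 / 2)
      have h2 := capCompact_le (p := p) (K := K n) ht (fun x => ?_) (fun x hx => ?_)
      · exact ENNReal.toReal_le_of_le_ofReal (hp.nonneg (hp.test ht)) h2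
      · simp only [Pi.smul_apply, Pi.add_apply, smul_eq_mul]
        linarith [hφ0 n x, hφ0 m x]
      · simp only [Pi.smul_apply, Pi.add_apply, smul_eq_mul]
        linarith [hφ1 n x hx, hφ1 m x (hKm hnm hx)]
    rw [hp.normSq_smul _ (hp.add hn hm), hp.normSq_add hn hm] at h1
    rw [hp.normSq_sub hn hm]
    linarith [hφn n, hφn m, hiL m, hδm hnm]
  have hb : Tendsto (fun n => 2 * (L - i n) + 4 * δ n) atTop (𝓝 0) := by
    have h1 := ((hL.const_sub L).const_mul 2).add (tendsto_one_div_nat_succ.const_mul 4)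
    have h2 : 2 * (L - L) + 4 * (0 : ℝ) = 0 := by ring
    rwa [h2] at h1
  obtain ⟨w, hw, hwlim⟩ := hp.exists_limit (fun n => hp.test (hφ n)) hb (by
    intro N n m hn hm
    rcases le_total n m with h | h
    · linarith [hcauchy n m h, him hn, hδm hn]
    · rw [hp.normSq_sub_comm (hp.test (hφ n)) (hp.test (hφ m))]
      linarith [hcauchy m n h, him hm, hδm hm])
  have hwS : MemSobolev p w := by
    refine ⟨hw, fun ε hε => ?_⟩
    obtain ⟨n, hn⟩ := ((tendsto_order.1 hwlim).2 ε hε).exists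
    exact ⟨φ n, hφ n, by rwa [hp.normSq_sub_comm hw (hp.test (hφ n))]⟩
  refine ⟨w, hwS, ?_, ?_⟩
  · obtain ⟨k, hk, hae⟩ := hp.tendsto_ae_of_eLpNorm (fun n => hp.test (hφ n)) hw hwlim
    filter_upwards [hae] with x hx hxO
    obtain ⟨N, hN⟩ := hKU x hxO
    refine ge_of_tendsto hx ?_
    filter_upwards [eventually_ge_atTop N] with n hn
    exact hφ1 _ x (hKm (hn.trans (hk.id_le n)) hN)
  · have hle : ∀ N, p.normSq w ≤ c + δ N := by
      intro N
      refine (hp.fatou (f := fun n => φ (n + N)) (fun n => hp.test (hφ _)) (fun n => ?_)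
        (hp.memLp hw) ?_).2
      · linarith [hφn (n + N), hic (n + N), hδm (Nat.le_add_left N n)]
      · exact (hp.tendsto_eLpNorm (fun n => hp.sub (hp.test (hφ n)) hw) hwlim).comp
          (tendsto_add_atTop_nat N)
    have h1 : Tendsto (fun N => c + δ N) atTop (𝓝 (c + 0)) :=
      tendsto_one_div_nat_succ.const_add c
    rw [add_zero] at h1
    exact ENNReal.ofReal_le_of_le_toReal (ge_of_tendsto' h1 hle)

lemma rpow_half_ofReal_normSq (hp : IsRegularForm p) {u : Eucl d → ℝ} (hu : p.Finite u) :
    ENNReal.ofReal (p.normSq u) ^ (1 / 2 : ℝ) = ENNReal.ofReal √(p.normSq u) := by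
  rw [ENNReal.ofReal_rpow_of_nonneg (hp.nonneg hu) (by norm_num), ← Real.sqrt_eq_rpow]

/-- The sum of the potentials is at least `1` on the union, and its norm is at most the sum of the
norms; this is why square roots occur. A compact subset meets the definition with finitely many of
the sets, so no infinite sum of potentials is needed. -/
lemma capOpen_iUnion_le (hp : IsRegularForm p) {O : ℕ → Set (Eucl d)} (hO : ∀ n, IsOpen (O n))
    (hOΩ : ∀ n, O n ⊆ Ω) :
    capOpen p (⋃ n, O n) ^ (1 / 2 : ℝ) ≤ ∑' n, capOpen p (O n) ^ (1 / 2 : ℝ) := by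
  by_cases htop : ∑' n, capOpen p (O n) ^ (1 / 2 : ℝ) = ⊤
  · rw [htop]; exact le_top
  have hfin : ∀ n, capOpen p (O n) ≠ ⊤ := by
    intro n h
    refine ENNReal.ne_top_of_tsum_ne_top htop n ?_
    rw [h, ENNReal.top_rpow_of_pos (by norm_num)]
  choose w hw hw1 hwn using fun n => hp.exists_potential (hO n) (hfin n)
  rw [← ENNReal.le_rpow_inv_iff (by norm_num : (0 : ℝ) < 1 / 2)]
  refine iSup₂_le fun K hK => ?_
  rw [ENNReal.le_rpow_inv_iff (by norm_num : (0 : ℝ) < 1 / 2)]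
  obtain ⟨t, ht⟩ := hK.1.elim_finite_subcover O hO hK.2
  have hopen : IsOpen (⋃ i ∈ t, O i) := isOpen_biUnion fun i _ => hO i
  have habs : ∀ i ∈ t, MemSobolev p (fun x => |w i x|) := fun i _ => hp.memSobolev_abs (hw i)
  obtain ⟨hs1, hs2⟩ := hp.memSobolev_sum t habs
  have hcap : capCompact p K ≤ ENNReal.ofReal (p.normSq (∑ i ∈ t, fun x => |w i x|)) := by
    refine (capCompact_le_capOpen hK.1 ht).trans
      (hp.capOpen_le_normSq hopen (iUnion₂_subset fun i _ => hOΩ i) hs1 ?_)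
    filter_upwards [ae_all_iff.2 hw1] with x hx hxU
    obtain ⟨i, hi, hxi⟩ := mem_iUnion₂.1 hxU
    rw [Finset.sum_apply]
    calc (1 : ℝ) ≤ |w i x| := (hx i hxi).trans (le_abs_self _)
      _ ≤ ∑ j ∈ t, |w j x| := Finset.single_le_sum (f := fun j => |w j x|)
        (fun j _ => abs_nonneg _) hi
      _ ≤ _ := le_abs_self _
  calc capCompact p K ^ (1 / 2 : ℝ)
      ≤ ENNReal.ofReal (p.normSq (∑ i ∈ t, fun x => |w i x|)) ^ (1 / 2 : ℝ) := by gcongr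
    _ = ENNReal.ofReal √(p.normSq (∑ i ∈ t, fun x => |w i x|)) :=
        hp.rpow_half_ofReal_normSq hs1.1
    _ ≤ ENNReal.ofReal (∑ i ∈ t, √(p.normSq (w i))) := by
        refine ENNReal.ofReal_le_ofReal (hs2.trans (Finset.sum_le_sum fun i _ => ?_))
        exact Real.sqrt_le_sqrt (hp.abs (hw i).1).2
    _ = ∑ i ∈ t, ENNReal.ofReal √(p.normSq (w i)) :=
        ENNReal.ofReal_sum_of_nonneg fun i _ => Real.sqrt_nonneg _
    _ ≤ ∑ i ∈ t, capOpen p (O i) ^ (1 / 2 : ℝ) := by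
        refine Finset.sum_le_sum fun i _ => ?_
        rw [← hp.rpow_half_ofReal_normSq (hw i).1]
        gcongr
        exact hwn i
    _ ≤ _ := ENNReal.sum_le_tsum t

lemma capOpen_empty (hp : IsRegularForm p) : capOpen p ∅ = 0 := by
  refine le_antisymm (iSup₂_le fun K hK => ?_) zero_le
  refine (capCompact_le zero_mem_testFunctions (fun _ => le_rfl)
    (fun x hx => (hK.2 hx).elim)).trans ?_
  rw [(hp.normSq_eq_zero_of_ae EventuallyEq.rfl).2, ENNReal.ofReal_zero]

/-- The square root of the capacity, as an outer measure that does not charge `Ωᶜ`. -/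
def capOuter (hp : IsRegularForm p) : OuterMeasure (Eucl d) where
  measureOf B := cap p (B ∩ Ω) ^ (1 / 2 : ℝ)
  empty := by
    rw [empty_inter, cap_eq_capOpen isOpen_empty (empty_subset _), hp.capOpen_empty,
      ENNReal.zero_rpow_of_pos (by norm_num)]
  mono {A B} h := by
    gcongr
    exact cap_mono (inter_subset_inter_left _ h)
  iUnion_nat B _ := by
    refine ENNReal.le_of_forall_pos_le_add fun ε hε hlt => ?_
    obtain ⟨ε', hε', hsum⟩ := ENNReal.exists_pos_sum_of_countable'
      (ENNReal.coe_ne_zero.2 hε.ne') ℕ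
    have hex : ∀ n, ∃ O, IsOpen O ∧ B n ∩ Ω ⊆ O ∧ O ⊆ Ω ∧
        capOpen p O ^ (1 / 2 : ℝ) ≤ cap p (B n ∩ Ω) ^ (1 / 2 : ℝ) + ε' n := by
      intro n
      have hne : cap p (B n ∩ Ω) ^ (1 / 2 : ℝ) ≠ ⊤ := ENNReal.ne_top_of_tsum_ne_top hlt.ne n
      have h1 : cap p (B n ∩ Ω) ^ (1 / 2 : ℝ) < cap p (B n ∩ Ω) ^ (1 / 2 : ℝ) + ε' n :=
        ENNReal.lt_add_right hne (hε' n).ne'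
      rw [← ENNReal.lt_rpow_inv_iff (by norm_num : (0 : ℝ) < 1 / 2)] at h1
      obtain ⟨O, hO, hBO, hOΩ, hlt⟩ := exists_open_of_cap_lt h1
      refine ⟨O, hO, hBO, hOΩ, ?_⟩
      rw [← ENNReal.le_rpow_inv_iff (by norm_num : (0 : ℝ) < 1 / 2)]
      exact hlt.le
    choose O hO hBO hOΩ hle using hex
    calc cap p ((⋃ n, B n) ∩ Ω) ^ (1 / 2 : ℝ) ≤ capOpen p (⋃ n, O n) ^ (1 / 2 : ℝ) := by
          gcongr
          refine cap_le_capOpen (isOpen_iUnion hO) ?_ (iUnion_subset hOΩ)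
          rw [iUnion_inter]
          exact iUnion_mono hBO
      _ ≤ ∑' n, capOpen p (O n) ^ (1 / 2 : ℝ) := hp.capOpen_iUnion_le hO hOΩ
      _ ≤ ∑' n, (cap p (B n ∩ Ω) ^ (1 / 2 : ℝ) + ε' n) := ENNReal.tsum_le_tsum hle
      _ = ∑' n, cap p (B n ∩ Ω) ^ (1 / 2 : ℝ) + ∑' n, ε' n := ENNReal.tsum_add
      _ ≤ _ := by gcongr

lemma capOuter_apply (hp : IsRegularForm p) (B : Set (Eucl d)) :
    hp.capOuter B = cap p (B ∩ Ω) ^ (1 / 2 : ℝ) := rfl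

lemma capOuter_eq_zero_iff (hp : IsRegularForm p) {B : Set (Eucl d)} :
    hp.capOuter B = 0 ↔ cap p (B ∩ Ω) = 0 := by
  rw [capOuter_apply, ENNReal.rpow_eq_zero_iff_of_pos (by norm_num)]

lemma capOuter_eq_zero_iff_of_subset (hp : IsRegularForm p) {B : Set (Eucl d)} (hB : B ⊆ Ω) :
    hp.capOuter B = 0 ↔ cap p B = 0 := by
  rw [capOuter_eq_zero_iff, inter_eq_left.2 hB]

lemma capOuter_compl (hp : IsRegularForm p) : hp.capOuter Ωᶜ = 0 := by
  rw [hp.capOuter_eq_zero_iff, compl_inter_self,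
    cap_eq_capOpen isOpen_empty (empty_subset _), hp.capOpen_empty]

lemma ae_mem (hp : IsRegularForm p) : ∀ᵐ x ∂hp.capOuter, x ∈ Ω := hp.capOuter_compl

lemma quasiEverywhere_iff (hp : IsRegularForm p) {P : Eucl d → Prop} :
    QuasiEverywhere p P ↔ ∀ᵐ x ∂hp.capOuter, P x := by
  rw [ae_iff]
  constructor
  · rintro ⟨A, hA, hA0, h⟩
    rw [← hp.capOuter_eq_zero_iff_of_subset hA] at hA0
    refine measure_mono_null ?_ (measure_union_null hA0 hp.capOuter_compl)
    intro x hx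
    by_cases hxΩ : x ∈ Ω
    · left
      by_contra hxA
      exact hx (h x ⟨hxΩ, hxA⟩)
    · exact Or.inr hxΩ
  · intro h
    refine ⟨{x | ¬P x} ∩ Ω, inter_subset_right, hp.capOuter_eq_zero_iff.1 h, fun x hx => ?_⟩
    by_contra hP
    exact hx.2 ⟨hP, hx.1⟩

end IsRegularForm

namespace IsRegularForm

/-! ### Quasi continuity -/

lemma capOuter_open (hp : IsRegularForm p) {O : Set (Eucl d)} (hO : IsOpen O) (hOΩ : O ⊆ Ω) :
    hp.capOuter O = capOpen p O ^ (1 / 2 : ℝ) := by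
  rw [capOuter_apply, inter_eq_left.2 hOΩ, cap_eq_capOpen hO hOΩ]

lemma exists_open_of_capOuter_lt (hp : IsRegularForm p) {B : Set (Eucl d)} {c : ℝ≥0∞}
    (h : hp.capOuter B < c) : ∃ O ⊆ Ω, IsOpen O ∧ B ∩ Ω ⊆ O ∧ hp.capOuter O < c := by
  rw [capOuter_apply, ← ENNReal.lt_rpow_inv_iff (by norm_num : (0 : ℝ) < 1 / 2)] at h
  obtain ⟨O, hO, hBO, hOΩ, hlt⟩ := exists_open_of_cap_lt h
  refine ⟨O, hOΩ, hO, hBO, ?_⟩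
  rwa [hp.capOuter_open hO hOΩ, ← ENNReal.lt_rpow_inv_iff (by norm_num : (0 : ℝ) < 1 / 2)]

lemma cap_lt_iff (hp : IsRegularForm p) {O : Set (Eucl d)} (hOΩ : O ⊆ Ω) {ε : ℝ≥0∞} :
    cap p O < ε ↔ hp.capOuter O < ε ^ (1 / 2 : ℝ) := by
  rw [capOuter_apply, inter_eq_left.2 hOΩ, ENNReal.rpow_lt_rpow_iff (by norm_num)]

lemma rpow_half_pos {ε : ℝ≥0∞} (hε : 0 < ε) : 0 < ε ^ (1 / 2 : ℝ) :=
  ENNReal.rpow_pos_of_nonneg hε (by norm_num)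

/-- Passing to the square root of the capacity merely replaces `ε` by `ε²` and gives access to
subadditivity. -/
lemma quasiContinuous_iff (hp : IsRegularForm p) {w : Eucl d → ℝ} :
    QuasiContinuous p w ↔
      ∀ ε > 0, ∃ O ⊆ Ω, IsOpen O ∧ hp.capOuter O < ε ∧ ContinuousOn w (Ω \ O) := by
  constructor
  · intro h ε hε
    obtain ⟨O, h1, h2, h3, h4⟩ := h (ε ^ (2 : ℝ)) (ENNReal.rpow_pos_of_nonneg hε (by norm_num))
    rw [hp.cap_lt_iff h1, ← ENNReal.rpow_mul] at h3
    norm_num at h3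
    exact ⟨O, h1, h2, h3, h4⟩
  · intro h ε hε
    obtain ⟨O, h1, h2, h3, h4⟩ := h _ (rpow_half_pos hε)
    exact ⟨O, h1, h2, (hp.cap_lt_iff h1).2 h3, h4⟩

lemma quasiOpen_iff (hp : IsRegularForm p) {A : Set (Eucl d)} :
    QuasiOpen p A ↔
      A ⊆ Ω ∧ ∀ ε > 0, ∃ O ⊆ Ω, IsOpen O ∧ IsOpen (A ∪ O) ∧ hp.capOuter O < ε := by
  refine and_congr_right fun _ => ?_
  constructor
  · intro h ε hε
    obtain ⟨O, h1, h2, h3, h4⟩ := h (ε ^ (2 : ℝ)) (ENNReal.rpow_pos_of_nonneg hε (by norm_num))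
    rw [hp.cap_lt_iff h1, ← ENNReal.rpow_mul] at h4
    norm_num at h4
    exact ⟨O, h1, h2, h3, h4⟩
  · intro h ε hε
    obtain ⟨O, h1, h2, h3, h4⟩ := h _ (rpow_half_pos hε)
    exact ⟨O, h1, h2, h3, (hp.cap_lt_iff h1).2 h4⟩

lemma quasiContinuous_of_continuous (hp : IsRegularForm p) {w : Eucl d → ℝ} (hw : Continuous w) :
    QuasiContinuous p w := by
  rw [hp.quasiContinuous_iff]
  exact fun ε hε => ⟨∅, empty_subset _, isOpen_empty, by simpa using hε, hw.continuousOn⟩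

lemma quasiContinuous_comp₂ (hp : IsRegularForm p) {u v : Eucl d → ℝ} (hu : QuasiContinuous p u)
    (hv : QuasiContinuous p v) {F : ℝ → ℝ → ℝ} (hF : Continuous fun q : ℝ × ℝ => F q.1 q.2) :
    QuasiContinuous p fun x => F (u x) (v x) := by
  rw [hp.quasiContinuous_iff] at hu hv ⊢
  intro ε hε
  have hε2 : 0 < ε / 2 := ENNReal.half_pos hε.ne'
  obtain ⟨O, h1, h2, h3, h4⟩ := hu _ hε2
  obtain ⟨O', h1', h2', h3', h4'⟩ := hv _ hε2
  refine ⟨O ∪ O', union_subset h1 h1', h2.union h2', ?_, ?_⟩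
  · calc hp.capOuter (O ∪ O') ≤ hp.capOuter O + hp.capOuter O' := measure_union_le _ _
      _ < ε / 2 + ε / 2 := ENNReal.add_lt_add h3 h3'
      _ = ε := ENNReal.add_halves ε
  · have a := h4.mono (sdiff_subset_sdiff_right (subset_union_left (s := O) (t := O')) (s := Ω))
    have b := h4'.mono (sdiff_subset_sdiff_right (subset_union_right (s := O) (t := O')) (s := Ω))
    exact hF.comp_continuousOn (a.prodMk b)

/-- Exceptional sets can be absorbed into the open sets in the definition of quasi continuity. -/
lemma exists_open_continuousOn (hp : IsRegularForm p) {w : Eucl d → ℝ}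
    (hw : QuasiContinuous p w) {N : Set (Eucl d)} (hN : hp.capOuter N = 0) {ε : ℝ≥0∞}
    (hε : 0 < ε) :
    ∃ O ⊆ Ω, IsOpen O ∧ N ∩ Ω ⊆ O ∧ hp.capOuter O < ε ∧ ContinuousOn w (Ω \ O) := by
  rw [hp.quasiContinuous_iff] at hw
  have hε2 : 0 < ε / 2 := ENNReal.half_pos hε.ne'
  obtain ⟨O, h1, h2, h3, h4⟩ := hw _ hε2
  obtain ⟨O', h1', h2', h3', h4'⟩ := hp.exists_open_of_capOuter_lt (hN ▸ hε2)
  refine ⟨O ∪ O', union_subset h1 h1', h2.union h2', h3'.trans subset_union_right, ?_,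
    h4.mono (sdiff_subset_sdiff_right subset_union_left)⟩
  calc hp.capOuter (O ∪ O') ≤ hp.capOuter O + hp.capOuter O' := measure_union_le _ _
    _ < ε / 2 + ε / 2 := ENNReal.add_lt_add h3 h4'
    _ = ε := ENNReal.add_halves ε

/-- A preimage that is open relative to `Ω \ O` becomes open after adding `O`. Level sets of quasi
continuous functions are thereby enlarged to open sets, for which almost everywhere bounds control
the capacity. -/
lemma isOpen_inter_preimage_union {w : Eucl d → ℝ} (hΩ : IsOpen Ω) {U O : Set (Eucl d)}
    (hU : IsOpen U) (hO : IsOpen O) (hw : ContinuousOn w (Ω \ O)) {T : Set ℝ} (hT : IsOpen T) :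
    IsOpen ((U ∩ Ω ∩ w ⁻¹' T) ∪ O) := by
  obtain ⟨V, hV, hVeq⟩ := continuousOn_iff'.1 hw T hT
  have : (U ∩ Ω ∩ w ⁻¹' T) ∪ O = (U ∩ Ω ∩ V) ∪ O := by
    ext x
    have h := congrArg (x ∈ ·) hVeq
    simp only [mem_inter_iff, Set.mem_sdiff, eq_iff_iff] at h
    simp only [mem_union, mem_inter_iff]
    tauto
  rw [this]
  exact ((hU.inter hΩ).inter hV).union hO

/-- The capacitary potential, with the norm compared to the outer measure. -/
lemma exists_nonneg_potential (hp : IsRegularForm p) {O : Set (Eucl d)} (hO : IsOpen O)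
    (hOΩ : O ⊆ Ω) (hfin : hp.capOuter O ≠ ⊤) :
    ∃ w, MemSobolev p w ∧ (∀ x, 0 ≤ w x) ∧ (∀ᵐ x ∂volume.restrict Ω, x ∈ O → 1 ≤ w x) ∧
      ENNReal.ofReal √(p.normSq w) ≤ hp.capOuter O := by
  rw [hp.capOuter_open hO hOΩ] at hfin ⊢
  have hfin' : capOpen p O ≠ ⊤ := by
    intro h
    rw [h, ENNReal.top_rpow_of_pos (by norm_num)] at hfin
    exact hfin rfl
  obtain ⟨w, hw, hw1, hwn⟩ := hp.exists_potential hO hfin'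
  refine ⟨fun x => |w x|, hp.memSobolev_abs hw, fun x => abs_nonneg _, ?_, ?_⟩
  · filter_upwards [hw1] with x hx hxO
    exact (hx hxO).trans (le_abs_self _)
  · rw [← hp.rpow_half_ofReal_normSq (hp.memSobolev_abs hw).1]
    gcongr
    exact (ENNReal.ofReal_le_ofReal (hp.abs hw.1).2).trans hwn

lemma capOuter_le_of_open (hp : IsRegularForm p) {U : Set (Eucl d)} (hU : IsOpen U) (hUΩ : U ⊆ Ω)
    {u : Eucl d → ℝ} (hu : MemSobolev p u) (h1 : ∀ᵐ x ∂volume.restrict Ω, x ∈ U → 1 ≤ |u x|) :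
    hp.capOuter U ≤ ENNReal.ofReal √(p.normSq u) := by
  rw [hp.capOuter_open hU hUΩ, ← hp.rpow_half_ofReal_normSq hu.1]
  gcongr
  exact hp.capOpen_le_normSq hU hUΩ hu h1

/-- A quasi continuous function that is nonnegative almost everywhere on an open set is
nonnegative quasi everywhere there. -/
lemma quasi_nonneg_of_ae (hp : IsRegularForm p) {w : Eucl d → ℝ} (hw : QuasiContinuous p w)
    {U : Set (Eucl d)} (hU : IsOpen U)
    (h : ∀ᵐ x ∂volume.restrict Ω, x ∈ U → 0 ≤ w x) :
    ∀ᵐ x ∂hp.capOuter, x ∈ U → 0 ≤ w x := by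
  rw [ae_iff]
  refine le_antisymm (ENNReal.le_of_forall_pos_le_add fun ε hε _ => ?_) zero_le
  have hε0 : (0 : ℝ≥0∞) < ε := ENNReal.coe_pos.2 hε
  obtain ⟨O, hOΩ, hO, -, hOε, hcont⟩ :=
    hp.exists_open_continuousOn hw (measure_empty (μ := hp.capOuter)) hε0
  obtain ⟨v, hv, hv0, hv1, hvn⟩ := hp.exists_nonneg_potential hO hOΩ hOε.ne_top
  have hVopen := isOpen_inter_preimage_union hp.isOpen hU hO hcont (isOpen_Iio (a := (0 : ℝ)))
  have hVΩ : (U ∩ Ω ∩ w ⁻¹' Iio 0) ∪ O ⊆ Ω :=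
    union_subset (inter_subset_left.trans inter_subset_right) hOΩ
  -- The set `U ∩ {w < 0}` is Lebesgue null, so the potential `v` of `O` is at least `1` almost
  -- everywhere on the larger open set too. Adding the exceptional set costs nothing beyond the norm
  -- of `v`.
  have hle := hp.capOuter_le_of_open hVopen hVΩ hv (by
    filter_upwards [h, hv1] with x hx hx1 hxV
    rcases hxV with ⟨⟨hxU, -⟩, hxw⟩ | hxO
    · exact absurd (hx hxU) (not_le.2 hxw)
    · exact (hx1 hxO).trans (le_abs_self _))
  have hsub : {x | ¬(x ∈ U → 0 ≤ w x)} ⊆ ((U ∩ Ω ∩ w ⁻¹' Iio 0) ∪ O) ∪ Ωᶜ := by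
    intro x hx
    have hx' : x ∈ U ∧ w x < 0 := by simpa using hx
    by_cases hxΩ : x ∈ Ω
    · exact Or.inl (Or.inl ⟨⟨hx'.1, hxΩ⟩, hx'.2⟩)
    · exact Or.inr hxΩ
  rw [zero_add]
  calc _ ≤ hp.capOuter (((U ∩ Ω ∩ w ⁻¹' Iio 0) ∪ O) ∪ Ωᶜ) := measure_mono hsub
    _ ≤ hp.capOuter ((U ∩ Ω ∩ w ⁻¹' Iio 0) ∪ O) + hp.capOuter Ωᶜ := measure_union_le _ _
    _ ≤ ε := by
      rw [hp.capOuter_compl, add_zero]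
      exact (hle.trans hvn).trans hOε.le

/-- Sets of capacity zero are Lebesgue null. -/
lemma volume_eq_zero (hp : IsRegularForm p) {N : Set (Eucl d)} (hN : hp.capOuter N = 0) :
    volume.restrict Ω N = 0 := by
  obtain ⟨C, hC, hcoer⟩ := hp.coercive
  have key : ∀ ε : ℝ≥0∞, 0 < ε → ε ≠ ⊤ →
      volume.restrict Ω N ^ (1 / 2 : ℝ) ≤ ENNReal.ofReal C * ε := by
    intro ε hε hεt
    obtain ⟨O, hOΩ, hO, hNO, hOε⟩ := hp.exists_open_of_capOuter_lt (hN ▸ hε)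
    obtain ⟨v, hv, hv0, hv1, hvn⟩ := hp.exists_nonneg_potential hO hOΩ hOε.ne_top
    have h1 : eLpNorm (O.indicator fun _ => (1 : ℝ)) 2 (volume.restrict Ω)
        ≤ eLpNorm v 2 (volume.restrict Ω) := by
      refine eLpNorm_mono_ae_real ?_
      filter_upwards [hv1] with x hx
      by_cases hxO : x ∈ O
      · simpa [hxO] using hx hxO
      · simpa [hxO] using hv0 x
    rw [eLpNorm_indicator_const hO.measurableSet (by norm_num) (by norm_num)] at h1
    have h2 : volume.restrict Ω N ≤ volume.restrict Ω O := by
      have h3 : N ⊆ O ∪ Ωᶜ := by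
        intro x hx
        by_cases hxΩ : x ∈ Ω
        · exact Or.inl (hNO ⟨hx, hxΩ⟩)
        · exact Or.inr hxΩ
      refine (measure_mono h3).trans ((measure_union_le _ _).trans ?_)
      rw [Measure.restrict_apply hp.isOpen.measurableSet.compl, compl_inter_self, measure_empty,
        add_zero]
    calc volume.restrict Ω N ^ (1 / 2 : ℝ) ≤ volume.restrict Ω O ^ (1 / 2 : ℝ) := by gcongr
      _ ≤ eLpNorm v 2 (volume.restrict Ω) := by simpa using h1
      _ ≤ ENNReal.ofReal (C * √(p.normSq v)) := hcoer hv.1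
      _ = ENNReal.ofReal C * ENNReal.ofReal √(p.normSq v) := ENNReal.ofReal_mul hC.le
      _ ≤ ENNReal.ofReal C * ε := by
        gcongr
        exact hvn.trans hOε.le
  have h0 : volume.restrict Ω N ^ (1 / 2 : ℝ) = 0 := by
    refine le_antisymm ?_ zero_le
    have hlim : Tendsto (fun n : ℕ => ENNReal.ofReal C * ((n : ℝ≥0∞) + 1)⁻¹) atTop
        (𝓝 (ENNReal.ofReal C * 0)) := by
      refine ENNReal.Tendsto.const_mul ?_ (Or.inr ENNReal.ofReal_ne_top)
      have := ENNReal.tendsto_inv_nat_nhds_zero.comp (tendsto_add_atTop_nat 1)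
      refine this.congr fun n => ?_
      simp
    rw [mul_zero] at hlim
    exact ge_of_tendsto' hlim fun n => key _ (by simp) (by simp)
  rwa [ENNReal.rpow_eq_zero_iff_of_pos (by norm_num)] at h0

lemma ae_of_quasi (hp : IsRegularForm p) {P : Eucl d → Prop} (h : ∀ᵐ x ∂hp.capOuter, P x) :
    ∀ᵐ x ∂volume.restrict Ω, P x :=
  hp.volume_eq_zero h

/-- The capacitary weak type inequality. -/
lemma capOuter_le (hp : IsRegularForm p) {w : Eucl d → ℝ} (hw : w ∈ W p) {B : Set (Eucl d)}
    (hB : ∀ᵐ x ∂hp.capOuter, x ∈ B → 1 ≤ |w x|) :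
    hp.capOuter B ≤ ENNReal.ofReal (2 * √(p.normSq w)) := by
  refine ENNReal.le_of_forall_pos_le_add fun ε hε _ => ?_
  have hε0 : (0 : ℝ≥0∞) < ε := ENNReal.coe_pos.2 hε
  obtain ⟨O, hOΩ, hO, hNO, hOε, hcont⟩ := hp.exists_open_continuousOn hw.2 hB hε0
  obtain ⟨v, hv, hv0, hv1, hvn⟩ := hp.exists_nonneg_potential hO hOΩ hOε.ne_top
  -- Lowering the level from `≥ 1` to `> 1/2` gives a set that is open up to `O`; this costs the
  -- factor `2` in the conclusion.
  have hVopen := isOpen_inter_preimage_union hp.isOpen isOpen_univ hO hcont.abs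
    (isOpen_Ioi (a := (1 / 2 : ℝ)))
  set V := (univ ∩ Ω ∩ (fun x => |w x|) ⁻¹' Ioi (1 / 2)) ∪ O with hV
  have hVΩ : V ⊆ Ω := union_subset (inter_subset_left.trans inter_subset_right) hOΩ
  have h2w := hp.memSobolev_smul 2 (hp.memSobolev_abs hw.1)
  have hle := hp.capOuter_le_of_open hVopen hVΩ (hp.memSobolev_add h2w hv) (by
    filter_upwards [hv1] with x hx hxV
    refine le_trans ?_ (le_abs_self _)
    simp only [Pi.add_apply, Pi.smul_apply, smul_eq_mul]
    rcases hxV with ⟨-, hxw⟩ | hxO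
    · have : 1 / 2 < |w x| := hxw
      linarith [hv0 x]
    · linarith [hx hxO, abs_nonneg (w x)])
  have hsub : B ⊆ V ∪ Ωᶜ := by
    intro x hx
    by_cases hxΩ : x ∈ Ω
    · left
      by_cases hxO : x ∈ O
      · exact Or.inr hxO
      · left
        refine ⟨⟨mem_univ _, hxΩ⟩, ?_⟩
        have : 1 ≤ |w x| := by
          by_contra hcon
          exact hxO (hNO ⟨fun h => hcon (h hx), hxΩ⟩)
        show 1 / 2 < |w x|
        linarith
    · exact Or.inr hxΩ
  calc hp.capOuter B ≤ hp.capOuter V + hp.capOuter Ωᶜ :=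
        (measure_mono hsub).trans (measure_union_le _ _)
    _ ≤ ENNReal.ofReal √(p.normSq (((2 : ℝ) • fun x => |w x|) + v)) := by
        rw [hp.capOuter_compl, add_zero]
        exact hle
    _ ≤ ENNReal.ofReal (2 * √(p.normSq w) + √(p.normSq v)) := by
        refine ENNReal.ofReal_le_ofReal ?_
        have h1 := hp.sqrt_normSq_add_le h2w.1 hv.1
        rw [hp.normSq_smul 2 (hp.memSobolev_abs hw.1).1, Real.sqrt_mul (by norm_num),
          Real.sqrt_sq (by norm_num)] at h1
        have h3 := Real.sqrt_le_sqrt (hp.abs hw.1.1).2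
        linarith
    _ = ENNReal.ofReal (2 * √(p.normSq w)) + ENNReal.ofReal √(p.normSq v) :=
        ENNReal.ofReal_add (by positivity) (by positivity)
    _ ≤ _ := by
        gcongr
        exact hvn.trans hOε.le

/-! ### The lattice structure of `W` -/

lemma W_test (hp : IsRegularForm p) {φ : Eucl d → ℝ} (hφ : φ ∈ testFunctions Ω) : φ ∈ W p :=
  ⟨hp.memSobolev_test hφ, hp.quasiContinuous_of_continuous hφ.1.continuous⟩

lemma W_smul (hp : IsRegularForm p) (c : ℝ) {u : Eucl d → ℝ} (hu : u ∈ W p) : c • u ∈ W p :=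
  ⟨hp.memSobolev_smul c hu.1,
    hp.quasiContinuous_comp₂ hu.2 hu.2 (F := fun a _ => c * a) (by fun_prop)⟩

lemma W_sub (hp : IsRegularForm p) {u v : Eucl d → ℝ} (hu : u ∈ W p) (hv : v ∈ W p) :
    u - v ∈ W p :=
  ⟨hp.memSobolev_sub hu.1 hv.1,
    hp.quasiContinuous_comp₂ hu.2 hv.2 (F := fun a b => a - b) (by fun_prop)⟩

lemma W_posPart (hp : IsRegularForm p) {u : Eucl d → ℝ} (hu : u ∈ W p) :
    (fun x => max (u x) 0) ∈ W p :=
  ⟨hp.memSobolev_posPart hu.1,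
    hp.quasiContinuous_comp₂ hu.2 hu.2 (F := fun a _ => max a 0) (by fun_prop)⟩

lemma W_min (hp : IsRegularForm p) {u v : Eucl d → ℝ} (hu : u ∈ W p) (hv : v ∈ W p) :
    (fun x => min (u x) (v x)) ∈ W p := by
  have h : (fun x => min (u x) (v x)) = u - fun x => max ((u - v) x) 0 := by
    ext x
    simp only [Pi.sub_apply]
    rcases le_total (u x) (v x) with h | h
    · rw [min_eq_left h, max_eq_right (by linarith), sub_zero]
    · rw [min_eq_right h, max_eq_left (by linarith), sub_sub_cancel]
  rw [h]
  exact hp.W_sub hu (hp.W_posPart (hp.W_sub hu hv))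

/-- The weak type inequality at level `r`. -/
lemma capOuter_level_le (hp : IsRegularForm p) {w : Eucl d → ℝ} (hw : w ∈ W p) {r : ℝ}
    (hr : 0 < r) :
    hp.capOuter {x | r ≤ |w x|} ≤ ENNReal.ofReal (2 * √(p.normSq w) / r) := by
  have h := hp.capOuter_le (hp.W_smul r⁻¹ hw) (B := {x | r ≤ |w x|}) (Eventually.of_forall ?_)
  · rw [hp.normSq_smul _ hw.1.1, Real.sqrt_mul (by positivity),
      Real.sqrt_sq (by positivity)] at h
    convert h using 2
    field_simp
  · intro x hx
    simp only [Pi.smul_apply, smul_eq_mul, abs_mul, abs_inv, abs_of_pos hr]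
    rw [inv_mul_eq_div, le_div_iff₀ hr, one_mul]
    exact hx

/-- Rapid convergence in norm implies convergence quasi everywhere. -/
lemma tendsto_zero_of_rapid (hp : IsRegularForm p) {v : ℕ → Eucl d → ℝ} (hv : ∀ n, v n ∈ W p)
    (hn : ∀ n, √(p.normSq (v n)) ≤ (1 / 4) ^ n) :
    ∀ᵐ x ∂hp.capOuter, Tendsto (fun n => v n x) atTop (𝓝 0) := by
  -- Norm `(1/4)^n` at level `(1/2)^n` gives outer measure at most `2 (1/2)^n`, which is summable:
  -- Borel–Cantelli applies to `capOuter`.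
  set B : ℕ → Set (Eucl d) := fun n => {x | (1 / 2 : ℝ) ^ n ≤ |v n x|} with hB
  have hBn : ∀ n, hp.capOuter (B n) ≤ ENNReal.ofReal (2 * (1 / 2) ^ n) := by
    intro n
    refine (hp.capOuter_level_le (hv n) (by positivity)).trans (ENNReal.ofReal_le_ofReal ?_)
    rw [div_le_iff₀ (by positivity), mul_assoc, ← mul_pow]
    norm_num
    simpa using hn n
  have hsum : ∑' n, hp.capOuter (B n) ≠ ⊤ := by
    refine ne_top_of_le_ne_top ?_ (ENNReal.tsum_le_tsum hBn)
    have hs : Summable fun n : ℕ => 2 * (1 / 2 : ℝ) ^ n := summable_geometric_two.mul_left 2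
    rw [← ENNReal.ofReal_tsum_of_nonneg (fun n => by positivity) hs]
    exact ENNReal.ofReal_ne_top
  have h0 := measure_limsup_atTop_eq_zero hsum
  have hae : ∀ᵐ x ∂hp.capOuter, x ∉ limsup B atTop := by
    rw [ae_iff]
    simpa using h0
  filter_upwards [hae] with x hx
  rw [mem_limsup_iff_frequently_mem, not_frequently] at hx
  refine squeeze_zero_norm' (hx.mono fun n hn => ?_)
    (tendsto_pow_atTop_nhds_zero_of_lt_one (by norm_num) (by norm_num : (1 / 2 : ℝ) < 1))
  exact (not_le.1 hn).le

/-- A sequence that converges in norm has a subsequence that converges quasi everywhere. -/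
lemma exists_subseq_tendsto (hp : IsRegularForm p) {f : ℕ → Eucl d → ℝ} {w : Eucl d → ℝ}
    (hf : ∀ n, f n ∈ W p) (hw : w ∈ W p)
    (h : Tendsto (fun n => p.normSq (f n - w)) atTop (𝓝 0)) :
    ∃ k : ℕ → ℕ, StrictMono k ∧
      ∀ᵐ x ∂hp.capOuter, Tendsto (fun n => f (k n) x) atTop (𝓝 (w x)) := by
  have h1 : Tendsto (fun n => √(p.normSq (f n - w))) atTop (𝓝 0) := by
    have := (Real.continuous_sqrt.tendsto 0).comp h
    rwa [Real.sqrt_zero] at this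
  obtain ⟨k, hk, hkn⟩ := extraction_forall_of_eventually
    (P := fun n m => √(p.normSq (f m - w)) ≤ (1 / 4) ^ n)
    (fun n => ((tendsto_order.1 h1).2 ((1 / 4) ^ n) (by positivity)).mono fun m hm => hm.le)
  refine ⟨k, hk, ?_⟩
  filter_upwards [hp.tendsto_zero_of_rapid (fun n => hp.W_sub (hf (k n)) hw) hkn] with x hx
  have := hx.add_const (w x)
  simpa using this

/-- Every element of the Sobolev space has a quasi continuous representative. -/
lemma exists_representative (hp : IsRegularForm p) {w : Eucl d → ℝ} (hw : MemSobolev p w) :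
    ∃ v ∈ W p, w =ᵐ[volume.restrict Ω] v := by
  -- The rate makes consecutive differences have norm at most `(1/4)^n`, so that the sets where they
  -- exceed `(1/2)^n` have summable outer measure.
  obtain ⟨φ, hφ, hlt, hlim⟩ := hp.exists_seq_test hw (ε := fun n : ℕ => ((1 / 4) ^ n / 2) ^ 2)
    (fun n => by positivity) (by
      have h1 : Tendsto (fun n : ℕ => (1 / 4 : ℝ) ^ n) atTop (𝓝 0) :=
        tendsto_pow_atTop_nhds_zero_of_lt_one (by norm_num) (by norm_num)
      simpa using (h1.div_const 2).pow 2)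
  have hsq : ∀ n, √(p.normSq (w - φ n)) ≤ (1 / 4) ^ n / 2 := fun n => by
    rw [Real.sqrt_le_left (by positivity)]
    exact (hlt n).le
  have hstep : ∀ n, √(p.normSq (φ (n + 1) - φ n)) ≤ (1 / 4) ^ n := by
    intro n
    have h1 := hp.sqrt_normSq_add_le (hp.sub (hp.test (hφ (n + 1))) hw.1)
      (hp.sub hw.1 (hp.test (hφ n)))
    rw [sub_add_sub_cancel, hp.normSq_sub_comm (hp.test (hφ (n + 1))) hw.1] at h1
    have h2 := hsq n
    have h3 := hsq (n + 1)
    have h4 : (1 / 4 : ℝ) ^ (n + 1) ≤ (1 / 4) ^ n :=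
      pow_le_pow_of_le_one (by norm_num) (by norm_num) (Nat.le_succ n)
    linarith
  -- Outside every `O j` the sequence converges uniformly. The arbitrary value of `limUnder` can
  -- matter only in `⋂ j, O j` or outside `Ω`, and both are negligible.
  set v : Eucl d → ℝ := fun x => limUnder atTop (fun n => φ n x) with hv
  set B : ℕ → Set (Eucl d) := fun n => {x | x ∈ Ω ∧ (1 / 2 : ℝ) ^ n < |φ (n + 1) x - φ n x|}
    with hB
  have hBopen : ∀ n, IsOpen (B n) := fun n => hp.isOpen.inter (isOpen_lt continuous_const
    (((hφ (n + 1)).1.continuous.sub (hφ n).1.continuous).abs))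
  set O : ℕ → Set (Eucl d) := fun j => ⋃ n, B (n + j) with hO
  have hBn : ∀ n, hp.capOuter (B n) ≤ ENNReal.ofReal (2 * (1 / 2) ^ n) := by
    intro n
    refine (measure_mono (fun x hx => ?_)).trans
      ((hp.capOuter_level_le (hp.W_sub (hp.W_test (hφ (n + 1))) (hp.W_test (hφ n)))
        (r := (1 / 2) ^ n) (by positivity)).trans (ENNReal.ofReal_le_ofReal ?_))
    · exact hx.2.le
    · rw [div_le_iff₀ (by positivity), mul_assoc, ← mul_pow]
      norm_num
      simpa using hstep n
  have hOcap : ∀ j, hp.capOuter (O j) ≤ ENNReal.ofReal (4 * (1 / 2) ^ j) := by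
    intro j
    have hs : Summable fun n : ℕ => 2 * (1 / 2 : ℝ) ^ (n + j) := by
      simp only [pow_add, ← mul_assoc]
      exact (summable_geometric_two.mul_left 2).mul_right _
    calc hp.capOuter (O j) ≤ ∑' n, hp.capOuter (B (n + j)) := measure_iUnion_le _
      _ ≤ ∑' n, ENNReal.ofReal (2 * (1 / 2) ^ (n + j)) := ENNReal.tsum_le_tsum fun n => hBn _
      _ = ENNReal.ofReal (∑' n : ℕ, 2 * (1 / 2) ^ (n + j)) :=
        (ENNReal.ofReal_tsum_of_nonneg (fun n => by positivity) hs).symm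
      _ = _ := by
        congr 1
        simp only [pow_add, ← mul_assoc]
        rw [tsum_mul_right, tsum_mul_left, tsum_geometric_two]
        norm_num
  have hdist : ∀ j, ∀ x ∈ Ω \ O j, ∀ n,
      dist (φ (n + j) x) (φ (n + 1 + j) x) ≤ (2 * (1 / 2) ^ j) / 2 / 2 ^ n := by
    intro j x hx n
    have h1 : x ∉ B (n + j) := fun h => hx.2 (mem_iUnion.2 ⟨n, h⟩)
    have h2 : |φ (n + j + 1) x - φ (n + j) x| ≤ (1 / 2) ^ (n + j) := by
      by_contra hcon
      exact h1 ⟨hx.1, not_le.1 hcon⟩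
    rw [dist_comm, Real.dist_eq, add_right_comm n 1 j]
    refine h2.trans (le_of_eq ?_)
    rw [pow_add, one_div_pow 2 n]
    field_simp
  have htend : ∀ j, ∀ x ∈ Ω \ O j, Tendsto (fun n => φ n x) atTop (𝓝 (v x)) := by
    intro j x hx
    have hc : CauchySeq fun n => φ (n + j) x := cauchySeq_of_le_geometric_two (hdist j x hx)
    obtain ⟨a, ha⟩ := cauchySeq_tendsto_of_complete hc
    exact tendsto_nhds_limUnder ⟨a, (tendsto_add_atTop_iff_nat j).1 ha⟩
  have hunif : ∀ j, TendstoUniformlyOn (fun n x => φ (n + j) x) v atTop (Ω \ O j) := by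
    intro j
    rw [Metric.tendstoUniformlyOn_iff]
    intro ε hε
    have hlim : Tendsto (fun n : ℕ => (2 * (1 / 2 : ℝ) ^ j) / 2 ^ n) atTop (𝓝 0) :=
      tendsto_const_nhds.div_atTop (tendsto_pow_atTop_atTop_of_one_lt (by norm_num))
    filter_upwards [(tendsto_order.1 hlim).2 ε hε] with n hn x hx
    rw [dist_comm]
    exact (dist_le_of_le_geometric_two_of_tendsto (f := fun n => φ (n + j) x) (hdist j x hx)
      ((htend j x hx).comp (tendsto_add_atTop_nat j)) n).trans_lt hn
  have hOlim : Tendsto (fun j : ℕ => ENNReal.ofReal (4 * (1 / 2) ^ j)) atTop (𝓝 0) := by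
    have h1 : Tendsto (fun n : ℕ => (1 / 2 : ℝ) ^ n) atTop (𝓝 0) :=
      tendsto_pow_atTop_nhds_zero_of_lt_one (by norm_num) (by norm_num)
    have h2 := h1.const_mul 4
    rw [mul_zero] at h2
    simpa using ENNReal.tendsto_ofReal h2
  have hvqc : QuasiContinuous p v := by
    rw [hp.quasiContinuous_iff]
    intro ε hε
    obtain ⟨j, hj⟩ := ((tendsto_order.1 hOlim).2 ε hε).exists
    refine ⟨O j, iUnion_subset fun n x hx => hx.1, isOpen_iUnion fun n => hBopen _,
      (hOcap j).trans_lt hj, ?_⟩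
    exact (hunif j).continuousOn (Frequently.of_forall fun n => (hφ _).1.continuous.continuousOn)
  have hnull : hp.capOuter (⋂ j, O j) = 0 :=
    le_antisymm (ge_of_tendsto' hOlim fun j => (measure_mono (iInter_subset _ j)).trans (hOcap j))
      zero_le
  have hae : w =ᵐ[volume.restrict Ω] v := by
    obtain ⟨k, hk, hkt⟩ := (tendstoInMeasure_of_tendsto_eLpNorm (by norm_num)
      (fun n => (hp.memLp (hp.test (hφ n))).1) (hp.memLp hw.1).1 hlim).exists_seq_tendsto_ae
    have h1 : ∀ᵐ x ∂volume.restrict Ω, x ∉ ⋂ j, O j := by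
      rw [ae_iff]
      simp only [not_not, Set.ofPred_mem_eq]
      exact hp.volume_eq_zero hnull
    filter_upwards [hkt, h1, hp.ae_of_quasi hp.ae_mem] with x hx hxO hxΩ
    rw [mem_iInter, not_forall] at hxO
    obtain ⟨j, hj⟩ := hxO
    exact tendsto_nhds_unique hx ((htend j x ⟨hxΩ, hj⟩).comp hk.tendsto_atTop)
  exact ⟨v, ⟨hp.memSobolev_congr hw hae, hvqc⟩, hae⟩

end IsRegularForm

/-! ### Radon measures and test functions -/

lemma extend_comp_val {φ : Eucl d → ℝ} (hφ : φ ∈ testFunctions Ω) :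
    Function.extend Subtype.val (fun x : Ω => φ x) 0 = φ := by
  ext x
  by_cases hx : x ∈ Ω
  · exact Subtype.val_injective.extend_apply (fun x : Ω => φ x) 0 (⟨x, hx⟩ : Ω)
  · rw [Function.extend_apply' _ _ _ (by rintro ⟨y, rfl⟩; exact hx y.2)]
    exact (image_eq_zero_of_notMem_tsupport fun h => hx (hφ.2.2 h)).symm

lemma hasCompactSupport_comp_val {φ : Eucl d → ℝ} (hφ : φ ∈ testFunctions Ω) :
    HasCompactSupport (fun x : Ω => φ x) := by
  have hK : IsCompact ((Subtype.val : Ω → Eucl d) ⁻¹' tsupport φ) :=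
    Topology.IsInducing.subtypeVal.isCompact_preimage' hφ.2.1 (by simpa using hφ.2.2)
  refine HasCompactSupport.of_support_subset_isCompact hK fun x hx => ?_
  exact subset_tsupport φ hx

/-- A positive linear functional on `C_c^∞(Ω)` is given by a Radon measure on `Ω`. -/
lemma exists_measure_of_positive (hΩ : IsOpen Ω) (L : (Eucl d → ℝ) → ℝ)
    (hadd : ∀ φ ∈ testFunctions Ω, ∀ ψ ∈ testFunctions Ω, L (φ + ψ) = L φ + L ψ)
    (hsmul : ∀ c : ℝ, ∀ φ ∈ testFunctions Ω, L (c • φ) = c * L φ)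
    (hpos : ∀ φ ∈ testFunctions Ω, (∀ x, 0 ≤ φ x) → 0 ≤ L φ) :
    ∃ η : Measure (Eucl d), η Ωᶜ = 0 ∧ (∀ C ⊆ Ω, IsCompact C → η C < ⊤) ∧
      ∀ φ ∈ testFunctions Ω, ∫ x, φ x ∂η = L φ := by
  have : LocallyCompactSpace Ω := hΩ.locallyCompactSpace
  set ext : (CompactlySupportedContinuousMap Ω ℝ) → Eucl d → ℝ :=
    fun f => Function.extend Subtype.val f 0 with hext
  have hext_add : ∀ f g, ext (f + g) = ext f + ext g := fun f g => by
    have := Function.extend_add (Subtype.val : Ω → Eucl d) (f : Ω → ℝ) g 0 0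
    simpa [hext] using this
  have hext_smul : ∀ (c : ℝ) f, ext (c • f) = c • ext f := fun c f => by
    have := Function.extend_smul c (Subtype.val : Ω → Eucl d) (f : Ω → ℝ) 0
    simpa [hext] using this
  -- The functional lives on the subspace of those functions in `C_c(Ω)` whose extension by zero is
  -- a test function. M. Riesz's extension theorem carries it to `C_c(Ω)` with positivity, and the
  -- Riesz–Markov–Kakutani theorem then gives the measure.
  let D : Submodule ℝ (CompactlySupportedContinuousMap Ω ℝ) :=
    { carrier := {f | ext f ∈ testFunctions Ω}
      add_mem' := fun {f g} hf hg => by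
        show ext (f + g) ∈ testFunctions Ω
        rw [hext_add]
        exact add_mem_testFunctions hf hg
      zero_mem' := by
        show ext 0 ∈ testFunctions Ω
        have h0 : ext 0 = 0 := by simpa using hext_smul 0 0
        rw [h0]
        exact zero_mem_testFunctions
      smul_mem' := fun c f hf => by
        show ext (c • f) ∈ testFunctions Ω
        rw [hext_smul]
        exact smul_mem_testFunctions hf c }
  let F : CompactlySupportedContinuousMap Ω ℝ →ₗ.[ℝ] ℝ :=
    { domain := D
      toFun :=
        { toFun := fun f => L (ext f)
          map_add' := fun f g => by
            show L (ext (f + g)) = _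
            rw [hext_add]
            exact hadd _ f.2 _ g.2
          map_smul' := fun c f => by
            show L (ext (c • f)) = _
            rw [hext_smul]
            exact hsmul c _ f.2 } }
  let res : ∀ φ, φ ∈ testFunctions Ω → CompactlySupportedContinuousMap Ω ℝ := fun φ hφ =>
    ⟨⟨fun x => φ x, hφ.1.continuous.comp continuous_subtype_val⟩, hasCompactSupport_comp_val hφ⟩
  have hres : ∀ φ (hφ : φ ∈ testFunctions Ω), ext (res φ hφ) = φ := fun φ hφ =>
    extend_comp_val hφ
  have hresD : ∀ φ (hφ : φ ∈ testFunctions Ω), res φ hφ ∈ D := fun φ hφ => by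
    show ext (res φ hφ) ∈ testFunctions Ω
    rw [hres φ hφ]
    exact hφ
  let P : PointedCone ℝ (CompactlySupportedContinuousMap Ω ℝ) :=
    { carrier := {f | ∀ x, 0 ≤ f x}
      add_mem' := fun {f g} hf hg x => add_nonneg (hf x) (hg x)
      zero_mem' := fun x => le_rfl
      smul_mem' := fun c f hf x => mul_nonneg c.2 (hf x) }
  obtain ⟨g, hg, hgpos⟩ := riesz_extension P F (by
    intro f hf
    refine hpos _ f.2 fun x => ?_
    by_cases hx : x ∈ Ω
    · have : ext (f : CompactlySupportedContinuousMap Ω ℝ) x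
          = (f : CompactlySupportedContinuousMap Ω ℝ) ⟨x, hx⟩ :=
        Subtype.val_injective.extend_apply (f : CompactlySupportedContinuousMap Ω ℝ) 0
          (⟨x, hx⟩ : Ω)
      rw [this]
      exact hf _
    · have : ext (f : CompactlySupportedContinuousMap Ω ℝ) x = 0 :=
        Function.extend_apply' _ _ _ (by rintro ⟨y, rfl⟩; exact hx y.2)
      rw [this]) (by
    intro f
    -- The cofinality condition of the extension theorem: adding `M` times a smooth cut-off that
    -- equals `1` on the support makes `f` nonnegative.
    have hK : IsCompact ((Subtype.val : Ω → Eucl d) '' tsupport f) :=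
      f.hasCompactSupport.isCompact.image continuous_subtype_val
    obtain ⟨ψ, hψ, hψ01, hψ1⟩ := exists_testFunction_eq_one hK hΩ (by
      rintro _ ⟨y, -, rfl⟩
      exact y.2)
    obtain ⟨M, hM⟩ := f.hasCompactSupport.exists_bound_of_continuous f.continuous
    have hMψ := smul_mem_testFunctions hψ M
    have hnn : ∀ x : Ω, 0 ≤ M * ψ x + f x := by
      intro x
      have h1 := hM x
      rw [Real.norm_eq_abs] at h1
      by_cases hx : x ∈ tsupport f
      · rw [hψ1 x ⟨x, hx, rfl⟩]
        linarith [neg_abs_le (f x)]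
      · rw [image_eq_zero_of_notMem_tsupport hx, add_zero]
        exact mul_nonneg ((abs_nonneg _).trans h1) (hψ01 x).1
    exact ⟨⟨res (M • ψ) hMψ, hresD (M • ψ) hMψ⟩, hnn⟩)
  let Λ : CompactlySupportedContinuousMap Ω ℝ →ₚ[ℝ] ℝ :=
    PositiveLinearMap.mk₀ g fun f hf => hgpos f fun x => hf x
  have hemb : MeasurableEmbedding (Subtype.val : Ω → Eucl d) :=
    MeasurableEmbedding.subtype_coe hΩ.measurableSet
  refine ⟨(RealRMK.rieszMeasure Λ).map Subtype.val, ?_, ?_, ?_⟩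
  · rw [hemb.map_apply]
    have : (Subtype.val : Ω → Eucl d) ⁻¹' Ωᶜ = ∅ := by
      ext x
      simp
    rw [this, measure_empty]
  · intro C hC hCc
    rw [hemb.map_apply]
    exact (Topology.IsInducing.subtypeVal.isCompact_preimage' hCc
      (by simpa using hC)).measure_lt_top
  · intro φ hφ
    rw [hemb.integral_map]
    have h1 := RealRMK.integral_rieszMeasure Λ (res φ hφ)
    have h2 : Λ (res φ hφ) = L φ := by
      have h3 : g (res φ hφ) = L (ext (res φ hφ)) := hg ⟨res φ hφ, hresD φ hφ⟩
      rw [hres φ hφ] at h3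
      exact h3
    rw [h2] at h1
    exact h1

lemma integrable_testFunction {η : Measure (Eucl d)}
    (hη : ∀ C ⊆ Ω, IsCompact C → η C < ⊤) {φ : Eucl d → ℝ} (hφ : φ ∈ testFunctions Ω) :
    Integrable φ η := by
  obtain ⟨M, hM⟩ := hφ.2.1.exists_bound_of_continuous hφ.1.continuous
  rw [← integrableOn_iff_integrable_of_support_subset (subset_tsupport φ)]
  exact Measure.integrableOn_of_bounded (hη _ hφ.2.2 hφ.2.1).ne
    hφ.1.continuous.aestronglyMeasurable (M := M) (Eventually.of_forall hM)

/-- If `f` is smooth with values in `[0, 1]` and is nonzero exactly on `U`, then `1 - (1 - f)^n`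
increases to the indicator of `U`. The compact set `K` ensures that these functions are test
functions in `Ω`. -/
lemma measure_open_eq {α β : Measure (Eucl d)}
    (h : ∀ φ ∈ testFunctions Ω, (∀ x, 0 ≤ φ x) →
      ∫⁻ x, ENNReal.ofReal (φ x) ∂α = ∫⁻ x, ENNReal.ofReal (φ x) ∂β)
    {U K : Set (Eucl d)} (hU : IsOpen U) (hK : IsCompact K) (hUK : U ⊆ K) (hKΩ : K ⊆ Ω) :
    α U = β U := by
  obtain ⟨f, hfU, hf, hf01⟩ := hU.exists_contDiff_support_eq (n := ⊤)
  have hf0 : ∀ x, 0 ≤ f x ∧ f x ≤ 1 := fun x => hf01 ⟨x, rfl⟩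
  set g : ℕ → Eucl d → ℝ := fun n x => 1 - (1 - f x) ^ n with hg
  have hgsupp : ∀ n, Function.support (g n) ⊆ U := by
    intro n x hx
    rw [← hfU]
    intro h0
    apply hx
    simp [hg, h0]
  have hgt : ∀ n, g n ∈ testFunctions Ω := by
    intro n
    have hts : tsupport (g n) ⊆ K := closure_minimal ((hgsupp n).trans hUK) hK.isClosed
    refine ⟨?_, HasCompactSupport.of_support_subset_isCompact hK ((hgsupp n).trans hUK),
      hts.trans hKΩ⟩
    have hf' : ContDiff ℝ ∞ f := hf
    simp only [hg]
    fun_prop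
  have hg0 : ∀ n x, 0 ≤ g n x := fun n x => by
    have := pow_le_one₀ (n := n) (by linarith [(hf0 x).2] : 0 ≤ 1 - f x) (by linarith [(hf0 x).1])
    simp only [hg]
    linarith
  have key : ∀ μ : Measure (Eucl d),
      Tendsto (fun n => ∫⁻ x, ENNReal.ofReal (g n x) ∂μ) atTop (𝓝 (μ U)) := by
    intro μ
    rw [← lintegral_indicator_one hU.measurableSet]
    refine lintegral_tendsto_of_tendsto_of_monotone
      (fun n => (hgt n).1.continuous.measurable.ennreal_ofReal.aemeasurable)
      (Eventually.of_forall fun x n m hnm => ?_) (Eventually.of_forall fun x => ?_)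
    · refine ENNReal.ofReal_le_ofReal ?_
      have := pow_le_pow_of_le_one (by linarith [(hf0 x).2] : 0 ≤ 1 - f x)
        (by linarith [(hf0 x).1]) hnm
      simp only [hg]
      linarith
    · by_cases hx : x ∈ U
      · have hfx : 0 < f x := by
          rw [← hfU] at hx
          exact lt_of_le_of_ne (hf0 x).1 (Ne.symm hx)
        have h1 : Tendsto (fun n => g n x) atTop (𝓝 (1 - 0)) :=
          (tendsto_pow_atTop_nhds_zero_of_lt_one (by linarith [(hf0 x).2])
            (by linarith)).const_sub 1
        rw [sub_zero] at h1
        simpa [hx] using ENNReal.tendsto_ofReal h1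
      · have h1 : ∀ n, g n x = 0 := fun n => by
          by_contra hne
          exact hx (hgsupp n hne)
        simp [hx, h1]
  refine tendsto_nhds_unique (key α) ?_
  simp only [h _ (hgt _) (hg0 _)]
  exact key β

/-- Radon measures on `Ω` are determined by their action on test functions. -/
lemma measure_ext_of_testFunctions (hΩ : IsOpen Ω) {α β : Measure (Eucl d)} (hα : α Ωᶜ = 0)
    (hβ : β Ωᶜ = 0) (hfin : ∀ C ⊆ Ω, IsCompact C → β C < ⊤)
    (h : ∀ φ ∈ testFunctions Ω, (∀ x, 0 ≤ φ x) →
      ∫⁻ x, ENNReal.ofReal (φ x) ∂α = ∫⁻ x, ENNReal.ofReal (φ x) ∂β) : α = β := by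
  have hex : ∀ x : Ω, ∃ U K : Set (Eucl d), IsOpen U ∧ IsCompact K ∧ (x : Eucl d) ∈ U ∧ U ⊆ K ∧
      K ⊆ Ω := by
    intro x
    obtain ⟨K, hK, hxK, hKΩ⟩ := exists_compact_subset hΩ x.2
    exact ⟨interior K, K, isOpen_interior, hK, hxK, interior_subset, hKΩ⟩
  choose U K hU hK hxU hUK hKΩ using hex
  obtain ⟨T, hT, hTU⟩ := TopologicalSpace.isOpen_iUnion_countable U hU
  have hUΩ : ⋃ i ∈ T, U i = Ω := by
    rw [hTU]
    refine subset_antisymm (iUnion_subset fun i => (hUK i).trans (hKΩ i)) fun x hx => ?_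
    exact mem_iUnion.2 ⟨⟨x, hx⟩, hxU _⟩
  have hres : α.restrict Ω = β.restrict Ω := by
    rw [← hUΩ, Measure.restrict_biUnion_congr hT]
    intro i _
    have hβfin : IsFiniteMeasure (β.restrict (U i)) := isFiniteMeasure_restrict.2
      ((measure_mono (hUK i)).trans_lt (hfin _ (hKΩ i) (hK i))).ne
    have hαfin : IsFiniteMeasure (α.restrict (U i)) := by
      refine isFiniteMeasure_restrict.2 ?_
      rw [measure_open_eq h (hU i) (hK i) (hUK i) (hKΩ i)]
      exact ((measure_mono (hUK i)).trans_lt (hfin _ (hKΩ i) (hK i))).ne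
    refine ext_of_generate_finite _ (BorelSpace.measurable_eq) isPiSystem_isOpen ?_ ?_
    · intro V hV
      have hV' : IsOpen V := hV
      rw [Measure.restrict_apply hV'.measurableSet, Measure.restrict_apply hV'.measurableSet]
      exact measure_open_eq h (hV'.inter (hU i)) (hK i) (inter_subset_right.trans (hUK i)) (hKΩ i)
    · rw [Measure.restrict_apply_univ, Measure.restrict_apply_univ]
      exact measure_open_eq h (hU i) (hK i) (hUK i) (hKΩ i)
  rwa [Measure.restrict_eq_self_of_ae_mem, Measure.restrict_eq_self_of_ae_mem] at hres
  · exact hβ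
  · exact hα

namespace IsRegularForm

/-! ### Measures that do not charge sets of capacity zero -/

lemma exists_measurable_superset (hp : IsRegularForm p) {N : Set (Eucl d)}
    (hN : hp.capOuter N = 0) :
    ∃ M, N ∩ Ω ⊆ M ∧ M ⊆ Ω ∧ MeasurableSet M ∧ hp.capOuter M = 0 := by
  have hex : ∀ n : ℕ, ∃ O ⊆ Ω, IsOpen O ∧ N ∩ Ω ⊆ O ∧ hp.capOuter O < ((n : ℝ≥0∞) + 1)⁻¹ :=
    fun n => hp.exists_open_of_capOuter_lt (by rw [hN]; simp)
  choose O hOΩ hO hNO hlt using hex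
  refine ⟨⋂ n, O n, subset_iInter hNO, (iInter_subset _ 0).trans (hOΩ 0),
    MeasurableSet.iInter fun n => (hO n).measurableSet, le_antisymm ?_ zero_le⟩
  have h1 : Tendsto (fun n : ℕ => ((n : ℝ≥0∞) + 1)⁻¹) atTop (𝓝 0) := by
    have := ENNReal.tendsto_inv_nat_nhds_zero.comp (tendsto_add_atTop_nat 1)
    refine this.congr fun n => ?_
    simp
  exact ge_of_tendsto' h1 fun n => (measure_mono (iInter_subset _ n)).trans (hlt n).le

/-- `μ` does not charge sets of capacity zero. -/
def Vanishes (hp : IsRegularForm p) (μ : Measure (Eucl d)) : Prop :=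
  ∀ N, hp.capOuter N = 0 → μ N = 0

lemma vanishes_of_measurable (hp : IsRegularForm p) {μ : Measure (Eucl d)} (h0 : μ Ωᶜ = 0)
    (h : ∀ B ⊆ Ω, MeasurableSet B → cap p B = 0 → μ B = 0) : hp.Vanishes μ := by
  intro N hN
  obtain ⟨M, hNM, hMΩ, hM, hM0⟩ := hp.exists_measurable_superset hN
  rw [hp.capOuter_eq_zero_iff_of_subset hMΩ] at hM0
  refine measure_mono_null (t := M ∪ Ωᶜ) (fun x hx => ?_)
    (measure_union_null (h M hMΩ hM hM0) h0)
  by_cases hxΩ : x ∈ Ω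
  · exact Or.inl (hNM ⟨hx, hxΩ⟩)
  · exact Or.inr hxΩ

lemma Vanishes.ae {hp : IsRegularForm p} {μ : Measure (Eucl d)} (hμ : hp.Vanishes μ)
    {P : Eucl d → Prop} (h : ∀ᵐ x ∂hp.capOuter, P x) : ∀ᵐ x ∂μ, P x :=
  hμ _ h

/-- A quasi continuous function is continuous on countably many Borel sets that cover `Ω` up to
capacity zero. -/
lemma Vanishes.aemeasurable {hp : IsRegularForm p} {μ : Measure (Eucl d)} (hμ : hp.Vanishes μ)
    {w : Eucl d → ℝ} (hw : QuasiContinuous p w) : AEMeasurable w μ := by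
  have hex : ∀ n : ℕ, ∃ O ⊆ Ω, IsOpen O ∧ hp.capOuter O < ((n : ℝ≥0∞) + 1)⁻¹ ∧
      ContinuousOn w (Ω \ O) := fun n => hp.quasiContinuous_iff.1 hw _ (by simp)
  choose O hOΩ hO hlt hcont using hex
  have h1 : Tendsto (fun n : ℕ => ((n : ℝ≥0∞) + 1)⁻¹) atTop (𝓝 0) := by
    have := ENNReal.tendsto_inv_nat_nhds_zero.comp (tendsto_add_atTop_nat 1)
    refine this.congr fun n => ?_
    simp
  have hnull : hp.capOuter (⋂ n, O n) = 0 := le_antisymm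
    (ge_of_tendsto' h1 fun n => (measure_mono (iInter_subset _ n)).trans (hlt n).le) zero_le
  have hm : AEMeasurable w (μ.restrict (⋃ n, Ω \ O n)) := aemeasurable_iUnion_iff.2 fun n =>
    (hcont n).aemeasurable (hp.isOpen.measurableSet.diff (hO n).measurableSet)
  rwa [Measure.restrict_eq_self_of_ae_mem] at hm
  have h2 : ∀ᵐ x ∂hp.capOuter, x ∉ ⋂ n, O n := by
    rw [ae_iff]
    simp only [not_not, Set.ofPred_mem_eq]
    exact hnull
  filter_upwards [hμ.ae h2, hμ.ae hp.ae_mem] with x hx hxΩ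
  rw [mem_iInter, not_forall] at hx
  obtain ⟨n, hn⟩ := hx
  exact mem_iUnion.2 ⟨n, hxΩ, hn⟩

lemma vanishes_volume (hp : IsRegularForm p) : hp.Vanishes (volume.restrict Ω) :=
  fun _ hN => hp.volume_eq_zero hN

/-! ### Quasi open sets -/

lemma quasiOpen_superlevel (hp : IsRegularForm p) {w : Eucl d → ℝ} (hw : QuasiContinuous p w)
    {U : Set (Eucl d)} (hU : IsOpen U) {T : Set ℝ} (hT : IsOpen T) :
    QuasiOpen p (U ∩ Ω ∩ w ⁻¹' T) := by
  rw [hp.quasiOpen_iff]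
  refine ⟨inter_subset_left.trans inter_subset_right, fun ε hε => ?_⟩
  obtain ⟨O, hOΩ, hO, hlt, hcont⟩ := hp.quasiContinuous_iff.1 hw ε hε
  exact ⟨O, hOΩ, hO, isOpen_inter_preimage_union hp.isOpen hU hO hcont hT, hlt⟩

lemma quasiOpen_null (hp : IsRegularForm p) {N : Set (Eucl d)} (hNΩ : N ⊆ Ω)
    (hN : hp.capOuter N = 0) : QuasiOpen p N := by
  rw [hp.quasiOpen_iff]
  refine ⟨hNΩ, fun ε hε => ?_⟩
  obtain ⟨O, hOΩ, hO, hNO, hlt⟩ := hp.exists_open_of_capOuter_lt (hN ▸ hε)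
  rw [inter_eq_left.2 hNΩ] at hNO
  exact ⟨O, hOΩ, hO, by rwa [union_eq_right.2 hNO], hlt⟩

lemma quasiOpen_iUnion (hp : IsRegularForm p) {A : ℕ → Set (Eucl d)}
    (hA : ∀ n, QuasiOpen p (A n)) : QuasiOpen p (⋃ n, A n) := by
  rw [hp.quasiOpen_iff]
  refine ⟨iUnion_subset fun n => (hA n).1, fun ε hε => ?_⟩
  obtain ⟨ε', hε', hsum⟩ := ENNReal.exists_pos_sum_of_countable' hε.ne' ℕ
  choose O hOΩ hO hAO hlt using fun n => (hp.quasiOpen_iff.1 (hA n)).2 (ε' n) (hε' n)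
  refine ⟨⋃ n, O n, iUnion_subset hOΩ, isOpen_iUnion hO, ?_, ?_⟩
  · rw [← iUnion_union_distrib]
    exact isOpen_iUnion hAO
  · calc hp.capOuter (⋃ n, O n) ≤ ∑' n, hp.capOuter (O n) := measure_iUnion_le _
      _ ≤ ∑' n, ε' n := ENNReal.tsum_le_tsum fun n => (hlt n).le
      _ < ε := hsum

lemma quasiOpen_union (hp : IsRegularForm p) {A B : Set (Eucl d)} (hA : QuasiOpen p A)
    (hB : QuasiOpen p B) : QuasiOpen p (A ∪ B) := by
  rw [hp.quasiOpen_iff] at hA hB ⊢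
  refine ⟨union_subset hA.1 hB.1, fun ε hε => ?_⟩
  obtain ⟨O, h1, h2, h3, h4⟩ := hA.2 _ (ENNReal.half_pos hε.ne')
  obtain ⟨O', h1', h2', h3', h4'⟩ := hB.2 _ (ENNReal.half_pos hε.ne')
  refine ⟨O ∪ O', union_subset h1 h1', h2.union h2', ?_, ?_⟩
  · rw [union_union_union_comm]
    exact h3.union h3'
  · calc hp.capOuter (O ∪ O') ≤ hp.capOuter O + hp.capOuter O' := measure_union_le _ _
      _ < ε / 2 + ε / 2 := ENNReal.add_lt_add h4 h4'
      _ = ε := ENNReal.add_halves ε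

end IsRegularForm

lemma setIntegral_eq_integral {μ : Measure (Eucl d)} (hμ : μ Ωᶜ = 0) (f : Eucl d → ℝ) :
    ∫ x in Ω, f x ∂μ = ∫ x, f x ∂μ := by
  rw [Measure.restrict_eq_self_of_ae_mem (μ := μ) (s := Ω) hμ]

namespace IsRegularForm

/-! ### The functional `v ↦ ∫ v - (z, v)` -/

lemma integrable (hp : IsRegularForm p) {u : Eucl d → ℝ} (hu : p.Finite u) :
    Integrable u (volume.restrict Ω) := by
  have := hp.isFiniteMeasure
  exact (hp.memLp hu).integrable (by norm_num)

lemma functional_bound (hp : IsRegularForm p) {z : Eucl d → ℝ} (hz : p.Finite z) :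
    ∃ C : ℝ, 0 < C ∧ ∀ v, p.Finite v → |(∫ x in Ω, v x) - p.prod z v| ≤ C * √(p.normSq v) := by
  have hfinm := hp.isFiniteMeasure
  obtain ⟨C, hC, hcoer⟩ := hp.coercive
  set V : ℝ := ((volume.restrict Ω) univ ^ (1 / 2 : ℝ)).toReal with hV
  have hV0 : 0 ≤ V := ENNReal.toReal_nonneg
  have hVt : (volume.restrict Ω) univ ^ (1 / 2 : ℝ) ≠ ⊤ :=
    ENNReal.rpow_ne_top_of_nonneg (by norm_num) (measure_ne_top _ _)
  refine ⟨C * V + √(p.normSq z) + 1, by positivity, fun v hv => ?_⟩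
  have h1 : |∫ x in Ω, v x| ≤ C * √(p.normSq v) * V := by
    have h2 : ‖∫ x in Ω, v x‖ₑ ≤ eLpNorm v 1 (volume.restrict Ω) := by
      rw [eLpNorm_one_eq_lintegral_enorm]
      exact enorm_integral_le_lintegral_enorm v
    have h3 := eLpNorm_le_eLpNorm_mul_rpow_measure_univ (μ := volume.restrict Ω)
      (p := 1) (q := 2) (f := v) (by norm_num) (hp.memLp hv).1
    have h4 : ‖∫ x in Ω, v x‖ₑ ≤ ENNReal.ofReal (C * √(p.normSq v) * V) := by
      refine h2.trans (h3.trans ?_)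
      rw [ENNReal.ofReal_mul (by positivity), hV, ENNReal.ofReal_toReal hVt]
      have : (1 / (1 : ℝ≥0∞).toReal - 1 / (2 : ℝ≥0∞).toReal) = (1 / 2 : ℝ) := by norm_num
      rw [this]
      gcongr
      exact hcoer hv
    rw [Real.enorm_eq_ofReal_abs, ENNReal.ofReal_le_ofReal_iff (by positivity)] at h4
    exact h4
  have h5 := hp.abs_prod_le hz hv
  have h6 : |(∫ x in Ω, v x) - p.prod z v| ≤ |∫ x in Ω, v x| + |p.prod z v| := abs_sub _ _
  nlinarith [Real.sqrt_nonneg (p.normSq v)]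

lemma functional_add (hp : IsRegularForm p) {z u v : Eucl d → ℝ} (hz : p.Finite z)
    (hu : p.Finite u) (hv : p.Finite v) :
    (∫ x in Ω, (u + v) x) - p.prod z (u + v)
      = ((∫ x in Ω, u x) - p.prod z u) + ((∫ x in Ω, v x) - p.prod z v) := by
  rw [hp.prod_add hz hu hv]
  simp only [Pi.add_apply]
  rw [integral_add (hp.integrable hu) (hp.integrable hv)]
  ring

lemma functional_smul (hp : IsRegularForm p) {z u : Eucl d → ℝ} (c : ℝ) (hz : p.Finite z)
    (hu : p.Finite u) :
    (∫ x in Ω, (c • u) x) - p.prod z (c • u) = c * ((∫ x in Ω, u x) - p.prod z u) := by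
  rw [hp.prod_smul c hz hu]
  simp only [Pi.smul_apply, smul_eq_mul]
  rw [integral_const_mul]
  ring

lemma functional_sub (hp : IsRegularForm p) {z u v : Eucl d → ℝ} (hz : p.Finite z)
    (hu : p.Finite u) (hv : p.Finite v) :
    (∫ x in Ω, (u - v) x) - p.prod z (u - v)
      = ((∫ x in Ω, u x) - p.prod z u) - ((∫ x in Ω, v x) - p.prod z v) := by
  rw [hp.prod_sub hz hu hv]
  simp only [Pi.sub_apply]
  rw [integral_sub (hp.integrable hu) (hp.integrable hv)]
  ring

lemma exists_represents (hp : IsRegularForm p) {z : Eucl d → ℝ} (hz : z ∈ K p) :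
    ∃ η, Represents p η z := by
  obtain ⟨η, h1, h2, h3⟩ := exists_measure_of_positive hp.isOpen
    (fun v => (∫ x in Ω, v x) - p.prod z v)
    (fun φ hφ ψ hψ => hp.functional_add hz.1.1.1 (hp.test hφ) (hp.test hψ))
    (fun c φ hφ => hp.functional_smul c hz.1.1.1 (hp.test hφ))
    (fun φ hφ h0 => by
      have := hz.2.2 φ (hp.W_test hφ)
        (hp.quasiEverywhere_iff.2 (Eventually.of_forall h0))
      linarith)
  exact ⟨η, h1, h2, fun φ hφ => by rw [setIntegral_eq_integral h1, h3 φ hφ]⟩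

end IsRegularForm

/-! ### The representing measure: capacity estimate and extension to `W` -/

namespace Represents

variable {η : Measure (Eucl d)} {z : Eucl d → ℝ}

lemma integral_test (hη : Represents p η z) {φ : Eucl d → ℝ} (hφ : φ ∈ testFunctions Ω) :
    ∫ x, φ x ∂η = (∫ x in Ω, φ x) - p.prod z φ := by
  rw [← hη.integral_eq φ hφ, setIntegral_eq_integral hη.compl_eq_zero]

lemma integrable_test (hη : Represents p η z) {φ : Eucl d → ℝ} (hφ : φ ∈ testFunctions Ω) :
    Integrable φ η :=
  integrable_testFunction hη.finite_on_compacts hφ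

lemma lintegral_test (hη : Represents p η z) {φ : Eucl d → ℝ} (hφ : φ ∈ testFunctions Ω)
    (h0 : ∀ x, 0 ≤ φ x) :
    ∫⁻ x, ENNReal.ofReal (φ x) ∂η = ENNReal.ofReal ((∫ x in Ω, φ x) - p.prod z φ) := by
  rw [← hη.integral_test hφ, ofReal_integral_eq_lintegral_ofReal (hη.integrable_test hφ)
    (Eventually.of_forall h0)]

lemma unique (hΩ : IsOpen Ω) {η' : Measure (Eucl d)} (hη' : Represents p η' z)
    (hη : Represents p η z) : η' = η :=
  measure_ext_of_testFunctions hΩ hη'.compl_eq_zero hη.compl_eq_zero hη.finite_on_compacts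
    fun φ hφ h0 => by rw [hη.lintegral_test hφ h0, hη'.lintegral_test hφ h0]

/-- The absolute value of a test function is not smooth. The functional is evaluated at `softAbs (δ
n) ∘ φ`, whose norm does not exceed that of `φ`, and Fatou's lemma gives the limit. -/
lemma lintegral_enorm_test_le (hp : IsRegularForm p) (hη : Represents p η z) {C : ℝ}
    (hC0 : 0 < C) (hC : ∀ v, p.Finite v → |(∫ x in Ω, v x) - p.prod z v| ≤ C * √(p.normSq v))
    {φ : Eucl d → ℝ} (hφ : φ ∈ testFunctions Ω) :
    ∫⁻ x, ‖φ x‖ₑ ∂η ≤ ENNReal.ofReal (C * √(p.normSq φ)) := by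
  set δ : ℕ → ℝ := fun n => 1 / ((n : ℝ) + 1) with hδ
  have hδ0 : ∀ n, 0 < δ n := fun n => by simp only [hδ]; positivity
  have hft : ∀ n, (fun x => softAbs (δ n) (φ x)) ∈ testFunctions Ω := fun n =>
    comp_mem_testFunctions hφ (contDiff_softAbs (hδ0 n)) (softAbs_zero (hδ0 n))
  have hpt : ∀ x, Tendsto (fun n => ENNReal.ofReal (softAbs (δ n) (φ x))) atTop (𝓝 ‖φ x‖ₑ) := by
    intro x
    rw [Real.enorm_eq_ofReal_abs]
    refine ENNReal.tendsto_ofReal ?_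
    rw [tendsto_iff_norm_sub_tendsto_zero]
    exact squeeze_zero (fun n => norm_nonneg _) (fun n => abs_softAbs_sub_abs_le (hδ0 n) (φ x))
      tendsto_one_div_nat_succ
  have hle : ∀ n, ∫⁻ x, ENNReal.ofReal (softAbs (δ n) (φ x)) ∂η
      ≤ ENNReal.ofReal (C * √(p.normSq φ)) := by
    intro n
    rw [hη.lintegral_test (hft n) (fun x => softAbs_nonneg _ _)]
    refine ENNReal.ofReal_le_ofReal ((le_abs_self _).trans ((hC _ (hp.test (hft n))).trans ?_))
    gcongr
    exact (hp.contraction (hδ0 n) (hp.test hφ)).2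
  calc ∫⁻ x, ‖φ x‖ₑ ∂η
      = ∫⁻ x, liminf (fun n => ENNReal.ofReal (softAbs (δ n) (φ x))) atTop ∂η :=
        lintegral_congr fun x => (hpt x).liminf_eq.symm
    _ ≤ liminf (fun n => ∫⁻ x, ENNReal.ofReal (softAbs (δ n) (φ x)) ∂η) atTop :=
        lintegral_liminf_le fun n => (hft n).1.continuous.measurable.ennreal_ofReal
    _ ≤ liminf (fun _ : ℕ => ENNReal.ofReal (C * √(p.normSq φ))) atTop :=
        liminf_le_liminf (Eventually.of_forall hle)
    _ = _ := liminf_const _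

/-- Every compact subset of `O` has a test function that is at least `1` on it and has norm below
`ε`; its `η`-integral dominates the measure. Exhausting `O` by compact sets finishes the estimate.
-/
lemma measure_open_le (hp : IsRegularForm p) (hη : Represents p η z) {C : ℝ}
    (hC0 : 0 < C) (hC : ∀ v, p.Finite v → |(∫ x in Ω, v x) - p.prod z v| ≤ C * √(p.normSq v))
    {O : Set (Eucl d)} (hO : IsOpen O) (hOΩ : O ⊆ Ω) {ε : ℝ} (hε : 0 < ε)
    (hcap : hp.capOuter O < ENNReal.ofReal ε) : η O ≤ ENNReal.ofReal (C * ε) := by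
  obtain ⟨K, hKc, hKO, hKm, hKU⟩ := exists_compact_exhaustion hO
  have hU : O = ⋃ n, K n :=
    subset_antisymm (fun x hx => mem_iUnion.2 (hKU x hx)) (iUnion_subset hKO)
  have hKle : ∀ n, η (K n) ≤ ENNReal.ofReal (C * ε) := by
    intro n
    have h1 : capCompact p (K n) < ENNReal.ofReal (ε ^ 2) := by
      refine (capCompact_le_capOpen (hKc n) (hKO n)).trans_lt ?_
      rw [← cap_eq_capOpen hO hOΩ, hp.cap_lt_iff hOΩ,
        ENNReal.ofReal_rpow_of_nonneg (by positivity) (by norm_num), ← Real.sqrt_eq_rpow,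
        Real.sqrt_sq hε.le]
      exact hcap
    obtain ⟨φ, hφ, h0, h2, h3⟩ := exists_of_capCompact_lt h1
    rw [ENNReal.ofReal_lt_ofReal_iff (by positivity)] at h3
    calc η (K n) = ∫⁻ x, (K n).indicator 1 x ∂η :=
          (lintegral_indicator_one (hKc n).measurableSet).symm
      _ ≤ ∫⁻ x, ‖φ x‖ₑ ∂η := by
        refine lintegral_mono fun x => ?_
        by_cases hx : x ∈ K n
        · simp only [hx, indicator_of_mem, Pi.one_apply, Real.enorm_eq_ofReal_abs]
          rw [← ENNReal.ofReal_one]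
          exact ENNReal.ofReal_le_ofReal ((h2 x hx).trans (le_abs_self _))
        · simp [hx]
      _ ≤ ENNReal.ofReal (C * √(p.normSq φ)) := hη.lintegral_enorm_test_le hp hC0 hC hφ
      _ ≤ _ := by
        refine ENNReal.ofReal_le_ofReal ?_
        gcongr
        rw [Real.sqrt_le_left hε.le]
        exact h3.le
  rw [hU, hKm.measure_iUnion]
  exact iSup_le hKle

/-- The representing measure does not charge sets of capacity zero. -/
lemma vanishes (hp : IsRegularForm p) (hz : p.Finite z) (hη : Represents p η z) :
    hp.Vanishes η := by
  obtain ⟨C, hC0, hC⟩ := hp.functional_bound hz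
  intro N hN
  have key : ∀ n : ℕ, η N ≤ ENNReal.ofReal (C * (1 / ((n : ℝ) + 1))) := by
    intro n
    have hpos : (0 : ℝ) < 1 / ((n : ℝ) + 1) := by positivity
    obtain ⟨O, hOΩ, hO, hNO, hlt⟩ := hp.exists_open_of_capOuter_lt
      (hN ▸ ENNReal.ofReal_pos.2 hpos)
    have hsub : N ⊆ O ∪ Ωᶜ := fun x hx => by
      by_cases hxΩ : x ∈ Ω
      · exact Or.inl (hNO ⟨hx, hxΩ⟩)
      · exact Or.inr hxΩ
    calc η N ≤ η O + η Ωᶜ := (measure_mono hsub).trans (measure_union_le _ _)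
      _ ≤ _ := by
        rw [hη.compl_eq_zero, add_zero]
        exact hη.measure_open_le hp hC0 hC hO hOΩ hpos hlt
  have hlim : Tendsto (fun n : ℕ => ENNReal.ofReal (C * (1 / ((n : ℝ) + 1)))) atTop (𝓝 0) := by
    have := tendsto_one_div_nat_succ.const_mul C
    rw [mul_zero] at this
    simpa using ENNReal.tendsto_ofReal this
  exact le_antisymm (ge_of_tendsto' hlim key) zero_le

/-- The representation formula extends to quasi continuous elements of `W`. -/
lemma integral_eq_of_mem (hp : IsRegularForm p) (hz : p.Finite z) (hη : Represents p η z)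
    {v : Eucl d → ℝ} (hv : v ∈ W p) :
    Integrable v η ∧ ∫ x, v x ∂η = (∫ x in Ω, v x) - p.prod z v := by
  obtain ⟨C, hC0, hC⟩ := hp.functional_bound hz
  have hvan := hη.vanishes hp hz
  have hq : Tendsto (fun n : ℕ => (1 / 4 : ℝ) ^ n) atTop (𝓝 0) :=
    tendsto_pow_atTop_nhds_zero_of_lt_one (by norm_num) (by norm_num)
  obtain ⟨φ, hφ, hlt, -⟩ := hp.exists_seq_test hv.1 (ε := fun n : ℕ => ((1 / 4) ^ n) ^ 2)
    (fun n => by positivity) (by simpa using hq.pow 2)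
  have hsq : ∀ n, √(p.normSq (φ n - v)) ≤ (1 / 4) ^ n := fun n => by
    rw [Real.sqrt_le_left (by positivity), hp.normSq_sub_comm (hp.test (hφ n)) hv.1.1]
    exact (hlt n).le
  have hpt : ∀ᵐ x ∂η, Tendsto (fun n => φ n x) atTop (𝓝 (v x)) := by
    filter_upwards [hvan.ae (hp.tendsto_zero_of_rapid
      (fun n => hp.W_sub (hp.W_test (hφ n)) hv) hsq)] with x hx
    simpa using hx.add_const (v x)
  -- The norm bound makes `φ` a Cauchy sequence in `L¹(η)`. Since `η` ignores capacity zero, the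
  -- quasi everywhere limit `v` is an `η`-almost everywhere limit, and Fatou's lemma identifies it
  -- with the `L¹` limit.
  have hL1 : ∀ n, ∫⁻ x, ‖φ n x - v x‖ₑ ∂η ≤ ENNReal.ofReal (C * (2 * (1 / 4) ^ n)) := by
    intro n
    have hle : ∀ m, n ≤ m →
        ∫⁻ x, ‖φ n x - φ m x‖ₑ ∂η ≤ ENNReal.ofReal (C * (2 * (1 / 4) ^ n)) := by
      intro m hnm
      refine (hη.lintegral_enorm_test_le hp hC0 hC
        (sub_mem_testFunctions (hφ n) (hφ m))).trans (ENNReal.ofReal_le_ofReal ?_)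
      gcongr
      have h1 := hp.sqrt_normSq_add_le (hp.sub (hp.test (hφ n)) hv.1.1)
        (hp.sub hv.1.1 (hp.test (hφ m)))
      rw [sub_add_sub_cancel, hp.normSq_sub_comm hv.1.1 (hp.test (hφ m))] at h1
      have h2 : (1 / 4 : ℝ) ^ m ≤ (1 / 4) ^ n :=
        pow_le_pow_of_le_one (by norm_num) (by norm_num) hnm
      linarith [hsq n, hsq m]
    calc ∫⁻ x, ‖φ n x - v x‖ₑ ∂η
        = ∫⁻ x, liminf (fun m => ‖φ n x - φ m x‖ₑ) atTop ∂η := by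
          refine lintegral_congr_ae (hpt.mono fun x hx => ?_)
          exact ((continuous_enorm.tendsto _).comp (hx.const_sub (φ n x))).liminf_eq.symm
      _ ≤ liminf (fun m => ∫⁻ x, ‖φ n x - φ m x‖ₑ ∂η) atTop :=
          lintegral_liminf_le fun m =>
            ((hφ n).1.continuous.sub (hφ m).1.continuous).enorm.measurable
      _ ≤ liminf (fun _ : ℕ => ENNReal.ofReal (C * (2 * (1 / 4) ^ n))) atTop :=
          liminf_le_liminf ((eventually_ge_atTop n).mono fun m hm => hle m hm)
      _ = _ := liminf_const _
  have hmeas : AEStronglyMeasurable v η := (hvan.aemeasurable hv.2).aestronglyMeasurable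
  have hint : Integrable v η := by
    have h1 : Integrable (fun x => φ 0 x - v x) η :=
      ⟨(hη.integrable_test (hφ 0)).1.sub hmeas, (hL1 0).trans_lt ENNReal.ofReal_lt_top⟩
    have h2 := (hη.integrable_test (hφ 0)).sub h1
    refine h2.congr (Eventually.of_forall fun x => ?_)
    simp
  refine ⟨hint, ?_⟩
  have hlim1 : Tendsto (fun n => ∫ x, φ n x ∂η) atTop (𝓝 (∫ x, v x ∂η)) := by
    refine tendsto_integral_of_L1 v hmeas (Eventually.of_forall fun n =>
      hη.integrable_test (hφ n)) ?_
    have h1 : Tendsto (fun n : ℕ => ENNReal.ofReal (C * (2 * (1 / 4) ^ n))) atTop (𝓝 0) := by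
      have := (hq.const_mul 2).const_mul C
      rw [mul_zero, mul_zero] at this
      simpa using ENNReal.tendsto_ofReal this
    exact tendsto_of_tendsto_of_tendsto_of_le_of_le tendsto_const_nhds h1 (fun _ => zero_le) hL1
  have hlim2 : Tendsto (fun n => ∫ x, φ n x ∂η) atTop (𝓝 ((∫ x in Ω, v x) - p.prod z v)) := by
    rw [tendsto_iff_norm_sub_tendsto_zero]
    have h1 : Tendsto (fun n : ℕ => C * (1 / 4 : ℝ) ^ n) atTop (𝓝 0) := by
      simpa using hq.const_mul C
    refine squeeze_zero (fun n => norm_nonneg _) (fun n => ?_) h1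
    rw [hη.integral_test (hφ n), ← hp.functional_sub hz (hp.test (hφ n)) hv.1.1]
    exact (hC _ (hp.sub (hp.test (hφ n)) hv.1.1)).trans (by gcongr; exact hsq n)
  exact tendsto_nhds_unique hlim1 hlim2

lemma lintegral_eq_of_mem (hp : IsRegularForm p) (hz : p.Finite z) (hη : Represents p η z)
    {v : Eucl d → ℝ} (hv : v ∈ W p) (h0 : ∀ᵐ x ∂hp.capOuter, 0 ≤ v x) :
    ∫⁻ x, ENNReal.ofReal (v x) ∂η = ENNReal.ofReal ((∫ x in Ω, v x) - p.prod z v) := by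
  obtain ⟨h1, h2⟩ := hη.integral_eq_of_mem hp hz hv
  rw [← h2, ofReal_integral_eq_lintegral_ofReal h1 ((hη.vanishes hp hz).ae h0)]

end Represents

namespace IsRegularForm

/-! ### The measure `∞ · cap` -/

/-- Multiplication by `∞` leaves only the values `0` and `∞`, and for such an outer measure
subadditivity already yields the Carathéodory condition for every set. -/
lemma le_caratheodory_top_smul {α : Type*} [ms : MeasurableSpace α] (m : OuterMeasure α) :
    ms ≤ ((⊤ : ℝ≥0∞) • m).caratheodory := by
  intro A _
  rw [OuterMeasure.isCaratheodory_iff_le]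
  intro t
  simp only [_root_.smul_apply, smul_eq_mul]
  by_cases h : m t = 0
  · rw [measure_mono_null inter_subset_left h, measure_mono_null sdiff_subset h]
    simp
  · rw [ENNReal.top_mul h]
    exact le_top

/-- The measure that is `∞` on the Borel sets that meet `Z` in positive capacity, and `0` on the
others. -/
def topCap (hp : IsRegularForm p) (Z : Set (Eucl d)) : Measure (Eucl d) :=
  ((⊤ : ℝ≥0∞) • OuterMeasure.restrict Z hp.capOuter).toMeasure (le_caratheodory_top_smul _)

lemma topCap_apply (hp : IsRegularForm p) {Z B : Set (Eucl d)} (hB : MeasurableSet B) :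
    hp.topCap Z B = ⊤ * hp.capOuter (B ∩ Z) := by
  rw [topCap, toMeasure_apply _ _ hB, _root_.smul_apply, OuterMeasure.restrict_apply,
    smul_eq_mul]

lemma topCap_eq_zero_iff (hp : IsRegularForm p) {Z B : Set (Eucl d)} (hB : MeasurableSet B) :
    hp.topCap Z B = 0 ↔ hp.capOuter (B ∩ Z) = 0 := by
  rw [hp.topCap_apply hB]
  simp

lemma vanishes_topCap (hp : IsRegularForm p) (Z : Set (Eucl d)) : hp.Vanishes (hp.topCap Z) := by
  refine hp.vanishes_of_measurable ?_ fun B hBΩ hB h => ?_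
  · rw [hp.topCap_eq_zero_iff hp.isOpen.measurableSet.compl]
    exact measure_mono_null inter_subset_left hp.capOuter_compl
  · rw [hp.topCap_eq_zero_iff hB]
    exact measure_mono_null inter_subset_left ((hp.capOuter_eq_zero_iff_of_subset hBΩ).2 h)

/-- The way back from almost everywhere statements for `topCap` to quasi everywhere statements on
`Z`; a Borel null superset is needed because `topCap` is computed explicitly only on Borel sets. -/
lemma quasi_of_ae_topCap (hp : IsRegularForm p) {Z : Set (Eucl d)} {P : Eucl d → Prop}
    (h : ∀ᵐ x ∂hp.topCap Z, P x) : ∀ᵐ x ∂hp.capOuter, x ∈ Z → P x := by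
  obtain ⟨T, hT, hTm, hT0⟩ := exists_measurable_superset_of_null h
  rw [hp.topCap_eq_zero_iff hTm] at hT0
  refine measure_mono_null (fun x hx => ?_) hT0
  have hx' : x ∈ Z ∧ ¬P x := by simpa using hx
  exact ⟨hT hx'.2, hx'.1⟩

/-- An integral with respect to `topCap` is therefore unchanged by multiplication by `∞`: if it is
finite, it vanishes. -/
lemma top_smul_topCap (hp : IsRegularForm p) (Z : Set (Eucl d)) :
    (⊤ : ℝ≥0∞) • hp.topCap Z = hp.topCap Z := by
  ext B hB
  rw [Measure.smul_apply, hp.topCap_apply hB, smul_eq_mul, ← mul_assoc, ENNReal.top_mul_top]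

/-- Quasi continuous functions have Borel versions. -/
lemma exists_measurable_version (hp : IsRegularForm p) {w : Eucl d → ℝ}
    (hw : QuasiContinuous p w) : ∃ w', Measurable w' ∧ ∀ᵐ x ∂hp.capOuter, w x = w' x := by
  have h := (hp.vanishes_topCap univ).aemeasurable hw
  refine ⟨h.mk w, h.measurable_mk, ?_⟩
  filter_upwards [hp.quasi_of_ae_topCap h.ae_eq_mk] with x hx
  exact hx (mem_univ x)

end IsRegularForm

lemma IsCapacitaryMeasure.vanishes (hp : IsRegularForm p) {μ : Measure (Eucl d)}
    (hμ : IsCapacitaryMeasure p μ) : hp.Vanishes μ :=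
  hp.vanishes_of_measurable hμ.compl_eq_zero hμ.eq_zero_of_cap

namespace SolvesRelaxed

variable {μ η : Measure (Eucl d)} {z : Eucl d → ℝ}

/-! ### Solutions of the relaxed problem -/

lemma eq' (hμ : IsCapacitaryMeasure p μ) (h : SolvesRelaxed p μ z) {v : Eucl d → ℝ}
    (hv : v ∈ W p) (hv2 : MemLp v 2 μ) : p.prod z v + ∫ x, z x * v x ∂μ = ∫ x in Ω, v x := by
  rw [← h.eq v hv hv2, setIntegral_eq_integral hμ.compl_eq_zero]

lemma memLp_of_le (hp : IsRegularForm p) (hμ : hp.Vanishes μ) {v w : Eucl d → ℝ}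
    (hw : MemLp w 2 μ) (hv : v ∈ W p) (hle : ∀ᵐ x ∂hp.capOuter, |v x| ≤ |w x|) : MemLp v 2 μ :=
  hw.mono (hμ.aemeasurable hv.2).aestronglyMeasurable (hμ.ae hle)

/-- The test function is the negative part `v` of `z`. Then `(z, v) ≤ -‖v‖²` and `∫ z v dμ ≤ 0`,
whereas the right-hand side `∫ v` is nonnegative, so `v = 0`. -/
lemma quasi_nonneg (hp : IsRegularForm p) (hμ : IsCapacitaryMeasure p μ)
    (h : SolvesRelaxed p μ z) : ∀ᵐ x ∂hp.capOuter, 0 ≤ z x := by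
  have hz := h.mem
  have hnz := hp.W_smul (-1) hz
  have hv := hp.W_posPart hnz
  set v : Eucl d → ℝ := fun x => max (((-1 : ℝ) • z) x) 0 with hvdef
  have hvx : ∀ x, v x = max (-z x) 0 := fun x => by simp [hvdef]
  have hv2 : MemLp v 2 μ := memLp_of_le hp (hμ.vanishes hp) h.memLp hv
    (Eventually.of_forall fun x => by
      rw [hvx, abs_of_nonneg (le_max_right _ _)]
      exact max_le (neg_le_abs _) (abs_nonneg _))
  have h1 := h.eq' hμ hv hv2
  have h2 := hp.normSq_posPart_le hnz.1.1
  rw [hp.prod_comm, hp.prod_smul _ hv.1.1 hz.1.1, hp.prod_comm] at h2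
  have h3 : 0 ≤ ∫ x in Ω, v x := integral_nonneg fun x => le_max_right _ _
  have h4 : ∫ x, z x * v x ∂μ ≤ 0 := integral_nonpos fun x => by
    rw [Pi.zero_apply, hvx]
    rcases le_total 0 (z x) with h | h
    · rw [max_eq_right (by linarith), mul_zero]
    · exact mul_nonpos_of_nonpos_of_nonneg h (le_max_right _ _)
  have h5 : p.normSq v ≤ 0 := by linarith
  have h6 : eLpNorm v 2 (volume.restrict Ω) = 0 := by
    obtain ⟨C, hC, hcoer⟩ := hp.coercive
    have := hcoer hv.1.1
    rw [le_antisymm h5 (hp.nonneg hv.1.1), Real.sqrt_zero, mul_zero, ENNReal.ofReal_zero] at this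
    exact le_antisymm this zero_le
  rw [eLpNorm_eq_zero_iff (hp.memLp hv.1.1).1 (by norm_num)] at h6
  have h7 := hp.quasi_nonneg_of_ae hz.2 isOpen_univ (by
    filter_upwards [h6] with x hx _
    rw [hvx] at hx
    have := le_max_left (-z x) 0
    rw [hx] at this
    simpa using this)
  filter_upwards [h7] with x hx
  exact hx (mem_univ x)

/-- The remainder `(v - nz)⁺`. -/
lemma posPart_mem (hp : IsRegularForm p) (hz : z ∈ W p) {v : Eucl d → ℝ} (hv : v ∈ W p) (n : ℕ) :
    (fun x => max ((v - (n : ℝ) • z) x) 0) ∈ W p :=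
  hp.W_posPart (hp.W_sub hv (hp.W_smul _ hz))

/-- This is `(v - n z, g) ≥ ‖g‖²` for `g` the positive part of `v - n z`, solved for `n (z, g)`. -/
lemma mul_prod_posPart_le (hp : IsRegularForm p) (hz : z ∈ W p) {v : Eucl d → ℝ} (hv : v ∈ W p)
    (n : ℕ) : n * p.prod z (fun x => max ((v - (n : ℝ) • z) x) 0)
      ≤ p.prod v (fun x => max ((v - (n : ℝ) • z) x) 0)
        - p.normSq (fun x => max ((v - (n : ℝ) • z) x) 0) := by
  have hg := (posPart_mem hp hz hv n).1.1
  have h1 := hp.normSq_posPart_le (hp.sub hv.1.1 (hp.smul (n : ℝ) hz.1.1))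
  rw [hp.prod_comm, hp.prod_sub hg hv.1.1 (hp.smul _ hz.1.1), hp.prod_smul _ hg hz.1.1,
    hp.prod_comm _ v, hp.prod_comm _ z] at h1
  linarith

/-- In the splitting of `v` into `min v (n z)` and `(v - n z)⁺`, the first part lies in `L²_μ`,
being dominated by `n z`, and the equation with the sign of `z` gives the inequality for it. The
second part contributes at most `‖v‖² / (4n)`. The index is shifted to `n + 1` to divide by it. -/
lemma mem_K (hp : IsRegularForm p) (hμ : IsCapacitaryMeasure p μ) (h : SolvesRelaxed p μ z) :
    z ∈ K p := by
  have hz := h.mem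
  have hz0 := h.quasi_nonneg hp hμ
  refine ⟨hz, hp.quasiEverywhere_iff.2 hz0, fun v hv hv0 => ?_⟩
  rw [hp.quasiEverywhere_iff] at hv0
  have key : ∀ n : ℕ, p.prod z v ≤ (∫ x in Ω, v x) + p.normSq v / 4 * (1 / ((n : ℝ) + 1)) := by
    intro n
    set m : Eucl d → ℝ := fun x => min (v x) ((((n + 1 : ℕ) : ℝ) • z) x) with hm
    set g : Eucl d → ℝ := fun x => max ((v - ((n + 1 : ℕ) : ℝ) • z) x) 0 with hg
    have hgW : g ∈ W p := posPart_mem hp hz hv (n + 1)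
    have hmW : m ∈ W p := hp.W_min hv (hp.W_smul _ hz)
    have hvmg : v = m + g := by
      ext x
      simp only [hm, hg, Pi.add_apply, Pi.sub_apply]
      rcases le_total (v x) ((((n + 1 : ℕ) : ℝ) • z) x) with h | h
      · rw [min_eq_left h, max_eq_right (by linarith), add_zero]
      · rw [min_eq_right h, max_eq_left (by linarith), add_sub_cancel]
    have hm0 : ∀ᵐ x ∂hp.capOuter, 0 ≤ m x := by
      filter_upwards [hz0, hv0] with x h1 h2
      exact le_min h2 (mul_nonneg (Nat.cast_nonneg _) h1)
    have hm2 : MemLp m 2 μ := by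
      refine memLp_of_le hp (hμ.vanishes hp) (h.memLp.const_smul ((n + 1 : ℕ) : ℝ)) hmW ?_
      filter_upwards [hm0] with x h1
      rw [abs_of_nonneg h1]
      exact (min_le_right _ _).trans (le_abs_self _)
    have h1 := h.eq' hμ hmW hm2
    have h2 : 0 ≤ ∫ x, z x * m x ∂μ := by
      refine integral_nonneg_of_ae ?_
      filter_upwards [(hμ.vanishes hp).ae hz0, (hμ.vanishes hp).ae hm0] with x ha hb
      exact mul_nonneg ha hb
    have h3 : ∫ x in Ω, m x ≤ ∫ x in Ω, v x :=
      integral_mono (hp.integrable hmW.1.1) (hp.integrable hv.1.1) fun x => min_le_left _ _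
    have h4 := mul_prod_posPart_le hp hz hv (n + 1)
    have h5 := hp.prod_le hv.1.1 hgW.1.1
    have h6 : ((n + 1 : ℕ) : ℝ) * p.prod z g ≤ p.normSq v / 4 := by
      nlinarith [sq_nonneg (√(p.normSq v) / 2 - √(p.normSq g)), Real.sq_sqrt (hp.nonneg hv.1.1),
        Real.sq_sqrt (hp.nonneg hgW.1.1)]
    have h7 : p.prod z g ≤ p.normSq v / 4 * (1 / ((n : ℝ) + 1)) := by
      rw [mul_one_div, le_div_iff₀ (by positivity), mul_comm]
      push_cast at h6
      exact h6
    have h8 : p.prod z v = p.prod z m + p.prod z g := by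
      rw [← hp.prod_add hz.1.1 hmW.1.1 hgW.1.1, ← hvmg]
    linarith
  have hlim : Tendsto (fun n : ℕ => (∫ x in Ω, v x) + p.normSq v / 4 * (1 / ((n : ℝ) + 1))) atTop
      (𝓝 ((∫ x in Ω, v x) + p.normSq v / 4 * 0)) :=
    (tendsto_one_div_nat_succ.const_mul _).const_add _
  rw [mul_zero, add_zero] at hlim
  exact ge_of_tendsto' hlim key

/-- On the set where `z` is positive, `z μ` is the representing measure. -/
lemma restrict_eq_withDensity (hp : IsRegularForm p) (hμ : IsCapacitaryMeasure p μ)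
    (h : SolvesRelaxed p μ z) (hη : Represents p η z) {z' : Eucl d → ℝ} (hz' : Measurable z')
    (hzz' : ∀ᵐ x ∂hp.capOuter, z x = z' x) :
    μ.withDensity (fun x => ENNReal.ofReal (z' x)) = η.restrict {x | 0 < z' x} := by
  have hz := h.mem
  have hz0 := h.quasi_nonneg hp hμ
  have hvan := hμ.vanishes hp
  have hvη := hη.vanishes hp hz.1.1
  have hset : MeasurableSet {x | 0 < z' x} := measurableSet_lt measurable_const hz'
  refine measure_ext_of_testFunctions hp.isOpen
    (withDensity_absolutelyContinuous _ _ hμ.compl_eq_zero)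
    (Measure.absolutelyContinuous_of_le Measure.restrict_le_self hη.compl_eq_zero)
    (fun C hC hCc => (Measure.restrict_apply_le _ _).trans_lt (hη.finite_on_compacts C hC hCc))
    fun φ hφ hφ0 => ?_
  -- The truncations `min φ (n z)` are admissible in the equation and increase to `φ` where `z > 0`,
  -- while they vanish where `z = 0`. Comparing the equation with the representation by `η` gives `∫
  -- z m dμ = ∫ m dη`, and monotone convergence applies to both sides.
  set m : ℕ → Eucl d → ℝ := fun n x => min (φ x) (((n : ℝ) • z) x) with hm
  have hmW : ∀ n, m n ∈ W p := fun n => hp.W_min (hp.W_test hφ) (hp.W_smul _ hz)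
  have hm0 : ∀ n, ∀ᵐ x ∂hp.capOuter, 0 ≤ m n x := fun n => by
    filter_upwards [hz0] with x h1
    exact le_min (hφ0 x) (mul_nonneg (Nat.cast_nonneg _) h1)
  have heq : ∀ n, ∫⁻ x, ENNReal.ofReal (z x * m n x) ∂μ = ∫⁻ x, ENNReal.ofReal (m n x) ∂η := by
    intro n
    have hm2 : MemLp (m n) 2 μ := by
      refine memLp_of_le hp hvan (h.memLp.const_smul (n : ℝ)) (hmW n) ?_
      filter_upwards [hm0 n] with x h1
      rw [abs_of_nonneg h1]
      exact (min_le_right _ _).trans (le_abs_self _)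
    have hint : Integrable (fun x => z x * m n x) μ := h.memLp.integrable_mul hm2
    rw [hη.lintegral_eq_of_mem hp hz.1.1 (hmW n) (hm0 n),
      ← ofReal_integral_eq_lintegral_ofReal hint]
    · congr 1
      have := h.eq' hμ (hmW n) hm2
      linarith
    · filter_upwards [hvan.ae hz0, hvan.ae (hm0 n)] with x ha hb
      exact mul_nonneg ha hb
  have hmono : ∀ᵐ x ∂hp.capOuter, Monotone fun n => m n x := by
    filter_upwards [hz0] with x hx n k hnk
    refine min_le_min_left _ ?_
    simp only [Pi.smul_apply, smul_eq_mul]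
    gcongr
  have hev : ∀ x, 0 < z x → ∀ᶠ n in atTop, m n x = φ x := by
    intro x hx
    obtain ⟨N, hN⟩ := exists_nat_ge (φ x / z x)
    filter_upwards [eventually_ge_atTop N] with n hn
    refine min_eq_left ?_
    simp only [Pi.smul_apply, smul_eq_mul]
    rw [← div_le_iff₀ hx]
    exact hN.trans (by exact_mod_cast hn)
  have hlim1 : Tendsto (fun n => ∫⁻ x, ENNReal.ofReal (z x * m n x) ∂μ) atTop
      (𝓝 (∫⁻ x, ENNReal.ofReal (z' x) * ENNReal.ofReal (φ x) ∂μ)) := by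
    refine lintegral_tendsto_of_tendsto_of_monotone (fun n =>
      ((hvan.aemeasurable hz.2).mul (hvan.aemeasurable (hmW n).2)).ennreal_ofReal) ?_ ?_
    · filter_upwards [hvan.ae hmono, hvan.ae hz0] with x h1 h2 n k hnk
      exact ENNReal.ofReal_le_ofReal (mul_le_mul_of_nonneg_left (h1 hnk) h2)
    · filter_upwards [hvan.ae hz0, hvan.ae hzz'] with x h1 h2
      rw [← h2, ← ENNReal.ofReal_mul h1]
      rcases h1.eq_or_lt with h3 | h3
      · simp [← h3]
      · refine tendsto_const_nhds.congr' ?_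
        filter_upwards [hev x h3] with n hn
        rw [hn]
  have hlim2 : Tendsto (fun n => ∫⁻ x, ENNReal.ofReal (m n x) ∂η) atTop
      (𝓝 (∫⁻ x, {x | 0 < z' x}.indicator (fun x => ENNReal.ofReal (φ x)) x ∂η)) := by
    refine lintegral_tendsto_of_tendsto_of_monotone (fun n =>
      (hvη.aemeasurable (hmW n).2).ennreal_ofReal) ?_ ?_
    · filter_upwards [hvη.ae hmono] with x h1 n k hnk
      exact ENNReal.ofReal_le_ofReal (h1 hnk)
    · filter_upwards [hvη.ae hz0, hvη.ae hzz'] with x h1 h2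
      rcases h1.eq_or_lt with h3 | h3
      · have h4 : ∀ n, m n x = 0 := fun n => by
          simp only [hm, Pi.smul_apply, smul_eq_mul, ← h3, mul_zero]
          exact min_eq_right (hφ0 x)
        have h5 : x ∉ {x | 0 < z' x} := by
          simp [← h2, ← h3]
        simp [h4, h5]
      · have h5 : x ∈ {x | 0 < z' x} := by
          show 0 < z' x
          rwa [← h2]
        rw [indicator_of_mem h5]
        refine tendsto_const_nhds.congr' ?_
        filter_upwards [hev x h3] with n hn
        rw [hn]
  simp only [heq] at hlim1
  rw [lintegral_withDensity_eq_lintegral_mul _ hz'.ennreal_ofReal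
    hφ.1.continuous.measurable.ennreal_ofReal, ← lintegral_indicator hset]
  exact tendsto_nhds_unique hlim1 hlim2

/-- The elements of `W ∩ L²_μ` vanish where `z` does. -/
lemma quasi_eq_zero (hp : IsRegularForm p) (hμ : IsCapacitaryMeasure p μ)
    (h : SolvesRelaxed p μ z) {v : Eucl d → ℝ} (hv : v ∈ W p) (hv0 : ∀ x, 0 ≤ v x)
    (hv2 : MemLp v 2 μ) : ∀ᵐ x ∂hp.capOuter, z x = 0 → v x = 0 := by
  have hz := h.mem
  have hz0 := h.quasi_nonneg hp hμ
  have hvan := hμ.vanishes hp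
  -- The remainders `g n` equal `v` on `{z = 0}` for every `n` and are eventually `0` where `z > 0`.
  -- It is enough to show that they tend to `0` in norm.
  set g : ℕ → Eucl d → ℝ := fun n x => max ((v - (n : ℝ) • z) x) 0 with hg
  have hgx : ∀ n x, g n x = max (v x - n * z x) 0 := fun n x => by simp [hg]
  have hgW : ∀ n, g n ∈ W p := fun n => posPart_mem hp hz hv n
  have hg0 : ∀ n x, 0 ≤ g n x := fun n x => le_max_right _ _
  have hgv : ∀ᵐ x ∂hp.capOuter, ∀ n, g n x ≤ v x := by
    filter_upwards [hz0] with x hx n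
    rw [hgx]
    exact max_le (by linarith [mul_nonneg (Nat.cast_nonneg (α := ℝ) n) hx]) (hv0 x)
  have hg2 : ∀ n, MemLp (g n) 2 μ := fun n => memLp_of_le hp hvan hv2 (hgW n) (by
    filter_upwards [hgv] with x hx
    rw [abs_of_nonneg (hg0 n x), abs_of_nonneg (hv0 x)]
    exact hx n)
  have hev : ∀ x, 0 < z x → ∀ᶠ n : ℕ in atTop, g n x = 0 := by
    intro x hx
    obtain ⟨N, hN⟩ := exists_nat_ge (v x / z x)
    filter_upwards [eventually_ge_atTop N] with n hn
    rw [hgx]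
    refine max_eq_right ?_
    have : v x / z x ≤ n := hN.trans (by exact_mod_cast hn)
    rw [div_le_iff₀ hx] at this
    linarith
  have hev0 : ∀ x, z x = 0 → ∀ n, g n x = v x := fun x hx n => by
    rw [hgx, hx, mul_zero, sub_zero, max_eq_left (hv0 x)]
  have hpt : ∀ n x, n * (z x * g n x) = v x * g n x - g n x * g n x := by
    intro n x
    rw [hgx]
    rcases le_total (v x - n * z x) 0 with h1 | h1
    · rw [max_eq_right h1]; ring
    · rw [max_eq_left h1]; ring
  -- The equation tested with `n • g n`, where `n z g = v g - g²`. All terms on the left are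
  -- nonnegative, so this bounds the energies and also gives `∫ g n = O(1/n)`.
  have hmain : ∀ n, p.normSq (g n) + n * ∫ x in Ω, g n x
      ≤ p.prod v (g n) + ∫ x, (v x * g n x - g n x * g n x) ∂μ := by
    intro n
    have h1 := mul_prod_posPart_le hp hz hv n
    have h2 := h.eq' hμ (hgW n) (hg2 n)
    have h3 : ∫ x, (v x * g n x - g n x * g n x) ∂μ = n * ∫ x, z x * g n x ∂μ := by
      rw [← integral_const_mul]
      exact integral_congr_ae (Eventually.of_forall fun x => (hpt n x).symm)
    rw [h3, ← h2]
    linarith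
  have hv2i : Integrable (fun x => v x * v x) μ := hv2.integrable_mul hv2
  have hbound : ∀ n, ∀ᵐ x ∂μ, ‖v x * g n x - g n x * g n x‖ ≤ v x * v x := fun n => by
    filter_upwards [hvan.ae hgv] with x hx
    rw [Real.norm_eq_abs, abs_le]
    constructor <;> nlinarith [hx n, hg0 n x, hv0 x]
  set M := ∫ x, v x * v x ∂μ with hM
  have hle : ∀ n, ∫ x, (v x * g n x - g n x * g n x) ∂μ ≤ M := fun n =>
    integral_mono_ae ((hv2.integrable_mul (hg2 n)).sub ((hg2 n).integrable_mul (hg2 n))) hv2i (by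
      filter_upwards [hbound n] with x hx
      exact (le_abs_self _).trans hx)
  have hgint : ∀ n, 0 ≤ ∫ x in Ω, g n x := fun n => integral_nonneg (hg0 n)
  have hM0 : 0 ≤ M := integral_nonneg fun x => mul_self_nonneg _
  have hprodle : ∀ n, p.prod v (g n) ≤ p.normSq v / 2 + p.normSq (g n) / 2 := fun n => by
    have := hp.nonneg (hp.sub hv.1.1 (hgW n).1.1)
    rw [hp.normSq_sub hv.1.1 (hgW n).1.1] at this
    linarith
  have hC : ∀ n, p.normSq (g n) ≤ p.normSq v + 2 * M := fun n => by
    have h1 := hmain n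
    have h2 := mul_nonneg (Nat.cast_nonneg (α := ℝ) n) (hgint n)
    linarith [hprodle n, hle n]
  have hgL1 : Tendsto (fun n => ∫ x in Ω, g n x) atTop (𝓝 0) := by
    have h1 : Tendsto (fun n : ℕ => (p.normSq v + 2 * M) / (n : ℝ)) atTop (𝓝 0) :=
      tendsto_const_div_atTop_nhds_zero_nat _
    refine squeeze_zero' (Eventually.of_forall hgint) ?_ h1
    filter_upwards [eventually_gt_atTop 0] with n hn
    rw [le_div_iff₀ (by exact_mod_cast hn)]
    have h2 := hmain n
    linarith [hprodle n, hle n, hp.nonneg (hgW n).1.1, hp.nonneg hv.1.1]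
  have hvol := hp.vanishes_volume
  have hlim0 : ∀ᵐ x ∂hp.capOuter, Tendsto (fun n => g n x) atTop
      (𝓝 ({x | z x = 0}.indicator v x)) := by
    filter_upwards [hz0] with x hx
    rcases hx.eq_or_lt with h1 | h1
    · have h2 : x ∈ {x | z x = 0} := h1.symm
      rw [indicator_of_mem h2]
      simp only [hev0 x h1.symm]
      exact tendsto_const_nhds
    · have h2 : x ∉ {x | z x = 0} := fun h3 => h1.ne' h3
      rw [indicator_of_notMem h2]
      refine tendsto_const_nhds.congr' ?_
      filter_upwards [hev x h1] with n hn
      rw [hn]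
  -- The `L¹` limit of `g n` is `0`, and its pointwise limit is `v` on `{z = 0}`; so `v = 0` almost
  -- everywhere there. With this, dominated convergence gives `g n → 0` in `L²`, hence weakly in
  -- `W`.
  have hae : ∀ᵐ x ∂volume.restrict Ω, {x | z x = 0}.indicator v x = 0 := by
    have hlim1 : Tendsto (fun n => ∫ x in Ω, g n x) atTop
        (𝓝 (∫ x in Ω, {x | z x = 0}.indicator v x)) := by
      refine tendsto_integral_of_dominated_convergence v
        (fun n => (hp.memLp (hgW n).1.1).1) (hp.integrable hv.1.1) (fun n => ?_) (hvol.ae hlim0)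
      filter_upwards [hvol.ae hgv] with x hx
      rw [Real.norm_eq_abs, abs_of_nonneg (hg0 n x)]
      exact hx n
    have h0 := tendsto_nhds_unique hlim1 hgL1
    have hmeas : AEStronglyMeasurable ({x | z x = 0}.indicator v) (volume.restrict Ω) :=
      aestronglyMeasurable_of_tendsto_ae atTop (fun n => (hp.memLp (hgW n).1.1).1)
        (hvol.ae hlim0)
    have hint : Integrable ({x | z x = 0}.indicator v) (volume.restrict Ω) :=
      (hp.integrable hv.1.1).mono hmeas (Eventually.of_forall fun x => norm_indicator_le_norm_self _ _)
    rwa [integral_eq_zero_iff_of_nonneg (fun x => indicator_nonneg (fun x _ => hv0 x) x) hint] at h0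
  have hgL2 : Tendsto (fun n => eLpNorm (g n) 2 (volume.restrict Ω)) atTop (𝓝 0) := by
    have h1 : Tendsto (fun n => ∫⁻ x in Ω, ‖g n x‖ₑ ^ (2 : ℝ)) atTop (𝓝 (∫⁻ x in Ω, 0)) := by
      refine tendsto_lintegral_of_dominated_convergence' (fun x => ‖v x‖ₑ ^ (2 : ℝ))
        (fun n => (hp.memLp (hgW n).1.1).1.enorm.pow_const _) (fun n => ?_) ?_ ?_
      · filter_upwards [hvol.ae hgv] with x hx
        gcongr
        rw [Real.enorm_eq_ofReal (hg0 n x), Real.enorm_eq_ofReal (hv0 x)]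
        exact ENNReal.ofReal_le_ofReal (hx n)
      · have := lintegral_rpow_enorm_lt_top_of_eLpNorm_lt_top (p := 2) (by norm_num) (by norm_num)
          (hp.memLp hv.1.1).2
        simpa using this.ne
      · filter_upwards [hvol.ae hlim0, hae] with x h1 h2
        rw [h2] at h1
        have h3 := ((ENNReal.continuous_rpow_const (y := 2)).comp continuous_enorm).tendsto (0 : ℝ)
        have h4 := h3.comp h1
        simpa [Function.comp_def] using h4
    rw [lintegral_zero] at h1
    have h2 := ((ENNReal.continuous_rpow_const (y := (1 / 2 : ℝ))).tendsto 0).comp h1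
    rw [ENNReal.zero_rpow_of_pos (by norm_num)] at h2
    refine h2.congr fun n => ?_
    rw [eLpNorm_eq_lintegral_rpow_enorm_toReal (by norm_num) (by norm_num)]
    simp
  have hweak := hp.tendsto_prod_zero (fun n => (hgW n).1.1) hC hv.1.1 hgL2
  -- On `{z = 0}` neither product tends to `0` by itself, but `g n = v` there and the difference
  -- vanishes identically. With the weak convergence, the right-hand side of `hmain` tends to `0`,
  -- which gives convergence in norm.
  have hcancel : Tendsto (fun n => ∫ x, (v x * g n x - g n x * g n x) ∂μ) atTop (𝓝 0) := by
    have h1 : Tendsto (fun n => ∫ x, (v x * g n x - g n x * g n x) ∂μ) atTop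
        (𝓝 (∫ _, (0 : ℝ) ∂μ)) := by
      refine tendsto_integral_of_dominated_convergence (fun x => v x * v x)
        (fun n => ((hv2.1.mul (hg2 n).1).sub ((hg2 n).1.mul (hg2 n).1))) hv2i hbound ?_
      filter_upwards [hvan.ae hz0] with x hx
      refine tendsto_const_nhds.congr' ?_
      rcases hx.eq_or_lt with h1 | h1
      · exact Eventually.of_forall fun n => by simp only [hev0 x h1.symm, sub_self]
      · filter_upwards [hev x h1] with n hn
        rw [hn]
        ring
    rwa [integral_zero] at h1
  have hnorm : Tendsto (fun n => p.normSq (g n - 0)) atTop (𝓝 0) := by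
    have h1 := hweak.add hcancel
    rw [add_zero] at h1
    refine squeeze_zero (fun n => ?_) (fun n => ?_) h1
    · rw [sub_zero]
      exact hp.nonneg (hgW n).1.1
    · rw [sub_zero]
      have h2 := hmain n
      have h3 := mul_nonneg (Nat.cast_nonneg (α := ℝ) n) (hgint n)
      linarith
  obtain ⟨k, hk, hkt⟩ := hp.exists_subseq_tendsto hgW (hp.W_test zero_mem_testFunctions) hnorm
  filter_upwards [hkt] with x hx hzx
  simp only [hev0 x hzx] at hx
  exact tendsto_nhds_unique tendsto_const_nhds hx

/-- The measure of a set that meets `{z = 0}` in positive capacity is infinite. -/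
lemma capOuter_eq_zero_of_lt_top (hp : IsRegularForm p) (hμ : IsCapacitaryMeasure p μ)
    (h : SolvesRelaxed p μ z) {B : Set (Eucl d)} (hBΩ : B ⊆ Ω) (hB : MeasurableSet B)
    (hfin : μ B < ⊤) : hp.capOuter (B ∩ {x | z x = 0}) = 0 := by
  have hvan := hμ.vanishes hp
  -- The regularity of `μ` supplies a quasi open `A ⊇ B` of finite measure; without it there would
  -- be no nontrivial admissible functions near `B`.
  rw [hμ.eq_iInf B hBΩ hB] at hfin
  simp only [iInf_lt_iff] at hfin
  obtain ⟨A, ⟨hA, hBA⟩, hAfin⟩ := hfin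
  refine le_antisymm (ENNReal.le_of_forall_pos_le_add fun ε hε _ => ?_) zero_le
  have hε2 : (0 : ℝ≥0∞) < ε / 2 := ENNReal.half_pos (ENNReal.coe_pos.2 hε).ne'
  obtain ⟨O, hOΩ, hO, hAO, hlt⟩ := (hp.quasiOpen_iff.1 hA).2 _ hε2
  obtain ⟨w₀, hw₀, hw₀0, hw₀1, hw₀n⟩ := hp.exists_nonneg_potential hO hOΩ hlt.ne_top
  obtain ⟨w, hw, hww⟩ := hp.exists_representative hw₀
  have hwn : p.normSq w = p.normSq w₀ := hp.normSq_congr hw₀.1 hww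
  have hw1 : ∀ᵐ x ∂hp.capOuter, x ∈ O → 1 ≤ w x := by
    have := hp.quasi_nonneg_of_ae (w := fun x => w x - 1) (hp.quasiContinuous_comp₂ hw.2 hw.2
      (F := fun a _ => a - 1) (by fun_prop)) hO (by
        filter_upwards [hw₀1, hww] with x h1 h2 hxO
        linarith [h1 hxO])
    filter_upwards [this] with x hx hxO
    linarith [hx hxO]
  have hw0 : ∀ᵐ x ∂hp.capOuter, 0 ≤ w x := by
    have := hp.quasi_nonneg_of_ae hw.2 isOpen_univ (by
      filter_upwards [hww] with x h1 _
      rw [← h1]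
      exact hw₀0 x)
    filter_upwards [this] with x hx
    exact hx (mem_univ x)
  obtain ⟨K, hKc, hKO, hKm, hKU⟩ := exists_compact_exhaustion hAO
  choose ψ hψ hψ01 hψ1 using fun n => exists_testFunction_eq_one (hKc n) hAO (hKO n)
  have hψt : ∀ n, ψ n ∈ testFunctions Ω := fun n =>
    ⟨(hψ n).1, (hψ n).2.1, (hψ n).2.2.trans (union_subset hA.1 hOΩ)⟩
  -- Here `ψ n` is a cut-off in the open set `A ∪ O`, and `w ≥ 1` on `O`. So `v n` is at most `1`
  -- and lives on `A` only, hence is in `L²_μ` and vanishes on `{z = 0}`. On `B ∩ {z = 0}` this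
  -- forces `w ≥ ψ n = 1` for large `n`, and `w` has small norm.
  set v : ℕ → Eucl d → ℝ := fun n x => max ((ψ n - w) x) 0 with hv
  have hvW : ∀ n, v n ∈ W p := fun n => hp.W_posPart (hp.W_sub (hp.W_test (hψt n)) hw)
  have hv2 : ∀ n, MemLp (v n) 2 μ := by
    intro n
    -- `A` need not be Borel; its measurable hull has the same finite measure.
    have hT : MemLp ((toMeasurable μ A).indicator fun _ => (1 : ℝ)) 2 μ :=
      memLp_indicator_const 2 (measurableSet_toMeasurable μ A) 1
        (Or.inr (by rw [measure_toMeasurable]; exact hAfin.ne))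
    refine memLp_of_le hp hvan hT (hvW n) ?_
    filter_upwards [hw1, hw0] with x h1 h2
    rw [abs_of_nonneg (le_max_right _ _)]
    by_cases hxA : x ∈ A
    · rw [indicator_of_mem (subset_toMeasurable μ A hxA), abs_one]
      refine max_le ?_ zero_le_one
      simp only [Pi.sub_apply]
      linarith [(hψ01 n x).2]
    · refine le_trans (max_le ?_ le_rfl) (abs_nonneg _)
      simp only [Pi.sub_apply]
      by_cases hxO : x ∈ O
      · linarith [(hψ01 n x).2, h1 hxO]
      · have : x ∉ tsupport (ψ n) := fun hx => ((hψ n).2.2 hx).elim hxA hxO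
        rw [image_eq_zero_of_notMem_tsupport this]
        linarith
  have hvz : ∀ᵐ x ∂hp.capOuter, ∀ n, z x = 0 → v n x = 0 := by
    rw [ae_all_iff]
    exact fun n => h.quasi_eq_zero hp hμ (hvW n) (fun x => le_max_right _ _) (hv2 n)
  have hcap := hp.capOuter_le hw (B := B ∩ {x | z x = 0}) (by
    filter_upwards [hvz] with x hx hxB
    obtain ⟨n, hn⟩ := hKU x (Or.inl (hBA hxB.1))
    have h1 := hx n hxB.2
    have h2 : (ψ n - w) x ≤ 0 := by
      rw [← h1]
      exact le_max_left _ _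
    rw [Pi.sub_apply, hψ1 n x hn] at h2
    exact (by linarith : 1 ≤ w x).trans (le_abs_self _))
  rw [zero_add]
  refine hcap.trans ?_
  rw [hwn, ENNReal.ofReal_mul (by norm_num)]
  calc ENNReal.ofReal 2 * ENNReal.ofReal √(p.normSq w₀) ≤ 2 * (ε / 2) := by
        gcongr
        · simp
        · exact hw₀n.trans hlt.le
    _ = ε := ENNReal.mul_div_cancel (by norm_num) (by norm_num)

end SolvesRelaxed

namespace IsRegularForm

variable {η : Measure (Eucl d)} {z z' : Eucl d → ℝ}

/-! ### Construction of the capacitary measure -/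

/-- The measure `η / z`, set to `∞` where `z` vanishes on a set of positive capacity. -/
def relaxing (hp : IsRegularForm p) (η : Measure (Eucl d)) (z : Eucl d → ℝ) :
    Measure (Eucl d) :=
  η.withDensity (fun x => (ENNReal.ofReal (z x))⁻¹) + hp.topCap {x | z x = 0}

lemma relaxing_apply (hp : IsRegularForm p) {B : Set (Eucl d)} (hB : MeasurableSet B) :
    hp.relaxing η z B
      = ∫⁻ x in B, (ENNReal.ofReal (z x))⁻¹ ∂η + ⊤ * hp.capOuter (B ∩ {x | z x = 0}) := by
  rw [relaxing, Measure.add_apply, withDensity_apply _ hB, hp.topCap_apply hB]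

lemma vanishes_relaxing (hp : IsRegularForm p) (hη : hp.Vanishes η) :
    hp.Vanishes (hp.relaxing η z) := by
  intro N hN
  rw [relaxing, Measure.add_apply, hp.vanishes_topCap _ N hN, add_zero]
  exact withDensity_absolutelyContinuous _ _ (hη N hN)

lemma exists_open_exhaustion (hΩ : IsOpen Ω) :
    ∃ U L : ℕ → Set (Eucl d), (∀ n, IsOpen (U n)) ∧ (∀ n, IsCompact (L n)) ∧ (∀ n, U n ⊆ L n) ∧
      (∀ n, L n ⊆ Ω) ∧ ∀ x ∈ Ω, ∀ᶠ n in atTop, x ∈ U n := by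
  obtain ⟨K, hKc, hKO, hKm, hKU⟩ := exists_compact_exhaustion hΩ
  choose L hL hKL hLΩ using fun n => exists_compact_between (hKc n) hΩ (hKO n)
  refine ⟨fun n => interior (L n), L, fun n => isOpen_interior, hL, fun n => interior_subset,
    hLΩ, fun x hx => ?_⟩
  obtain ⟨N, hN⟩ := hKU x hx
  filter_upwards [eventually_ge_atTop N] with n hn
  exact hKL n (hKm hn hN)

lemma relaxing_inter_le (hp : IsRegularForm p) (hz' : Measurable z') {S : Set (Eucl d)}
    (hS : MeasurableSet S) {r : ℝ} (hr : 0 < r) :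
    hp.relaxing η z' (S ∩ {x | r < z' x}) ≤ (ENNReal.ofReal r)⁻¹ * η S := by
  have hm : MeasurableSet {x | r < z' x} := measurableSet_lt measurable_const hz'
  rw [hp.relaxing_apply (hS.inter hm)]
  have hempty : S ∩ {x | r < z' x} ∩ {x | z' x = 0} = ∅ := by
    ext x
    simp only [mem_inter_iff, mem_ofPred_eq, mem_empty_iff_false, iff_false, not_and]
    rintro ⟨-, h⟩ h0
    linarith
  rw [hempty, measure_empty, mul_zero, add_zero]
  calc ∫⁻ x in S ∩ {x | r < z' x}, (ENNReal.ofReal (z' x))⁻¹ ∂η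
      ≤ ∫⁻ _ in S ∩ {x | r < z' x}, (ENNReal.ofReal r)⁻¹ ∂η := by
        refine setLIntegral_mono' (hS.inter hm) fun x hx => ?_
        exact ENNReal.inv_le_inv.2 (ENNReal.ofReal_le_ofReal (le_of_lt hx.2))
    _ = (ENNReal.ofReal r)⁻¹ * η (S ∩ {x | r < z' x}) := setLIntegral_const _ _
    _ ≤ _ := by
        gcongr
        exact inter_subset_left

/-- Only approximation by quasi open sets needs an argument, and only for a set `B` of finite
measure, which then meets `{z = 0}` in capacity zero. On `{z > r n}` the density is at most `1 / r
n`, so an open set exceeding `B ∩ U n` in `U n` by `η`-measure less than `r n * ε' n` exceeds it by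
at most `ε' n` for the new measure after intersection with `{z > r n}`. These quasi open sets cover
`B ∩ {z > 0}`, and the remaining null set is itself quasi open. -/
lemma isCapacitaryMeasure_relaxing (hp : IsRegularForm p) (hzqc : QuasiContinuous p z)
    (hz0 : ∀ᵐ x ∂hp.capOuter, 0 ≤ z x) (hz' : Measurable z')
    (hzz' : ∀ᵐ x ∂hp.capOuter, z x = z' x) (hη : hp.Vanishes η)
    (hηfin : ∀ C ⊆ Ω, IsCompact C → η C < ⊤) : IsCapacitaryMeasure p (hp.relaxing η z') := by
  have hvan := hp.vanishes_relaxing (z := z') hη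
  set μ := hp.relaxing η z' with hμ
  refine ⟨hvan _ hp.capOuter_compl, fun B hBΩ hB h =>
    hvan B ((hp.capOuter_eq_zero_iff_of_subset hBΩ).2 h), fun B hBΩ hB => ?_⟩
  refine le_antisymm (le_iInf₂ fun A hA => measure_mono hA.2) ?_
  by_cases htop : μ B = ⊤
  · rw [htop]
    exact le_top
  have hB0 : hp.capOuter (B ∩ {x | z' x = 0}) = 0 := by
    by_contra hne
    apply htop
    rw [hμ, hp.relaxing_apply hB, ENNReal.top_mul hne, add_top]
  refine ENNReal.le_of_forall_pos_le_add fun ε hε _ => ?_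
  obtain ⟨ε', hε', hsum⟩ := ENNReal.exists_pos_sum_of_countable' (ENNReal.coe_ne_zero.2 hε.ne') ℕ
  obtain ⟨U, L, hU, hL, hUL, hLΩ, hUev⟩ := exists_open_exhaustion hp.isOpen
  set r : ℕ → ℝ := fun n => 1 / ((n : ℝ) + 1) with hr
  have hr0 : ∀ n, 0 < r n := fun n => by simp only [hr]; positivity
  have hex : ∀ n, ∃ V, B ∩ U n ⊆ V ∧ IsOpen V ∧
      η ((V \ (B ∩ U n)) ∩ U n) < ENNReal.ofReal (r n) * ε' n := by
    intro n
    have hfin : IsFiniteMeasure (η.restrict (U n)) := isFiniteMeasure_restrict.2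
      ((measure_mono (hUL n)).trans_lt (hηfin _ (hLΩ n) (hL n))).ne
    obtain ⟨V, h1, h2, -, h3⟩ := (hB.inter (hU n).measurableSet).exists_isOpen_sdiff_lt
      (μ := η.restrict (U n)) (measure_ne_top _ _)
      (ε := ENNReal.ofReal (r n) * ε' n)
      (mul_ne_zero (ENNReal.ofReal_pos.2 (hr0 n)).ne' (hε' n).ne')
    refine ⟨V, h1, h2, ?_⟩
    rwa [Measure.restrict_apply (h2.measurableSet.diff (hB.inter (hU n).measurableSet))] at h3
  choose V hBV hV hVlt using hex
  set A : ℕ → Set (Eucl d) := fun n => (V n ∩ U n) ∩ Ω ∩ z ⁻¹' Ioi (r n) with hA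
  set N : Set (Eucl d) := B ∩ {x | z x ≤ 0} with hN
  have hN0 : hp.capOuter N = 0 := by
    refine le_antisymm ?_ zero_le
    rw [← hB0]
    refine measure_mono_ae ?_
    filter_upwards [hz0, hzz'] with x h1 h2 hx
    exact ⟨hx.1, by rw [mem_ofPred_eq, ← h2]; exact le_antisymm hx.2 h1⟩
  have hAq : QuasiOpen p ((⋃ n, A n) ∪ N) := hp.quasiOpen_union
    (hp.quasiOpen_iUnion fun n => hp.quasiOpen_superlevel hzqc ((hV n).inter (hU n)) isOpen_Ioi)
    (hp.quasiOpen_null (inter_subset_left.trans hBΩ) hN0)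
  have hBA : B ⊆ (⋃ n, A n) ∪ N := by
    intro x hx
    rcases le_or_gt (z x) 0 with h | h
    · exact Or.inr ⟨hx, h⟩
    · left
      have h1 : ∀ᶠ n in atTop, r n < z x := (tendsto_order.1 tendsto_one_div_nat_succ).2 _ h
      obtain ⟨n, h2, h3⟩ := (h1.and (hUev x (hBΩ hx))).exists
      exact mem_iUnion.2 ⟨n, ⟨⟨hBV n ⟨hx, h3⟩, h3⟩, hBΩ hx⟩, h2⟩
  have hAn : ∀ n, μ (A n \ B) ≤ ε' n := by
    intro n
    set S := (V n \ (B ∩ U n)) ∩ U n with hS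
    have hSm : MeasurableSet S :=
      ((hV n).measurableSet.diff (hB.inter (hU n).measurableSet)).inter (hU n).measurableSet
    calc μ (A n \ B) ≤ μ (S ∩ {x | r n < z' x}) := by
          refine measure_mono_ae ?_
          filter_upwards [hvan.ae hzz'] with x h1 hx
          obtain ⟨⟨⟨⟨hxV, hxU⟩, -⟩, hxz⟩, hxB⟩ := hx
          refine ⟨⟨⟨hxV, fun h => hxB h.1⟩, hxU⟩, ?_⟩
          show r n < z' x
          rw [← h1]
          exact hxz
      _ ≤ (ENNReal.ofReal (r n))⁻¹ * η S := hp.relaxing_inter_le hz' hSm (hr0 n)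
      _ ≤ (ENNReal.ofReal (r n))⁻¹ * (ENNReal.ofReal (r n) * ε' n) := by
          gcongr
          exact (hVlt n).le
      _ = ε' n := by
          rw [← mul_assoc, ENNReal.inv_mul_cancel (ENNReal.ofReal_pos.2 (hr0 n)).ne'
            ENNReal.ofReal_ne_top, one_mul]
  calc (⨅ A ∈ {A | QuasiOpen p A ∧ B ⊆ A}, μ A) ≤ μ ((⋃ n, A n) ∪ N) :=
        iInf₂_le _ ⟨hAq, hBA⟩
    _ ≤ μ (B ∪ (⋃ n, A n \ B) ∪ N) := by
        refine measure_mono (union_subset_union_left _ fun x hx => ?_)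
        obtain ⟨n, hn⟩ := mem_iUnion.1 hx
        by_cases hxB : x ∈ B
        · exact Or.inl hxB
        · exact Or.inr (mem_iUnion.2 ⟨n, hn, hxB⟩)
    _ ≤ μ B + μ (⋃ n, A n \ B) + μ N :=
        (measure_union_le _ _).trans (by gcongr; exact measure_union_le _ _)
    _ ≤ μ B + ∑' n, ε' n + 0 := by
        gcongr
        · exact (measure_iUnion_le _).trans (ENNReal.tsum_le_tsum hAn)
        · exact (hvan N hN0).le
    _ ≤ μ B + ε := by
        rw [add_zero]
        gcongr

lemma lintegral_relaxing (hp : IsRegularForm p) (hz' : Measurable z') {f : Eucl d → ℝ≥0∞}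
    (hf : AEMeasurable f η) :
    ∫⁻ x, f x ∂hp.relaxing η z'
      = ∫⁻ x, (ENNReal.ofReal (z' x))⁻¹ * f x ∂η + ∫⁻ x, f x ∂hp.topCap {x | z' x = 0} := by
  have hd : Measurable fun x => (ENNReal.ofReal (z' x))⁻¹ := hz'.ennreal_ofReal.inv
  rw [relaxing, lintegral_add_measure,
    lintegral_withDensity_eq_lintegral_mul₀ hd.aemeasurable hf]
  rfl

lemma topCap_eq_zero (hp : IsRegularForm p) (hz' : Measurable z')
    (hzz' : ∀ᵐ x ∂hp.capOuter, z x = z' x) : ∀ᵐ x ∂hp.topCap {x | z' x = 0}, z x = 0 := by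
  have hm : MeasurableSet {x | z' x = 0} := hz' (measurableSet_singleton 0)
  have h1 : ∀ᵐ x ∂hp.topCap {x | z' x = 0}, z' x = 0 := by
    have : hp.topCap {x | z' x = 0} {x | z' x = 0}ᶜ = 0 := by
      rw [hp.topCap_eq_zero_iff hm.compl, compl_inter_self, measure_empty]
    exact this
  filter_upwards [h1, (hp.vanishes_topCap _).ae hzz'] with x h2 h3
  rw [h3, h2]

/-- The integral of `z²` against `η / z` is at most that of `z` against `η`, and the `∞ · cap` part
sits where `z = 0`. -/
lemma memLp_relaxing (hp : IsRegularForm p) (hz : z ∈ W p)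
    (hz0 : ∀ᵐ x ∂hp.capOuter, 0 ≤ z x) (hz' : Measurable z')
    (hzz' : ∀ᵐ x ∂hp.capOuter, z x = z' x) (hη : hp.Vanishes η) (hint : Integrable z η) :
    MemLp z 2 (hp.relaxing η z') := by
  have hvan := hp.vanishes_relaxing (z := z') hη
  have hmeas : AEStronglyMeasurable z (hp.relaxing η z') :=
    (hvan.aemeasurable hz.2).aestronglyMeasurable
  rw [memLp_two_iff_integrable_sq hmeas]
  refine ⟨hmeas.pow 2, ?_⟩
  rw [hasFiniteIntegral_iff_ofReal (Eventually.of_forall fun x => sq_nonneg (z x)),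
    hp.lintegral_relaxing hz' ((hη.aemeasurable hz.2).pow_const 2).ennreal_ofReal]
  have h1 : ∫⁻ x, ENNReal.ofReal (z x ^ 2) ∂hp.topCap {x | z' x = 0} = 0 := by
    rw [lintegral_congr_ae (g := fun _ => 0) (by
      filter_upwards [hp.topCap_eq_zero hz' hzz'] with x hx
      simp [hx]), lintegral_zero]
  rw [h1, add_zero]
  have h2 : ∫⁻ x, (ENNReal.ofReal (z' x))⁻¹ * ENNReal.ofReal (z x ^ 2) ∂η
      ≤ ∫⁻ x, ENNReal.ofReal (z x) ∂η := by
    refine lintegral_mono_ae ?_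
    filter_upwards [hη.ae hz0, hη.ae hzz'] with x h3 h4
    rw [← h4]
    rcases h3.eq_or_lt with h5 | h5
    · simp [← h5]
    · rw [sq, ENNReal.ofReal_mul h3, ← mul_assoc, ENNReal.inv_mul_cancel
        (ENNReal.ofReal_pos.2 h5).ne' ENNReal.ofReal_ne_top, one_mul]
  refine h2.trans_lt ?_
  rw [← hasFiniteIntegral_iff_ofReal (hη.ae hz0)]
  exact hint.2

/-- The integral of `v²` over `{z' = 0}` is finite for a measure that equals `∞` times itself, so it
is zero, and null sets of that measure are capacity null on `{z' = 0}`. -/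
lemma quasi_eq_zero_of_memLp_relaxing (hp : IsRegularForm p) {v : Eucl d → ℝ}
    (hv2 : MemLp v 2 (hp.relaxing η z')) : ∀ᵐ x ∂hp.capOuter, z' x = 0 → v x = 0 := by
  have hle : hp.topCap {x | z' x = 0} ≤ hp.relaxing η z' := Measure.le_add_left le_rfl
  have h1 : MemLp v 2 (hp.topCap {x | z' x = 0}) := hv2.mono_measure hle
  have h2 : ∫⁻ x, ‖v x‖ₑ ^ (2 : ℝ) ∂hp.topCap {x | z' x = 0} < ⊤ := by
    have := lintegral_rpow_enorm_lt_top_of_eLpNorm_lt_top (p := 2) (by norm_num) (by norm_num) h1.2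
    simpa using this
  have h3 : ∫⁻ x, ‖v x‖ₑ ^ (2 : ℝ) ∂hp.topCap {x | z' x = 0} = 0 := by
    by_contra hne
    rw [← hp.top_smul_topCap, lintegral_smul_measure, smul_eq_mul, ENNReal.top_mul hne] at h2
    exact lt_irrefl _ h2
  rw [lintegral_eq_zero_iff' (h1.1.enorm.pow_const _)] at h3
  have h4 : ∀ᵐ x ∂hp.topCap {x | z' x = 0}, v x = 0 := by
    filter_upwards [h3] with x hx
    simpa using hx
  exact hp.quasi_of_ae_topCap h4

/-- For `v ≥ 0` everything is a Lebesgue integral: `(1 / z) z v = v` where `z > 0`, and `v` vanishes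
quasi everywhere, hence `η`-almost everywhere, where `z = 0`. So `∫ z v dμ = ∫ v dη`, which is the
representation formula. -/
lemma solves_nonneg (hp : IsRegularForm p) (hz : z ∈ W p)
    (hz0 : ∀ᵐ x ∂hp.capOuter, 0 ≤ z x) (hz' : Measurable z')
    (hzz' : ∀ᵐ x ∂hp.capOuter, z x = z' x) (hη : Represents p η z)
    {v : Eucl d → ℝ} (hv : v ∈ W p) (hv0 : ∀ x, 0 ≤ v x)
    (hv2 : MemLp v 2 (hp.relaxing η z')) :
    p.prod z v + ∫ x, z x * v x ∂hp.relaxing η z' = ∫ x in Ω, v x := by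
  have hvη := hη.vanishes hp hz.1.1
  have hvan := hp.vanishes_relaxing (z := z') hvη
  have hzint := (hη.integral_eq_of_mem hp hz.1.1 hz).1
  have hz2 := hp.memLp_relaxing hz hz0 hz' hzz' hvη hzint
  obtain ⟨hvint, hveq⟩ := hη.integral_eq_of_mem hp hz.1.1 hv
  have hint : Integrable (fun x => z x * v x) (hp.relaxing η z') := hz2.integrable_mul hv2
  have hzv := hp.quasi_eq_zero_of_memLp_relaxing hv2
  have hm : AEMeasurable (fun x => ENNReal.ofReal (z x * v x)) η :=
    ((hvη.aemeasurable hz.2).mul (hvη.aemeasurable hv.2)).ennreal_ofReal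
  have key : ∫ x, z x * v x ∂hp.relaxing η z' = ∫ x, v x ∂η := by
    rw [integral_eq_lintegral_of_nonneg_ae (by
        filter_upwards [hvan.ae hz0] with x hx
        exact mul_nonneg hx (hv0 x)) hint.1,
      integral_eq_lintegral_of_nonneg_ae (Eventually.of_forall hv0) hvint.1,
      hp.lintegral_relaxing hz' hm]
    have h1 : ∫⁻ x, ENNReal.ofReal (z x * v x) ∂hp.topCap {x | z' x = 0} = 0 := by
      rw [lintegral_congr_ae (g := fun _ => 0) (by
        filter_upwards [hp.topCap_eq_zero hz' hzz'] with x hx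
        simp [hx]), lintegral_zero]
    rw [h1, add_zero]
    congr 1
    refine lintegral_congr_ae ?_
    filter_upwards [hvη.ae hz0, hvη.ae hzz', hvη.ae hzv] with x h3 h4 h6
    rw [← h4] at h6 ⊢
    rcases h3.eq_or_lt with h5 | h5
    · simp [h6 h5.symm]
    · rw [ENNReal.ofReal_mul h3, ← mul_assoc, ENNReal.inv_mul_cancel
        (ENNReal.ofReal_pos.2 h5).ne' ENNReal.ofReal_ne_top, one_mul]
  rw [key, hveq]
  ring

lemma solvesRelaxed_relaxing (hp : IsRegularForm p) (hz : z ∈ W p)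
    (hz0 : ∀ᵐ x ∂hp.capOuter, 0 ≤ z x) (hz' : Measurable z')
    (hzz' : ∀ᵐ x ∂hp.capOuter, z x = z' x) (hη : Represents p η z) :
    SolvesRelaxed p (hp.relaxing η z') z := by
  have hvη := hη.vanishes hp hz.1.1
  have hvan := hp.vanishes_relaxing (z := z') hvη
  have hzint := (hη.integral_eq_of_mem hp hz.1.1 hz).1
  have hz2 := hp.memLp_relaxing hz hz0 hz' hzz' hvη hzint
  refine ⟨hz, hz2, fun v hv hv2 => ?_⟩
  rw [setIntegral_eq_integral (hvan _ hp.capOuter_compl)]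
  have hW1 := hp.W_posPart hv
  have hW2 := hp.W_posPart (hp.W_smul (-1) hv)
  set a : Eucl d → ℝ := fun x => max (v x) 0 with ha
  set b : Eucl d → ℝ := fun x => max (((-1 : ℝ) • v) x) 0 with hb
  have hab : v = a - b := by
    ext x
    simp only [ha, hb, Pi.sub_apply, Pi.smul_apply, smul_eq_mul, neg_one_mul]
    exact (max_zero_sub_eq_self (v x)).symm
  have ha2 : MemLp a 2 (hp.relaxing η z') := SolvesRelaxed.memLp_of_le hp hvan hv2 hW1
    (Eventually.of_forall fun x => by
      rw [abs_of_nonneg (le_max_right _ _)]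
      exact max_le (le_abs_self _) (abs_nonneg _))
  have hb2 : MemLp b 2 (hp.relaxing η z') := SolvesRelaxed.memLp_of_le hp hvan hv2 hW2
    (Eventually.of_forall fun x => by
      rw [abs_of_nonneg (le_max_right _ _)]
      refine max_le ?_ (abs_nonneg _)
      simpa using neg_le_abs (v x))
  have e1 := hp.solves_nonneg hz hz0 hz' hzz' hη hW1 (fun x => le_max_right _ _) ha2
  have e2 := hp.solves_nonneg hz hz0 hz' hzz' hη hW2 (fun x => le_max_right _ _) hb2
  have i1 : Integrable (fun x => z x * a x) (hp.relaxing η z') := hz2.integrable_mul ha2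
  have i2 : Integrable (fun x => z x * b x) (hp.relaxing η z') := hz2.integrable_mul hb2
  rw [hab, hp.prod_sub hz.1.1 hW1.1.1 hW2.1.1]
  simp only [Pi.sub_apply, mul_sub]
  rw [integral_sub i1 i2, integral_sub (hp.integrable hW1.1.1) (hp.integrable hW2.1.1)]
  linarith

/-- A Borel set that meets `{z = 0}` in positive capacity has infinite measure for both. Otherwise
the part where `z ≤ 0` is null for both, and on `{z > 0}` the identity `z μ = η` can be divided by
`z`. -/
lemma relaxing_unique (hp : IsRegularForm p) (hz : z ∈ W p) (hz' : Measurable z')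
    (hzz' : ∀ᵐ x ∂hp.capOuter, z x = z' x) (hη : Represents p η z) {μ : Measure (Eucl d)}
    (hμ : IsCapacitaryMeasure p μ) (h : SolvesRelaxed p μ z) : μ = hp.relaxing η z' := by
  have hvan := hμ.vanishes hp
  have hvη := hη.vanishes hp hz.1.1
  have hvr := hp.vanishes_relaxing (z := z') hvη
  have hz0 := h.quasi_nonneg hp hμ
  have hdens := h.restrict_eq_withDensity hp hμ hη hz' hzz'
  have hpos : MeasurableSet {x | 0 < z' x} := measurableSet_lt measurable_const hz'
  have key : ∀ B ⊆ Ω, MeasurableSet B → μ B = hp.relaxing η z' B := by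
    intro B hBΩ hB
    have hcongr : hp.capOuter (B ∩ {x | z' x = 0}) = hp.capOuter (B ∩ {x | z x = 0}) := by
      refine measure_congr ?_
      filter_upwards [hzz'] with x hx
      refine propext ⟨fun hxB => ⟨hxB.1, ?_⟩, fun hxB => ⟨hxB.1, ?_⟩⟩
      · exact hx.trans hxB.2
      · exact hx.symm.trans hxB.2
    by_cases h0 : hp.capOuter (B ∩ {x | z' x = 0}) = 0
    · have hnull : hp.capOuter (B \ {x | 0 < z' x}) = 0 := by
        refine le_antisymm ?_ zero_le
        rw [← h0]
        refine measure_mono_ae ?_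
        filter_upwards [hz0, hzz'] with x h1 h2 hx
        have h3 : z' x ≤ 0 := not_lt.1 hx.2
        exact ⟨hx.1, le_antisymm h3 (h2 ▸ h1)⟩
      have hd : Measurable fun x => (ENNReal.ofReal (z' x))⁻¹ := hz'.ennreal_ofReal.inv
      have e1 : μ B = μ (B ∩ {x | 0 < z' x}) := by
        rw [← measure_inter_add_sdiff B hpos, hvan _ hnull, add_zero]
      have e2 : hp.relaxing η z' B = ∫⁻ x in B ∩ {x | 0 < z' x}, (ENNReal.ofReal (z' x))⁻¹ ∂η := by
        rw [hp.relaxing_apply hB, h0, mul_zero, add_zero]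
        refine setLIntegral_congr ?_
        refine (ae_eq_set.2 ⟨?_, ?_⟩)
        · rw [sdiff_self_inter]
          exact hvη _ hnull
        · rw [sdiff_eq_empty.2 inter_subset_left, measure_empty]
      rw [e1, e2]
      have e3 : ∫⁻ x in B ∩ {x | 0 < z' x}, (ENNReal.ofReal (z' x))⁻¹ ∂η
          = ∫⁻ x in B, (ENNReal.ofReal (z' x))⁻¹ ∂(η.restrict {x | 0 < z' x}) := by
        rw [Measure.restrict_restrict hB]
      rw [e3, ← hdens, ← lintegral_indicator hB,
        lintegral_withDensity_eq_lintegral_mul _ hz'.ennreal_ofReal (hd.indicator hB),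
        ← lintegral_indicator_one (hB.inter hpos)]
      refine lintegral_congr fun x => ?_
      simp only [Pi.mul_apply]
      by_cases hxB : x ∈ B
      · by_cases hxz : 0 < z' x
        · have hmem : x ∈ B ∩ {x | 0 < z' x} := ⟨hxB, hxz⟩
          rw [indicator_of_mem hmem, indicator_of_mem hxB, Pi.one_apply,
            ENNReal.mul_inv_cancel (ENNReal.ofReal_pos.2 hxz).ne' ENNReal.ofReal_ne_top]
        · have hmem : x ∉ B ∩ {x | 0 < z' x} := fun hx => hxz hx.2
          rw [indicator_of_notMem hmem, ENNReal.ofReal_of_nonpos (not_lt.1 hxz), zero_mul]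
      · have hmem : x ∉ B ∩ {x | 0 < z' x} := fun hx => hxB hx.1
        rw [indicator_of_notMem hmem, indicator_of_notMem hxB, mul_zero]
    · have e1 : hp.relaxing η z' B = ⊤ := by
        rw [hp.relaxing_apply hB, ENNReal.top_mul h0, add_top]
      rw [e1]
      by_contra hne
      rw [hcongr] at h0
      exact h0 (h.capOuter_eq_zero_of_lt_top hp hμ hBΩ hB (lt_top_iff_ne_top.2 hne))
  ext B hB
  have hΩm := hp.isOpen.measurableSet
  rw [← measure_inter_add_sdiff B hΩm, ← measure_inter_add_sdiff (μ := hp.relaxing η z') B hΩm,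
    key _ inter_subset_right (hB.inter hΩm)]
  have hd : hp.capOuter (B \ Ω) = 0 :=
    measure_mono_null (fun x hx => hx.2) hp.capOuter_compl
  rw [hvan _ hd, hvr _ hd]

/-- The characterisation of `𝓚(Ω)` by relaxed Dirichlet problems, for a regular form. -/
theorem mem_K_iff_and_formula (hp : IsRegularForm p) {z : Eucl d → ℝ} (hz : z ∈ W p) :
    (z ∈ K p ↔ ∃ μ, IsCapacitaryMeasure p μ ∧ SolvesRelaxed p μ z) ∧
    (z ∈ K p →
      ∃ η, Represents p η z ∧ (∀ η', Represents p η' z → η' = η) ∧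
      ∃ μ, (IsCapacitaryMeasure p μ ∧ SolvesRelaxed p μ z) ∧
        (∀ μ', IsCapacitaryMeasure p μ' → SolvesRelaxed p μ' z → μ' = μ) ∧
        ∀ B ⊆ Ω, MeasurableSet B →
          (cap p (B ∩ {x | z x = 0}) = 0 →
            μ B = ∫⁻ x in B, (ENNReal.ofReal (z x))⁻¹ ∂η) ∧
          (0 < cap p (B ∩ {x | z x = 0}) → μ B = ⊤) ∧
          η (B ∩ {x | 0 < z x}) = ∫⁻ x in B, ENNReal.ofReal (z x) ∂μ) := by
  have main : z ∈ K p →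
      ∃ η, Represents p η z ∧ (∀ η', Represents p η' z → η' = η) ∧
      ∃ μ, (IsCapacitaryMeasure p μ ∧ SolvesRelaxed p μ z) ∧
        (∀ μ', IsCapacitaryMeasure p μ' → SolvesRelaxed p μ' z → μ' = μ) ∧
        ∀ B ⊆ Ω, MeasurableSet B →
          (cap p (B ∩ {x | z x = 0}) = 0 →
            μ B = ∫⁻ x in B, (ENNReal.ofReal (z x))⁻¹ ∂η) ∧
          (0 < cap p (B ∩ {x | z x = 0}) → μ B = ⊤) ∧
          η (B ∩ {x | 0 < z x}) = ∫⁻ x in B, ENNReal.ofReal (z x) ∂μ := by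
    intro hK
    obtain ⟨η, hη⟩ := hp.exists_represents hK
    -- `z` is only quasi continuous. Densities and the zero set in the construction are taken from a
    -- Borel version, which agrees with `z` quasi everywhere and hence almost everywhere for all
    -- measures involved.
    obtain ⟨z', hz', hzz'⟩ := hp.exists_measurable_version hz.2
    have hz0 := hp.quasiEverywhere_iff.1 hK.2.1
    have hvη := hη.vanishes hp hz.1.1
    have hvr := hp.vanishes_relaxing (z := z') hvη
    have hcap := hp.isCapacitaryMeasure_relaxing hz.2 hz0 hz' hzz' hvη hη.finite_on_compacts
    have hsol := hp.solvesRelaxed_relaxing hz hz0 hz' hzz' hη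
    refine ⟨η, hη, fun η' hη' => hη'.unique hp.isOpen hη, hp.relaxing η z', ⟨hcap, hsol⟩,
      fun μ' h1 h2 => hp.relaxing_unique hz hz' hzz' hη h1 h2, fun B hBΩ hB => ?_⟩
    have hcongr : hp.capOuter (B ∩ {x | z' x = 0}) = hp.capOuter (B ∩ {x | z x = 0}) := by
      refine measure_congr ?_
      filter_upwards [hzz'] with x hx
      refine propext ⟨fun hxB => ⟨hxB.1, ?_⟩, fun hxB => ⟨hxB.1, ?_⟩⟩
      · exact hx.trans hxB.2
      · exact hx.symm.trans hxB.2
    have hsub : B ∩ {x | z x = 0} ⊆ Ω := inter_subset_left.trans hBΩ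
    refine ⟨fun h0 => ?_, fun h0 => ?_, ?_⟩
    · rw [← hp.capOuter_eq_zero_iff_of_subset hsub, ← hcongr] at h0
      rw [hp.relaxing_apply hB, h0, mul_zero, add_zero]
      refine lintegral_congr_ae (ae_restrict_of_ae ?_)
      filter_upwards [hvη.ae hzz'] with x hx
      rw [hx]
    · have h1 : hp.capOuter (B ∩ {x | z' x = 0}) ≠ 0 := by
        rw [hcongr, Ne, hp.capOuter_eq_zero_iff_of_subset hsub]
        exact h0.ne'
      rw [hp.relaxing_apply hB, ENNReal.top_mul h1, add_top]
    · have hdens := hsol.restrict_eq_withDensity hp hcap hη hz' hzz'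
      have h1 : η (B ∩ {x | 0 < z x}) = η (B ∩ {x | 0 < z' x}) := by
        refine measure_congr ?_
        filter_upwards [hvη.ae hzz'] with x hx
        refine propext ⟨fun hxB => ⟨hxB.1, ?_⟩, fun hxB => ⟨hxB.1, ?_⟩⟩
        · exact lt_of_lt_of_eq hxB.2 hx
        · exact lt_of_lt_of_eq hxB.2 hx.symm
      rw [h1, ← Measure.restrict_apply hB, ← hdens, withDensity_apply _ hB]
      refine lintegral_congr_ae (ae_restrict_of_ae ?_)
      filter_upwards [hvr.ae hzz'] with x hx
      rw [hx]
  refine ⟨⟨fun hK => ?_, fun ⟨μ, hμ, h⟩ => h.mem_K hp hμ⟩, main⟩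
  obtain ⟨-, -, -, μ, hμ, -⟩ := main hK
  exact ⟨μ, hμ⟩

end IsRegularForm

/-! ### The forms of `H^s(Ω)` and of `H^s(ℝ^d)` -/

lemma fracConst_pos (d : ℕ) {s : ℝ} (hs0 : 0 < s) (hs1 : s < 1) : 0 < fracConst d s := by
  unfold fracConst
  have h1 : 0 < Real.Gamma (s + d / 2) := Real.Gamma_pos_of_pos (by positivity)
  have h2 : 0 < Real.Gamma (1 - s) := Real.Gamma_pos_of_pos (by linarith)
  have h3 := Real.pi_pos
  positivity

/-- The difference quotient of order `s`, normalised such that its `L²` norm is the Gagliardo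
seminorm. -/
def hsQuot (s : ℝ) (w : Eucl d → ℝ) (q : Eucl d × Eucl d) : ℝ :=
  (w q.1 - w q.2) / ‖q.1 - q.2‖ ^ ((d : ℝ) / 2 + s)

lemma hsQuot_add (u v : Eucl d → ℝ) : hsQuot s (u + v) = hsQuot s u + hsQuot s v := by
  ext q
  simp only [hsQuot, Pi.add_apply]
  ring

lemma hsQuot_smul (c : ℝ) (u : Eucl d → ℝ) : hsQuot s (c • u) = c • hsQuot s u := by
  ext q
  simp only [hsQuot, Pi.smul_apply, smul_eq_mul]
  ring

lemma measurable_norm_rpow (a : ℝ) :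
    Measurable fun q : Eucl d × Eucl d => ‖q.1 - q.2‖ ^ a := by
  fun_prop

lemma aestronglyMeasurable_hsQuot {ν : Measure (Eucl d)} [SFinite ν] {w : Eucl d → ℝ}
    (hw : AEStronglyMeasurable w ν) : AEStronglyMeasurable (hsQuot s w) (ν.prod ν) := by
  have h1 : AEMeasurable (fun q : Eucl d × Eucl d => w q.1 - w q.2) (ν.prod ν) :=
    (hw.aemeasurable.comp_quasiMeasurePreserving Measure.quasiMeasurePreserving_fst).sub
      (hw.aemeasurable.comp_quasiMeasurePreserving Measure.quasiMeasurePreserving_snd)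
  exact (h1.div (measurable_norm_rpow _).aemeasurable).aestronglyMeasurable

/-- The signed quotient has the same modulus and, unlike the one in `MemHs`, is linear in `w`. -/
lemma memHs_iff {A : Set (Eucl d)} {w : Eucl d → ℝ} :
    MemHs s A w ↔ MemLp w 2 (volume.restrict A) ∧
      MemLp (hsQuot s w) 2 ((volume.restrict A).prod (volume.restrict A)) := by
  refine and_congr_right fun hw => ?_
  have hm := aestronglyMeasurable_hsQuot (s := s) hw.1
  have hn : ∀ q : Eucl d × Eucl d,
      ‖|w q.1 - w q.2| / ‖q.1 - q.2‖ ^ ((d : ℝ) / 2 + s)‖ = ‖hsQuot s w q‖ := by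
    intro q
    simp [hsQuot]
  constructor
  · intro h
    exact h.of_le hm (Eventually.of_forall fun q => (hn q).symm.le)
  · intro h
    refine h.of_le ?_ (Eventually.of_forall fun q => (hn q).le)
    have : (fun q : Eucl d × Eucl d => |w q.1 - w q.2| / ‖q.1 - q.2‖ ^ ((d : ℝ) / 2 + s))
        = fun q => ‖hsQuot s w q‖ := by
      ext q
      rw [← hn q, Real.norm_of_nonneg (by positivity)]
    rw [this]
    exact hm.norm

lemma hsQuot_mul_hsQuot (hs0 : 0 < s) (u w : Eucl d → ℝ) (x y : Eucl d) :
    hsQuot s u (x, y) * hsQuot s w (x, y)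
      = (u x - u y) * (w x - w y) / ‖x - y‖ ^ ((d : ℝ) + 2 * s) := by
  have h : ‖x - y‖ ^ ((d : ℝ) + 2 * s)
      = ‖x - y‖ ^ ((d : ℝ) / 2 + s) * ‖x - y‖ ^ ((d : ℝ) / 2 + s) := by
    -- Both exponents being nonnegative, the identity includes the diagonal `x = y`, where the norm
    -- is `0`.
    rw [← Real.rpow_add_of_nonneg (norm_nonneg _) (by positivity) (by positivity)]
    congr 1
    ring
  rw [h]
  simp only [hsQuot]
  rw [div_mul_div_comm]

lemma hsInner_eq (hs0 : 0 < s) {A : Set (Eucl d)} {u w : Eucl d → ℝ} (hu : MemHs s A u)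
    (hw : MemHs s A w) : hsInner s A u w = (∫ x in A, u x * w x) + fracConst d s / 2 *
      ∫ q, hsQuot s u q * hsQuot s w q ∂((volume.restrict A).prod (volume.restrict A)) := by
  have hi : Integrable (fun q => hsQuot s u q * hsQuot s w q)
      ((volume.restrict A).prod (volume.restrict A)) :=
    (memHs_iff.1 hu).2.integrable_mul (memHs_iff.1 hw).2
  rw [integral_prod _ hi]
  simp only [hsQuot_mul_hsQuot hs0]
  rfl

lemma hsInner_comm (A : Set (Eucl d)) (u w : Eucl d → ℝ) :
    hsInner s A u w = hsInner s A w u := by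
  simp only [hsInner, mul_comm]

lemma memHs_add {A : Set (Eucl d)} {u v : Eucl d → ℝ} (hu : MemHs s A u) (hv : MemHs s A v) :
    MemHs s A (u + v) := by
  rw [memHs_iff] at *
  rw [hsQuot_add]
  exact ⟨hu.1.add hv.1, hu.2.add hv.2⟩

lemma memHs_smul (c : ℝ) {A : Set (Eucl d)} {u : Eucl d → ℝ} (hu : MemHs s A u) :
    MemHs s A (c • u) := by
  rw [memHs_iff] at *
  rw [hsQuot_smul]
  exact ⟨hu.1.const_smul c, hu.2.const_smul c⟩

lemma hsInner_add (hs0 : 0 < s) {A : Set (Eucl d)} {u v w : Eucl d → ℝ} (hu : MemHs s A u)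
    (hv : MemHs s A v) (hw : MemHs s A w) :
    hsInner s A u (v + w) = hsInner s A u v + hsInner s A u w := by
  have huv := memHs_add hv hw
  rw [hsInner_eq hs0 hu huv, hsInner_eq hs0 hu hv, hsInner_eq hs0 hu hw, hsQuot_add]
  rw [memHs_iff] at hu hv hw
  simp only [Pi.add_apply, mul_add]
  have i1 : Integrable (fun x => u x * v x) (volume.restrict A) := hu.1.integrable_mul hv.1
  have i2 : Integrable (fun x => u x * w x) (volume.restrict A) := hu.1.integrable_mul hw.1
  have i3 : Integrable (fun q => hsQuot s u q * hsQuot s v q)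
    ((volume.restrict A).prod (volume.restrict A)) := hu.2.integrable_mul hv.2
  have i4 : Integrable (fun q => hsQuot s u q * hsQuot s w q)
    ((volume.restrict A).prod (volume.restrict A)) := hu.2.integrable_mul hw.2
  rw [integral_add i1 i2, integral_add i3 i4]
  ring

lemma hsInner_smul (hs0 : 0 < s) (c : ℝ) {A : Set (Eucl d)} {u v : Eucl d → ℝ}
    (hu : MemHs s A u) (hv : MemHs s A v) :
    hsInner s A u (c • v) = c * hsInner s A u v := by
  rw [hsInner_eq hs0 hu (memHs_smul c hv), hsInner_eq hs0 hu hv, hsQuot_smul]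
  simp only [Pi.smul_apply, smul_eq_mul, mul_left_comm _ c, integral_const_mul]
  ring

/-- The square of the `L²` norm as a Lebesgue integral. -/
lemma ofReal_integral_mul_self {α : Type*} [MeasurableSpace α] {μ : Measure α} {f : α → ℝ}
    (hf : MemLp f 2 μ) :
    ENNReal.ofReal (∫ x, f x * f x ∂μ) = ∫⁻ x, ‖f x‖ₑ ^ 2 ∂μ := by
  have hi : Integrable (fun x => f x * f x) μ := hf.integrable_mul hf
  rw [ofReal_integral_eq_lintegral_ofReal hi (Eventually.of_forall fun x => mul_self_nonneg _)]
  refine lintegral_congr fun x => ?_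
  rw [Real.enorm_eq_ofReal_abs, ← ENNReal.ofReal_pow (abs_nonneg _), sq_abs, sq]

lemma memLp_two_of_lintegral {α : Type*} [MeasurableSpace α] {μ : Measure α} {f : α → ℝ}
    (hf : AEStronglyMeasurable f μ) (h : ∫⁻ x, ‖f x‖ₑ ^ 2 ∂μ < ⊤) : MemLp f 2 μ := by
  refine ⟨hf, ?_⟩
  rw [eLpNorm_lt_top_iff_lintegral_rpow_enorm_lt_top (by norm_num) (by norm_num)]
  simpa using h

lemma eLpNorm_two_eq_sqrt {α : Type*} [MeasurableSpace α] {μ : Measure α} {f : α → ℝ}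
    (hf : MemLp f 2 μ) : eLpNorm f 2 μ = ENNReal.ofReal √(∫ x, f x * f x ∂μ) := by
  rw [eLpNorm_eq_lintegral_rpow_enorm_toReal (by norm_num) (by norm_num), Real.sqrt_eq_rpow,
    ← ENNReal.ofReal_rpow_of_nonneg (integral_nonneg fun x => mul_self_nonneg _) (by norm_num),
    ofReal_integral_mul_self hf]
  simp

/-- The squared norm of `H^s(A)` as an extended real number. -/
def hsEnergy (s : ℝ) (A : Set (Eucl d)) (w : Eucl d → ℝ) : ℝ≥0∞ :=
  (∫⁻ x in A, ‖w x‖ₑ ^ 2) + ENNReal.ofReal (fracConst d s / 2) *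
    ∫⁻ q, ‖hsQuot s w q‖ₑ ^ 2 ∂((volume.restrict A).prod (volume.restrict A))

lemma hsInner_self_nonneg (hs0 : 0 < s) (hs1 : s < 1) {A : Set (Eucl d)} {u : Eucl d → ℝ}
    (hu : MemHs s A u) : 0 ≤ hsInner s A u u ∧ ∫ x in A, u x * u x ≤ hsInner s A u u := by
  rw [hsInner_eq hs0 hu hu]
  have h1 := fracConst_pos d hs0 hs1
  have h2 : 0 ≤ ∫ x in A, u x * u x := integral_nonneg fun x => mul_self_nonneg _
  have h3 : 0 ≤ ∫ q, hsQuot s u q * hsQuot s u q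
    ∂((volume.restrict A).prod (volume.restrict A)) := integral_nonneg fun x => mul_self_nonneg _
  constructor
  · positivity
  · exact le_add_of_nonneg_right (by positivity)

lemma ofReal_hsInner_self (hs0 : 0 < s) (hs1 : s < 1) {A : Set (Eucl d)} {u : Eucl d → ℝ}
    (hu : MemHs s A u) : ENNReal.ofReal (hsInner s A u u) = hsEnergy s A u := by
  have h1 := fracConst_pos d hs0 hs1
  have h3 : 0 ≤ ∫ q, hsQuot s u q * hsQuot s u q
    ∂((volume.restrict A).prod (volume.restrict A)) := integral_nonneg fun x => mul_self_nonneg _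
  rw [hsInner_eq hs0 hu hu, ENNReal.ofReal_add (integral_nonneg fun x => mul_self_nonneg _)
    (by positivity), ENNReal.ofReal_mul (by positivity)]
  rw [memHs_iff] at hu
  rw [ofReal_integral_mul_self hu.1, ofReal_integral_mul_self hu.2]
  rfl

lemma memHs_of_hsEnergy_lt_top (hs0 : 0 < s) (hs1 : s < 1) {A : Set (Eucl d)} {u : Eucl d → ℝ}
    (hu : AEStronglyMeasurable u (volume.restrict A)) (h : hsEnergy s A u < ⊤) :
    MemHs s A u := by
  have h1 := fracConst_pos d hs0 hs1
  obtain ⟨h2, h3⟩ := ENNReal.add_lt_top.1 h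
  refine memHs_iff.2 ⟨memLp_two_of_lintegral hu h2,
    memLp_two_of_lintegral (aestronglyMeasurable_hsQuot hu) ?_⟩
  by_contra hcon
  rw [not_lt_top_iff.1 hcon, ENNReal.mul_top (by simpa using h1)] at h3
  exact lt_irrefl _ h3

lemma memHs_of_hsEnergy_le (hs0 : 0 < s) (hs1 : s < 1) {A : Set (Eucl d)} {u : Eucl d → ℝ}
    {C : ℝ} (hC : 0 ≤ C) (hu : AEStronglyMeasurable u (volume.restrict A))
    (h : hsEnergy s A u ≤ ENNReal.ofReal C) : MemHs s A u ∧ hsInner s A u u ≤ C := by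
  have hm := memHs_of_hsEnergy_lt_top hs0 hs1 hu (h.trans_lt ENNReal.ofReal_lt_top)
  refine ⟨hm, ?_⟩
  rw [← ofReal_hsInner_self hs0 hs1 hm] at h
  exact (ENNReal.ofReal_le_ofReal_iff hC).1 h

lemma liminf_add_liminf_le {a b : ℕ → ℝ≥0∞} {C : ℝ≥0∞} (h : ∀ n, a n + b n ≤ C) :
    liminf a atTop + liminf b atTop ≤ C := by
  rw [liminf_eq_iSup_iInf_of_nat, liminf_eq_iSup_iInf_of_nat, ENNReal.iSup_add_iSup_of_monotone]
  · exact iSup_le fun n => (add_le_add (iInf₂_le n le_rfl) (iInf₂_le n le_rfl)).trans (h n)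
  · exact fun n m hnm => biInf_mono fun i hi => hnm.trans hi
  · exact fun n m hnm => biInf_mono fun i hi => hnm.trans hi

/-- A subsequence converges almost everywhere, so its difference quotients converge almost
everywhere for the product measure. Fatou's lemma applies to the two parts of the energy separately,
and the sum of the lower limits is at most `C`. -/
lemma hsInner_fatou (hs0 : 0 < s) (hs1 : s < 1) {A : Set (Eucl d)} {f : ℕ → Eucl d → ℝ}
    {w : Eucl d → ℝ} {C : ℝ} (hf : ∀ n, MemHs s A (f n)) (hC : ∀ n, hsInner s A (f n) (f n) ≤ C)
    (hw : MemLp w 2 (volume.restrict A))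
    (h : Tendsto (fun n => eLpNorm (f n - w) 2 (volume.restrict A)) atTop (𝓝 0)) :
    MemHs s A w ∧ hsInner s A w w ≤ C := by
  have hC0 : 0 ≤ C := (hsInner_self_nonneg hs0 hs1 (hf 0)).1.trans (hC 0)
  refine memHs_of_hsEnergy_le hs0 hs1 hC0 hw.1 ?_
  obtain ⟨k, -, hk⟩ := (tendstoInMeasure_of_tendsto_eLpNorm (by norm_num)
    (fun n => (hf n).1.1) hw.1 h).exists_seq_tendsto_ae
  set ν := volume.restrict A
  have hfst : ∀ᵐ q : Eucl d × Eucl d ∂ν.prod ν, Tendsto (fun n => f (k n) q.1) atTop (𝓝 (w q.1)) :=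
    Measure.quasiMeasurePreserving_fst.ae hk
  have hsnd : ∀ᵐ q : Eucl d × Eucl d ∂ν.prod ν, Tendsto (fun n => f (k n) q.2) atTop (𝓝 (w q.2)) :=
    Measure.quasiMeasurePreserving_snd.ae hk
  have l1 : ∫⁻ x, ‖w x‖ₑ ^ 2 ∂ν ≤ liminf (fun n => ∫⁻ x, ‖f (k n) x‖ₑ ^ 2 ∂ν) atTop := by
    refine le_trans (lintegral_mono_ae ?_)
      (lintegral_liminf_le' fun n => (hf (k n)).1.1.enorm.pow_const 2)
    filter_upwards [hk] with x hx
    exact (((ENNReal.continuous_pow 2).tendsto _).comp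
      ((continuous_enorm.tendsto _).comp hx)).liminf_eq.ge
  have l2 : ∫⁻ q, ‖hsQuot s w q‖ₑ ^ 2 ∂ν.prod ν
      ≤ liminf (fun n => ∫⁻ q, ‖hsQuot s (f (k n)) q‖ₑ ^ 2 ∂ν.prod ν) atTop := by
    refine le_trans (lintegral_mono_ae ?_)
      (lintegral_liminf_le' fun n => (memHs_iff.1 (hf (k n))).2.1.enorm.pow_const 2)
    filter_upwards [hfst, hsnd] with q h1 h2
    exact (((ENNReal.continuous_pow 2).tendsto _).comp
      ((continuous_enorm.tendsto _).comp ((h1.sub h2).div_const _))).liminf_eq.ge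
  have l3 : ENNReal.ofReal (fracConst d s / 2) * ∫⁻ q, ‖hsQuot s w q‖ₑ ^ 2 ∂ν.prod ν
      ≤ liminf (fun n => ENNReal.ofReal (fracConst d s / 2) *
        ∫⁻ q, ‖hsQuot s (f (k n)) q‖ₑ ^ 2 ∂ν.prod ν) atTop := by
    rw [ENNReal.liminf_const_mul_of_ne_top ENNReal.ofReal_ne_top]
    gcongr
  refine (add_le_add l1 l3).trans (liminf_add_liminf_le fun n => ?_)
  change hsEnergy s A (f (k n)) ≤ _
  rw [← ofReal_hsInner_self hs0 hs1 (hf _)]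
  exact ENNReal.ofReal_le_ofReal (hC _)

lemma hsInner_contraction (hs0 : 0 < s) (hs1 : s < 1) {A : Set (Eucl d)} {u : Eucl d → ℝ}
    {δ : ℝ} (hδ : 0 < δ) (hu : MemHs s A u) :
    MemHs s A (fun x => softAbs δ (u x)) ∧
      hsInner s A (fun x => softAbs δ (u x)) (fun x => softAbs δ (u x)) ≤ hsInner s A u u := by
  refine memHs_of_hsEnergy_le hs0 hs1 (hsInner_self_nonneg hs0 hs1 hu).1
    ((continuous_softAbs δ).comp_aestronglyMeasurable hu.1.1) ?_
  rw [ofReal_hsInner_self hs0 hs1 hu]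
  unfold hsEnergy
  gcongr with x q
  · rw [enorm_le_iff_norm_le, Real.norm_of_nonneg (softAbs_nonneg _ _)]
    exact softAbs_le_abs hδ _
  · rw [enorm_le_iff_norm_le]
    simp only [hsQuot, norm_div]
    gcongr
    exact abs_softAbs_sub_le hδ _ _

lemma hsInner_coercive (hs0 : 0 < s) (hs1 : s < 1) {A : Set (Eucl d)} {u : Eucl d → ℝ}
    (hu : MemHs s A u) :
    eLpNorm u 2 (volume.restrict A) ≤ ENNReal.ofReal (1 * √(hsInner s A u u)) := by
  rw [eLpNorm_two_eq_sqrt hu.1, one_mul]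
  exact ENNReal.ofReal_le_ofReal (Real.sqrt_le_sqrt (hsInner_self_nonneg hs0 hs1 hu).2)

lemma MemHs.mono {A B : Set (Eucl d)} (hAB : A ⊆ B) {u : Eucl d → ℝ} (hu : MemHs s B u) :
    MemHs s A u := by
  have h := Measure.restrict_mono hAB (le_refl (volume : Measure (Eucl d)))
  exact ⟨hu.1.mono_measure h, hu.2.mono_measure (Measure.prod_mono h h)⟩

/-! ### Test functions have finite fractional energy -/

/-- The radial majorant of the squared difference quotient of a test function is integrable. -/
lemma integrable_min_sq_div_rpow (hd : 1 ≤ d) (hs0 : 0 < s) (hs1 : s < 1) {L : ℝ}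
    (hL : 0 ≤ L) : Integrable fun h : Eucl d => min (L * ‖h‖) L ^ 2 / ‖h‖ ^ ((d : ℝ) + 2 * s) := by
  have : Nontrivial (Eucl d) := by
    have : Nonempty (Fin d) := ⟨⟨0, hd⟩⟩
    infer_instance
  rw [integrable_fun_norm_addHaar volume
    (f := fun y => min (L * y) L ^ 2 / y ^ ((d : ℝ) + 2 * s))]
  have hfin : Module.finrank ℝ (Eucl d) = d := by simp
  rw [hfin]
  have hm : Measurable fun y : ℝ => y ^ (d - 1) • (min (L * y) L ^ 2 / y ^ ((d : ℝ) + 2 * s)) := by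
    simp only [smul_eq_mul]
    fun_prop
  have hd' : ((d - 1 : ℕ) : ℝ) = (d : ℝ) - 1 := by
    rw [Nat.cast_sub hd, Nat.cast_one]
  have e1 : ∀ y : ℝ, 0 < y → y ^ (d - 1) / y ^ ((d : ℝ) + 2 * s) = y ^ (-1 - 2 * s) := by
    intro y hy
    rw [← Real.rpow_natCast, hd', ← Real.rpow_sub hy]
    congr 1
    ring
  have e2 : ∀ y : ℝ, 0 < y → y ^ (d - 1) * (min (L * y) L ^ 2 / y ^ ((d : ℝ) + 2 * s))
      = min (L * y) L ^ 2 * y ^ (-1 - 2 * s) := by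
    intro y hy
    rw [← e1 y hy]
    ring
  have hmin : ∀ y : ℝ, 0 < y → 0 ≤ min (L * y) L := fun y hy => le_min (by positivity) hL
  -- Near `0` the Lipschitz bound leaves the power `1 - 2s > -1`; at infinity the constant bound
  -- leaves `-1 - 2s < -1`.
  rw [← Ioc_union_Ioi_eq_Ioi (zero_le_one (α := ℝ)), integrableOn_union]
  constructor
  · have hi : IntegrableOn (fun y : ℝ => L ^ 2 * y ^ (1 - 2 * s)) (Ioc 0 1) := by
      have := (intervalIntegral.intervalIntegrable_rpow' (a := 0) (b := 1) (r := 1 - 2 * s)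
        (by linarith)).const_mul (L ^ 2)
      rwa [intervalIntegrable_iff_integrableOn_Ioc_of_le zero_le_one] at this
    refine Integrable.mono' hi hm.aestronglyMeasurable ?_
    filter_upwards [ae_restrict_mem measurableSet_Ioc] with y hy
    have hy0 := hy.1
    rw [Real.norm_of_nonneg (by simp only [smul_eq_mul]; positivity), smul_eq_mul, e2 y hy0]
    have e3 : y ^ (1 - 2 * s) = y ^ 2 * y ^ (-1 - 2 * s) := by
      rw [← Real.rpow_natCast, ← Real.rpow_add hy0]
      congr 1
      push_cast
      ring
    rw [e3, ← mul_assoc, ← mul_pow]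
    gcongr
    exact min_le_left _ _
  · have hi : IntegrableOn (fun y : ℝ => L ^ 2 * y ^ (-1 - 2 * s)) (Ioi 1) :=
      (integrableOn_Ioi_rpow_of_lt (by linarith) one_pos).const_mul (L ^ 2)
    refine Integrable.mono' hi hm.aestronglyMeasurable ?_
    filter_upwards [ae_restrict_mem measurableSet_Ioi] with y hy
    have hy0 : 0 < y := one_pos.trans hy
    rw [Real.norm_of_nonneg (by simp only [smul_eq_mul]; positivity), smul_eq_mul, e2 y hy0]
    gcongr
    exact min_le_right _ _

lemma memHs_univ_of_mem_testFunctions (hd : 1 ≤ d) (hs0 : 0 < s) (hs1 : s < 1)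
    {φ : Eucl d → ℝ} (hφ : φ ∈ testFunctions Ω) : MemHs s univ φ := by
  have hφc := hφ.1.continuous
  obtain ⟨C, hC⟩ := (hφ.1.of_le (by simp)).lipschitzWith_of_hasCompactSupport hφ.2.1 one_ne_zero
  obtain ⟨M, hM⟩ := hφc.bounded_above_of_compact_support hφ.2.1
  have hM0 : 0 ≤ M := (norm_nonneg _).trans (hM 0)
  -- One constant serves for the Lipschitz bound (`C`) and for the oscillation bound (`2M`).
  set L : ℝ := C + 2 * M with hLdef
  have hL : 0 ≤ L := by positivity
  have hdiff : ∀ x y, |φ x - φ y| ≤ min (L * ‖x - y‖) L := by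
    intro x y
    refine le_min ?_ ?_
    · have h1 := hC.dist_le_mul x y
      rw [Real.dist_eq, dist_eq_norm] at h1
      exact h1.trans (by gcongr; linarith)
    · have h1 := abs_sub (φ x) (φ y)
      have h2 := hM x
      have h3 := hM y
      rw [Real.norm_eq_abs] at h2 h3
      have h4 : (0 : ℝ) ≤ C := C.2
      linarith
  set g : Eucl d → ℝ := fun h => min (L * ‖h‖) L ^ 2 / ‖h‖ ^ ((d : ℝ) + 2 * s) with hg
  have hgi : Integrable g := integrable_min_sq_div_rpow hd hs0 hs1 hL
  have hgm : Measurable g := by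
    rw [hg]
    fun_prop
  set S := tsupport φ with hS
  have hSm : MeasurableSet S := (isClosed_tsupport φ).measurableSet
  have hSf : volume S < ⊤ := hφ.2.1.measure_lt_top
  refine memHs_iff.2 ⟨?_, ?_⟩
  · rw [Measure.restrict_univ]
    exact hφc.memLp_of_hasCompactSupport hφ.2.1
  rw [Measure.restrict_univ]
  refine memLp_two_of_lintegral (aestronglyMeasurable_hsQuot hφc.aestronglyMeasurable) ?_
  have hfin : ∫⁻ h, ‖g h‖ₑ < ⊤ := hgi.2
  have i1 : ∫⁻ q : Eucl d × Eucl d, S.indicator 1 q.1 * ‖g (q.1 - q.2)‖ₑ < ⊤ := by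
    rw [Measure.volume_eq_prod, lintegral_prod _ (by fun_prop)]
    have : ∀ x : Eucl d, ∫⁻ y, S.indicator (1 : Eucl d → ℝ≥0∞) x * ‖g (x - y)‖ₑ
        = S.indicator 1 x * ∫⁻ h, ‖g h‖ₑ := by
      intro x
      rw [lintegral_const_mul _ (by fun_prop), lintegral_sub_left_eq_self (fun y => ‖g y‖ₑ) x]
    simp only [this]
    rw [lintegral_mul_const _ (measurable_one.indicator hSm), lintegral_indicator_one hSm]
    exact ENNReal.mul_lt_top hSf hfin
  have i2 : ∫⁻ q : Eucl d × Eucl d, S.indicator 1 q.2 * ‖g (q.1 - q.2)‖ₑ < ⊤ := by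
    rw [Measure.volume_eq_prod, lintegral_prod_symm _ (by fun_prop)]
    have : ∀ y : Eucl d, ∫⁻ x, S.indicator (1 : Eucl d → ℝ≥0∞) y * ‖g (x - y)‖ₑ
        = S.indicator 1 y * ∫⁻ h, ‖g h‖ₑ := by
      intro y
      rw [lintegral_const_mul _ (by fun_prop), lintegral_sub_right_eq_self (fun y => ‖g y‖ₑ) y]
    simp only [this]
    rw [lintegral_mul_const _ (measurable_one.indicator hSm), lintegral_indicator_one hSm]
    exact ENNReal.mul_lt_top hSf hfin
  have hq : ∀ q : Eucl d × Eucl d, ‖hsQuot s φ q‖ₑ ^ 2 ≤ ‖g (q.1 - q.2)‖ₑ := by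
    rintro ⟨x, y⟩
    have h1 : ‖hsQuot s φ (x, y)‖ₑ ^ 2 = ENNReal.ofReal (hsQuot s φ (x, y) * hsQuot s φ (x, y)) := by
      rw [Real.enorm_eq_ofReal_abs, ← ENNReal.ofReal_pow (abs_nonneg _), sq_abs, sq]
    rw [h1, hsQuot_mul_hsQuot hs0, Real.enorm_eq_ofReal_abs]
    refine ENNReal.ofReal_le_ofReal (le_trans ?_ (le_abs_self _))
    simp only [hg]
    gcongr ?_ / _
    rw [← sq, ← sq_abs]
    gcongr
    exact hdiff x y
  -- The quotient vanishes unless one of the two points is in the support of `φ`, which has finite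
  -- measure; integrating the other point against the radial majorant is then enough.
  refine lt_of_le_of_lt (lintegral_mono fun q => ?_)
    ((lintegral_add_left' (by fun_prop) _).trans_lt (ENNReal.add_lt_top.2 ⟨i1, i2⟩))
  by_cases h1 : q.1 ∈ S
  · refine (hq q).trans ?_
    simp [h1]
  by_cases h2 : q.2 ∈ S
  · refine (hq q).trans ?_
    simp [h2]
  · simp [hsQuot, image_eq_zero_of_notMem_tsupport h1, image_eq_zero_of_notMem_tsupport h2]

lemma indicator_eq_of_mem_testFunctions {φ : Eucl d → ℝ} (hφ : φ ∈ testFunctions Ω) :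
    Ω.indicator φ = φ :=
  indicator_eq_self.2 ((subset_tsupport φ).trans hφ.2.2)

/-- The inner product of `H^s(Ω)` is regular. -/
theorem isRegularForm_integral (hd : 1 ≤ d) (hΩ : IsOpen Ω) (hb : Bornology.IsBounded Ω)
    (hs0 : 0 < s) (hs1 : s < 1) : IsRegularForm (.integral : InnerChoice Ω s) where
  isOpen := hΩ
  volume_ne_top := hb.measure_lt_top.ne
  memLp hw := hw.1
  add := memHs_add
  smul c := memHs_smul c
  prod_comm := hsInner_comm Ω
  prod_add := hsInner_add hs0
  prod_smul c := hsInner_smul hs0 c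
  nonneg hu := (hsInner_self_nonneg hs0 hs1 hu).1
  coercive := ⟨1, one_pos, hsInner_coercive hs0 hs1⟩
  fatou := hsInner_fatou hs0 hs1
  test hφ := (memHs_univ_of_mem_testFunctions hd hs0 hs1 hφ).mono (subset_univ _)
  contraction := hsInner_contraction hs0 hs1

/-- The inner product of `H^s(ℝ^d)`, applied to extensions by zero, is regular. -/
theorem isRegularForm_wholeSpace (hd : 1 ≤ d) (hΩ : IsOpen Ω) (hb : Bornology.IsBounded Ω)
    (hs0 : 0 < s) (hs1 : s < 1) (hs : s ≠ 1 / 2) :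
    IsRegularForm (.wholeSpace hs : InnerChoice Ω s) := by
  have hm := hΩ.measurableSet
  have hadd : ∀ u v : Eucl d → ℝ, Ω.indicator (u + v) = Ω.indicator u + Ω.indicator v :=
    fun u v => indicator_add' Ω u v
  have hsmul : ∀ (c : ℝ) (u : Eucl d → ℝ), Ω.indicator (c • u) = c • Ω.indicator u :=
    fun c u => indicator_const_smul Ω c u
  have hnorm : ∀ u : Eucl d → ℝ, eLpNorm (Ω.indicator u) 2 (volume.restrict univ)
      = eLpNorm u 2 (volume.restrict Ω) := fun u => by
    rw [Measure.restrict_univ, eLpNorm_indicator_eq_eLpNorm_restrict hm]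
  -- Extension by zero commutes with the contraction because `softAbs` fixes `0`.
  have hsoft : ∀ {δ : ℝ}, 0 < δ → ∀ u : Eucl d → ℝ,
      Ω.indicator (fun x => softAbs δ (u x)) = fun x => softAbs δ (Ω.indicator u x) := by
    intro δ hδ u
    ext x
    by_cases hx : x ∈ Ω
    · simp [hx]
    · simp [hx, softAbs_zero hδ]
  refine ⟨hΩ, hb.measure_lt_top.ne, ?_, ?_, ?_, fun u v => hsInner_comm _ _ _, ?_, ?_,
    fun hu => (hsInner_self_nonneg hs0 hs1 hu).1, ⟨1, one_pos, ?_⟩, ?_, ?_, ?_⟩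
  · intro w hw
    have := hw.1
    rwa [Measure.restrict_univ, memLp_indicator_iff_restrict hm] at this
  · intro u v hu hv
    have := memHs_add hu hv
    rwa [← hadd] at this
  · intro c u hu
    have := memHs_smul c hu
    rwa [← hsmul] at this
  · intro u v w hu hv hw
    have := hsInner_add hs0 hu hv hw
    rwa [← hadd] at this
  · intro c u v hu hv
    have := hsInner_smul hs0 c hu hv
    rwa [← hsmul] at this
  · intro u hu
    rw [← hnorm]
    exact hsInner_coercive hs0 hs1 hu
  · intro f w C hf hC hw h
    refine hsInner_fatou hs0 hs1 hf hC ?_ ?_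
    · rwa [Measure.restrict_univ, memLp_indicator_iff_restrict hm]
    · have h1 : ∀ n, Ω.indicator (f n) - Ω.indicator w = Ω.indicator (f n - w) :=
        fun n => (indicator_sub' Ω (f n) w).symm
      simp only [h1, hnorm]
      exact h
  · intro φ hφ
    have := memHs_univ_of_mem_testFunctions hd hs0 hs1 hφ
    rwa [← indicator_eq_of_mem_testFunctions hφ] at this
  · intro u δ hδ hu
    have := hsInner_contraction hs0 hs1 hδ hu
    rwa [← hsoft hδ] at this

/-! ### The Dirichlet form on `H_0^1(Ω)` -/

lemma differentiable_of_mem_testFunctions {φ : Eucl d → ℝ} (hφ : φ ∈ testFunctions Ω) :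
    Differentiable ℝ φ := hφ.1.differentiable (by simp)

lemma gradient_add_of_mem {φ ψ : Eucl d → ℝ} (hφ : φ ∈ testFunctions Ω)
    (hψ : ψ ∈ testFunctions Ω) (x : Eucl d) :
    gradient (φ + ψ) x = gradient φ x + gradient ψ x := by
  simp only [gradient]
  rw [fderiv_add (differentiable_of_mem_testFunctions hφ x)
    (differentiable_of_mem_testFunctions hψ x), map_add]

lemma gradient_smul_of_mem {φ : Eucl d → ℝ} (hφ : φ ∈ testFunctions Ω) (c : ℝ) (x : Eucl d) :
    gradient (c • φ) x = c • gradient φ x := by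
  simp only [gradient]
  rw [fderiv_const_smul (differentiable_of_mem_testFunctions hφ x), map_smul]

lemma norm_gradient (φ : Eucl d → ℝ) (x : Eucl d) : ‖gradient φ x‖ = ‖fderiv ℝ φ x‖ := by
  simp [gradient]

lemma continuous_gradient {φ : Eucl d → ℝ} (hφ : φ ∈ testFunctions Ω) :
    Continuous (gradient φ) :=
  (InnerProductSpace.toDual ℝ (Eucl d)).symm.continuous.comp (hφ.1.continuous_fderiv (by simp))

lemma hasCompactSupport_gradient {φ : Eucl d → ℝ} (hφ : φ ∈ testFunctions Ω) :
    HasCompactSupport (gradient φ) :=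
  (hφ.2.1.fderiv ℝ).comp_left (g := (InnerProductSpace.toDual ℝ (Eucl d)).symm) (map_zero _)

lemma memLp_gradient {φ : Eucl d → ℝ} (hφ : φ ∈ testFunctions Ω) :
    MemLp (gradient φ) 2 (volume.restrict Ω) :=
  ((continuous_gradient hφ).memLp_of_hasCompactSupport (hasCompactSupport_gradient hφ)).restrict Ω

lemma memLp_of_mem_testFunctions {φ : Eucl d → ℝ} (hφ : φ ∈ testFunctions Ω) :
    MemLp φ 2 (volume.restrict Ω) :=
  (hφ.1.continuous.memLp_of_hasCompactSupport hφ.2.1).restrict Ω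

lemma lipschitzWith_softAbs {δ : ℝ} (hδ : 0 < δ) : LipschitzWith 1 (softAbs δ) :=
  LipschitzWith.of_dist_le_mul fun a b => by
    simpa [Real.dist_eq] using abs_softAbs_sub_le hδ a b

lemma norm_gradient_softAbs_le {φ : Eucl d → ℝ} (hφ : φ ∈ testFunctions Ω) {δ : ℝ} (hδ : 0 < δ)
    (x : Eucl d) : ‖gradient (fun y => softAbs δ (φ y)) x‖ ≤ ‖gradient φ x‖ := by
  rw [norm_gradient, norm_gradient]
  have h1 : HasDerivAt (softAbs δ) (deriv (softAbs δ) (φ x)) (φ x) :=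
    ((contDiff_softAbs hδ).differentiable (by simp) _).hasDerivAt
  have h2 : HasFDerivAt (fun y => softAbs δ (φ y)) (deriv (softAbs δ) (φ x) • fderiv ℝ φ x) x :=
    h1.comp_hasFDerivAt x (differentiable_of_mem_testFunctions hφ x).hasFDerivAt
  have h3 : ‖deriv (softAbs δ) (φ x)‖ ≤ (1 : ℝ≥0) := norm_deriv_le_of_lipschitz
    (lipschitzWith_softAbs hδ)
  rw [h2.fderiv, norm_smul]
  exact mul_le_of_le_one_left (norm_nonneg _) (by simpa using h3)

/-- The pairs `(ψ, ∇ψ)`, `ψ ∈ C_c^∞(Ω)`, as elements of `L²`. -/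
def gradGraph (Ω : Set (Eucl d)) :
    Submodule ℝ (Lp ℝ 2 (volume.restrict Ω) × Lp (Eucl d) 2 (volume.restrict Ω)) where
  carrier := {q | ∃ ψ ∈ testFunctions Ω, q.1 =ᵐ[volume.restrict Ω] ψ ∧
    q.2 =ᵐ[volume.restrict Ω] gradient ψ}
  add_mem' := by
    rintro q r ⟨φ, hφ, h1, h2⟩ ⟨ψ, hψ, h3, h4⟩
    refine ⟨φ + ψ, add_mem_testFunctions hφ hψ, ?_, ?_⟩
    · filter_upwards [Lp.coeFn_add q.1 r.1, h1, h3] with x h5 h6 h7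
      rw [Prod.fst_add, h5, Pi.add_apply, h6, h7, Pi.add_apply]
    · filter_upwards [Lp.coeFn_add q.2 r.2, h2, h4] with x h5 h6 h7
      rw [Prod.snd_add, h5, Pi.add_apply, h6, h7, gradient_add_of_mem hφ hψ]
  zero_mem' := by
    refine ⟨0, zero_mem_testFunctions, Lp.coeFn_zero _ _ _, ?_⟩
    filter_upwards [Lp.coeFn_zero (Eucl d) 2 (volume.restrict Ω)] with x hx
    rw [Prod.snd_zero, hx]
    simp [gradient]
  smul_mem' := by
    rintro c q ⟨φ, hφ, h1, h2⟩
    refine ⟨c • φ, smul_mem_testFunctions hφ c, ?_, ?_⟩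
    · filter_upwards [Lp.coeFn_smul c q.1, h1] with x h5 h6
      rw [Prod.smul_fst, h5, Pi.smul_apply, h6, Pi.smul_apply]
    · filter_upwards [Lp.coeFn_smul c q.2, h2] with x h5 h6
      rw [Prod.smul_snd, h5, Pi.smul_apply, h6, gradient_smul_of_mem hφ]

lemma norm_sq_sub_eq {E : Type*} [NormedAddCommGroup E] [InnerProductSpace ℝ E]
    {α : Type*} [MeasurableSpace α] {μ : Measure α} {f g : Lp E 2 μ} {F G : α → E}
    (hf : f =ᵐ[μ] F) (hg : g =ᵐ[μ] G) : ‖f - g‖ ^ 2 = ∫ x, ‖F x - G x‖ ^ 2 ∂μ := by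
  rw [← real_inner_self_eq_norm_sq, L2.inner_def]
  refine integral_congr_ae ?_
  filter_upwards [Lp.coeFn_sub f g, hf, hg] with x h1 h2 h3
  rw [h1, Pi.sub_apply, h2, h3, real_inner_self_eq_norm_sq]

/-- The weak gradient of an eigenfunction. -/
lemma IsDirichletEigen.exists_gradient {w : Lp ℝ 2 (volume.restrict Ω)} {lam : ℝ}
    (hw : IsDirichletEigen Ω w lam) : ∃ g : Lp (Eucl d) 2 (volume.restrict Ω),
      (w, g) ∈ (gradGraph Ω).topologicalClosure ∧
      ∀ q ∈ (gradGraph Ω).topologicalClosure, inner ℝ g q.2 = lam * inner ℝ w q.1 := by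
  obtain ⟨G, ⟨h1, h2, h3⟩, h4⟩ := hw
  have hG := h2.coeFn_toLp
  refine ⟨h2.toLp G, ?_, ?_⟩
  · rw [← SetLike.mem_coe, Submodule.topologicalClosure_coe, Metric.mem_closure_iff]
    intro ε hε
    obtain ⟨ψ, hψ, hlt⟩ := h3 (ε ^ 2) (by positivity)
    have m1 := memLp_of_mem_testFunctions hψ
    have m2 := memLp_gradient hψ
    refine ⟨(m1.toLp ψ, m2.toLp _), ⟨ψ, hψ, m1.coeFn_toLp, m2.coeFn_toLp⟩, ?_⟩
    have e1 := norm_sq_sub_eq (EventuallyEq.refl (ae (volume.restrict Ω)) w) m1.coeFn_toLp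
    have e2 := norm_sq_sub_eq hG m2.coeFn_toLp
    simp only [Real.norm_eq_abs, sq_abs] at e1
    rw [← e1, ← e2] at hlt
    rw [Prod.dist_eq, max_lt_iff, dist_eq_norm, dist_eq_norm]
    exact ⟨lt_of_pow_lt_pow_left₀ 2 hε.le (by nlinarith [sq_nonneg ‖h2.toLp G - m2.toLp _‖]),
      lt_of_pow_lt_pow_left₀ 2 hε.le (by nlinarith [sq_nonneg ‖w - m1.toLp _‖])⟩
  · intro q hq
    -- The eigenvalue equation, known for test functions, is a closed condition on pairs and so
    -- extends to the closure of the graph, that is to `H_0^1(Ω)`.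
    have hc : IsClosed {q : Lp ℝ 2 (volume.restrict Ω) × Lp (Eucl d) 2 (volume.restrict Ω) |
        inner ℝ (h2.toLp G) q.2 = lam * inner ℝ w q.1} :=
      isClosed_eq (by fun_prop) (by fun_prop)
    refine closure_minimal ?_ hc hq
    rintro ⟨u, a⟩ ⟨ψ, hψ, e1, e2⟩
    have := h4 ψ hψ
    simp only [mem_ofPred_eq, L2.inner_def]
    rw [integral_congr_ae (g := fun x => inner ℝ (G x) (gradient ψ x)) (by
        filter_upwards [hG, e2] with x h5 h6
        rw [h5, h6]), this,
      integral_congr_ae (f := fun x => inner ℝ (w x) (u x)) (g := fun x => w x * ψ x) (by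
        filter_upwards [e1] with x h5
        rw [h5, real_inner_eq_re_inner, RCLike.inner_apply]
        simp [mul_comm])]

/-! ### Poincaré's inequality -/

lemma gradient_eq_zero_of_notMem {φ : Eucl d → ℝ} (hφ : φ ∈ testFunctions Ω) {x : Eucl d}
    (hx : x ∉ Ω) : gradient φ x = 0 := by
  have : fderiv ℝ φ x = 0 :=
    image_eq_zero_of_notMem_tsupport fun h => hx (hφ.2.2 (tsupport_fderiv_subset ℝ h))
  simp [gradient, this]

lemma eq_zero_of_notMem {φ : Eucl d → ℝ} (hφ : φ ∈ testFunctions Ω) {x : Eucl d} (hx : x ∉ Ω) :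
    φ x = 0 :=
  image_eq_zero_of_notMem_tsupport fun h => hx (hφ.2.2 h)

/-- Integration by parts against a coordinate. -/
lemma integral_sq_eq_of_mem_testFunctions (i : Fin d) {φ : Eucl d → ℝ}
    (hφ : φ ∈ testFunctions Ω) :
    Integrable (fun x => -(2 * φ x * fderiv ℝ φ x (EuclideanSpace.single i 1) * x i)) ∧
      ∫ x, φ x ^ 2 = ∫ x, -(2 * φ x * fderiv ℝ φ x (EuclideanSpace.single i 1) * x i) := by
  obtain ⟨v, hv⟩ : ∃ v : Eucl d, v = EuclideanSpace.single i 1 := ⟨_, rfl⟩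
  rw [← hv]
  have hc := hφ.1.continuous
  have hdiff := differentiable_of_mem_testFunctions hφ
  have hg : ∀ x : Eucl d, HasFDerivAt (fun x : Eucl d => x i)
      (EuclideanSpace.proj i : Eucl d →L[ℝ] ℝ) x :=
    fun x => (EuclideanSpace.proj i : Eucl d →L[ℝ] ℝ).hasFDerivAt
  have hg' : ∀ x : Eucl d, fderiv ℝ (fun x : Eucl d => x i) x v = 1 := by
    intro x
    rw [(hg x).fderiv]
    simp [hv]
  have hf' : ∀ x, fderiv ℝ (fun x => φ x ^ 2) x v = 2 * φ x * fderiv ℝ φ x v := by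
    intro x
    rw [((hdiff x).hasFDerivAt.pow 2).fderiv]
    simp [mul_assoc]
  have hcd : Continuous fun x => fderiv ℝ φ x v :=
    (hφ.1.continuous_fderiv (by simp)).clm_apply continuous_const
  have hci : Continuous fun x : Eucl d => x i := by fun_prop
  have i1 : Integrable fun x => φ x ^ 2 :=
    (hc.pow 2).integrable_of_hasCompactSupport (hφ.2.1.mono fun x hx h0 => hx (by simp [h0]))
  have i2 : Integrable fun x => 2 * φ x * fderiv ℝ φ x v * x i :=
    (((continuous_const.mul hc).mul hcd).mul hci).integrable_of_hasCompactSupport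
      (hφ.2.1.mono fun x hx h0 => hx (by simp [h0]))
  have i3 : Integrable fun x => φ x ^ 2 * x i :=
    ((hc.pow 2).mul hci).integrable_of_hasCompactSupport
      (hφ.2.1.mono fun x hx h0 => hx (by simp [h0]))
  refine ⟨i2.neg, ?_⟩
  have ibp := integral_mul_fderiv_eq_neg_fderiv_mul_of_integrable (μ := volume)
    (f := fun x => φ x ^ 2) (g := fun x : Eucl d => x i) (v := v)
    (by simpa only [hf'] using i2) (by simpa only [hg', mul_one] using i1) i3
    (fun x _ => (hdiff x).pow 2) (fun x _ => (hg x).differentiableAt)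
  simp only [hg', mul_one, hf'] at ibp
  rw [ibp, integral_neg]

/-- Poincaré's inequality for test functions. -/
lemma integral_sq_le_of_mem_testFunctions (hd : 1 ≤ d) {R : ℝ} (hR : ∀ x ∈ Ω, ‖x‖ ≤ R)
    {φ : Eucl d → ℝ} (hφ : φ ∈ testFunctions Ω) :
    ∫ x in Ω, φ x ^ 2 ≤ 4 * R ^ 2 * ∫ x in Ω, ‖gradient φ x‖ ^ 2 := by
  obtain ⟨i⟩ : Nonempty (Fin d) := ⟨⟨0, hd⟩⟩
  obtain ⟨i2, ibp⟩ := integral_sq_eq_of_mem_testFunctions i hφ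
  have hv1 : ‖(EuclideanSpace.single i 1 : Eucl d)‖ = 1 := by simp
  obtain ⟨v, hv⟩ : ∃ v : Eucl d, v = EuclideanSpace.single i 1 := ⟨_, rfl⟩
  rw [← hv] at i2 ibp hv1
  have i1 : Integrable fun x => φ x ^ 2 :=
    (hφ.1.continuous.pow 2).integrable_of_hasCompactSupport
      (hφ.2.1.mono fun x hx h0 => hx (by simp [h0]))
  have i4 : Integrable fun x => ‖gradient φ x‖ ^ 2 :=
    ((continuous_gradient hφ).norm.pow 2).integrable_of_hasCompactSupport
      ((hasCompactSupport_gradient hφ).mono fun x hx h0 => hx (by simp [h0]))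
  -- Young's inequality with weight `1/2`, so that half of `∫ φ²` can be absorbed; this yields the
  -- constant `4R²`.
  have hpt : ∀ x, -(2 * φ x * fderiv ℝ φ x v * x i)
      ≤ φ x ^ 2 / 2 + 2 * R ^ 2 * ‖gradient φ x‖ ^ 2 := by
    intro x
    by_cases hx : x ∈ Ω
    · have h1 : |fderiv ℝ φ x v| ≤ ‖gradient φ x‖ := by
        rw [norm_gradient]
        have := (fderiv ℝ φ x).le_opNorm v
        rwa [hv1, mul_one] at this
      have h2 : |x i| ≤ R := (PiLp.norm_apply_le x i).trans (hR x hx)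
      have h3 : |fderiv ℝ φ x v * x i| ≤ R * ‖gradient φ x‖ := by
        rw [abs_mul, mul_comm]
        exact mul_le_mul h2 h1 (abs_nonneg _) ((abs_nonneg _).trans h2)
      have h4 := sq_le_sq' (abs_le.1 h3).1 (abs_le.1 h3).2
      nlinarith [sq_nonneg (φ x + 2 * (fderiv ℝ φ x v * x i))]
    · rw [eq_zero_of_notMem hφ hx]
      simp only [mul_zero, zero_mul, neg_zero]
      positivity
  have hle := integral_mono i2 ((i1.div_const 2).add (i4.const_mul (2 * R ^ 2))) hpt
  rw [integral_add' (i1.div_const 2) (i4.const_mul (2 * R ^ 2)), integral_div,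
    integral_const_mul] at hle
  rw [setIntegral_eq_integral_of_forall_compl_eq_zero fun x hx => by
      rw [eq_zero_of_notMem hφ hx]; simp,
    setIntegral_eq_integral_of_forall_compl_eq_zero fun x hx => by
      rw [gradient_eq_zero_of_notMem hφ hx]; simp]
  have hle' : ∫ x, φ x ^ 2 ≤ (∫ x, φ x ^ 2) / 2 + 2 * R ^ 2 * ∫ x, ‖gradient φ x‖ ^ 2 :=
    ibp.le.trans hle
  linarith

/-- Poincaré's inequality. -/
lemma exists_poincare (hd : 1 ≤ d) (hb : Bornology.IsBounded Ω) : ∃ C : ℝ, 0 < C ∧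
    ∀ q ∈ (gradGraph Ω).topologicalClosure, ‖q.1‖ ≤ C * ‖q.2‖ := by
  obtain ⟨R, hR0, hR⟩ := hb.exists_pos_norm_le
  refine ⟨2 * R, by positivity, fun q hq => ?_⟩
  have hc : IsClosed {q : Lp ℝ 2 (volume.restrict Ω) × Lp (Eucl d) 2 (volume.restrict Ω) |
      ‖q.1‖ ≤ 2 * R * ‖q.2‖} := isClosed_le (by fun_prop) (by fun_prop)
  refine closure_minimal ?_ hc hq
  rintro ⟨u, a⟩ ⟨ψ, hψ, e1, e2⟩
  have h1 := norm_sq_sub_eq e1 (Lp.coeFn_zero ℝ 2 (volume.restrict Ω))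
  have h2 := norm_sq_sub_eq e2 (Lp.coeFn_zero (Eucl d) 2 (volume.restrict Ω))
  simp only [sub_zero, Pi.zero_apply, Real.norm_eq_abs, sq_abs] at h1 h2
  have h3 := integral_sq_le_of_mem_testFunctions hd hR hψ
  rw [← h1, ← h2] at h3
  refine (abs_le_of_sq_le_sq' (?_ : ‖u‖ ^ 2 ≤ (2 * R * ‖a‖) ^ 2) (by positivity)).2
  rw [mul_pow, mul_pow]
  norm_num
  exact h3

/-! ### Contractions and the eigenfunction expansion -/

/-- Composition with `softAbs δ`, as a map of `L²`. -/
def softAbsLp {δ : ℝ} (hδ : 0 < δ) (u : Lp ℝ 2 (volume.restrict Ω)) :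
    Lp ℝ 2 (volume.restrict Ω) :=
  (lipschitzWith_softAbs hδ).compLp (softAbs_zero hδ) u

lemma coeFn_softAbsLp {δ : ℝ} (hδ : 0 < δ) (u : Lp ℝ 2 (volume.restrict Ω)) :
    softAbsLp hδ u =ᵐ[volume.restrict Ω] fun x => softAbs δ (u x) :=
  LipschitzWith.coeFn_compLp _ _ u

lemma norm_softAbsLp_sub_le {δ : ℝ} (hδ : 0 < δ) (u v : Lp ℝ 2 (volume.restrict Ω)) :
    ‖softAbsLp hδ u - softAbsLp hδ v‖ ≤ ‖u - v‖ := by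
  have := (lipschitzWith_softAbs hδ).norm_compLp_sub_le (softAbs_zero hδ) u v
  rwa [NNReal.coe_one, one_mul] at this

lemma continuous_softAbsLp {δ : ℝ} (hδ : 0 < δ) :
    Continuous (softAbsLp hδ : Lp ℝ 2 (volume.restrict Ω) → _) :=
  (lipschitzWith_softAbs hδ).continuous_compLp (softAbs_zero hδ)

/-- By the chain rule with derivative at most `1` in modulus. This is needed on the graph only: the
passage to its closure is made for the resulting inequalities, using that `softAbsLp` is continuous
on `L²`. -/
lemma exists_softAbsLp_mem_gradGraph {δ : ℝ} (hδ : 0 < δ)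
    {q : Lp ℝ 2 (volume.restrict Ω) × Lp (Eucl d) 2 (volume.restrict Ω)}
    (hq : q ∈ gradGraph Ω) : ∃ a, (softAbsLp hδ q.1, a) ∈ gradGraph Ω ∧ ‖a‖ ≤ ‖q.2‖ := by
  obtain ⟨ψ, hψ, e1, e2⟩ := hq
  have ht := comp_mem_testFunctions hψ (contDiff_softAbs hδ) (softAbs_zero hδ)
  have hm := memLp_gradient ht
  refine ⟨hm.toLp _, ⟨_, ht, ?_, hm.coeFn_toLp⟩, ?_⟩
  · filter_upwards [coeFn_softAbsLp hδ q.1, e1] with x h1 h2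
    rw [h1, h2]
  · refine Lp.norm_le_norm_of_ae_le ?_
    filter_upwards [hm.coeFn_toLp, e2] with x h1 h2
    rw [h1, h2]
    exact norm_gradient_softAbs_le hψ hδ x

/-- An orthonormal basis of eigenfunctions together with the weak gradients. -/
structure IsEigenSystem (e : ℕ → Lp ℝ 2 (volume.restrict Ω)) (lam : ℕ → ℝ)
    (g : ℕ → Lp (Eucl d) 2 (volume.restrict Ω)) : Prop where
  orthonormal : Orthonormal ℝ e
  mem : ∀ n, (e n, g n) ∈ (gradGraph Ω).topologicalClosure
  inner_eq : ∀ n, ∀ q ∈ (gradGraph Ω).topologicalClosure,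
    inner ℝ (g n) q.2 = lam n * inner ℝ (e n) q.1

/-! ### Finite eigenfunction expansions -/

namespace IsEigenSystem

variable {e : ℕ → Lp ℝ 2 (volume.restrict Ω)} {lam : ℕ → ℝ}
  {g : ℕ → Lp (Eucl d) 2 (volume.restrict Ω)}

lemma lam_eq (h : IsEigenSystem e lam g) (n : ℕ) : lam n = ‖g n‖ ^ 2 := by
  have := h.inner_eq n _ (h.mem n)
  rw [real_inner_self_eq_norm_sq, real_inner_self_eq_norm_sq, h.orthonormal.1 n] at this
  linarith

/-- The eigenvalues are bounded away from zero. -/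
lemma exists_le_lam (h : IsEigenSystem e lam g) (hd : 1 ≤ d) (hb : Bornology.IsBounded Ω) :
    ∃ c : ℝ, 0 < c ∧ ∀ n, c ≤ lam n := by
  obtain ⟨C, hC, hP⟩ := exists_poincare hd hb
  refine ⟨1 / C ^ 2, by positivity, fun n => ?_⟩
  have h1 := hP _ (h.mem n)
  simp only [h.orthonormal.1 n] at h1
  rw [h.lam_eq, div_le_iff₀ (by positivity), mul_comm, ← mul_pow]
  exact one_le_pow₀ h1

lemma inner_sum_eq (h : IsEigenSystem e lam g) (F : Finset ℕ) (c : ℕ → ℝ)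
    {q : Lp ℝ 2 (volume.restrict Ω) × Lp (Eucl d) 2 (volume.restrict Ω)}
    (hq : q ∈ (gradGraph Ω).topologicalClosure) :
    inner ℝ (∑ n ∈ F, c n • g n) q.2 = ∑ n ∈ F, lam n * c n * inner ℝ (e n) q.1 := by
  rw [sum_inner]
  refine Finset.sum_congr rfl fun n _ => ?_
  rw [real_inner_smul_left, h.inner_eq n q hq]
  ring

lemma sum_mem (h : IsEigenSystem e lam g) (F : Finset ℕ) (c : ℕ → ℝ) :
    (∑ n ∈ F, c n • e n, ∑ n ∈ F, c n • g n) ∈ (gradGraph Ω).topologicalClosure := by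
  have := Submodule.sum_mem (gradGraph Ω).topologicalClosure
    (fun n (_ : n ∈ F) => Submodule.smul_mem _ (c n) (h.mem n))
  convert this using 1
  ext1
  · simp [Prod.fst_sum]
  · simp [Prod.snd_sum]

lemma inner_sum_basis (h : IsEigenSystem e lam g) (F : Finset ℕ) (c : ℕ → ℝ) {n : ℕ}
    (hn : n ∈ F) : inner ℝ (e n) (∑ m ∈ F, c m • e m) = c n :=
  h.orthonormal.inner_right_sum c hn

lemma norm_sum_sq (h : IsEigenSystem e lam g) (F : Finset ℕ) (c : ℕ → ℝ) :
    ‖∑ n ∈ F, c n • e n‖ ^ 2 = ∑ n ∈ F, c n ^ 2 := by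
  rw [← real_inner_self_eq_norm_sq, h.orthonormal.inner_sum]
  simp [sq]

lemma norm_sum_gradient_sq (h : IsEigenSystem e lam g) (F : Finset ℕ) (c : ℕ → ℝ) :
    ‖∑ n ∈ F, c n • g n‖ ^ 2 = ∑ n ∈ F, lam n * c n ^ 2 := by
  rw [← real_inner_self_eq_norm_sq, h.inner_sum_eq F c (h.sum_mem F c)]
  refine Finset.sum_congr rfl fun n hn => ?_
  rw [h.inner_sum_basis F c hn]
  ring

/-- Bessel's inequality for the Dirichlet form. -/
lemma sum_lam_mul_sq_le (h : IsEigenSystem e lam g) (F : Finset ℕ)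
    {q : Lp ℝ 2 (volume.restrict Ω) × Lp (Eucl d) 2 (volume.restrict Ω)}
    (hq : q ∈ (gradGraph Ω).topologicalClosure) :
    ∑ n ∈ F, lam n * inner ℝ (e n) q.1 ^ 2 ≤ ‖q.2‖ ^ 2 := by
  -- The gradients `g n` are orthogonal with squared norms `lam n`, and their products with `q.2`
  -- are read off from `q.1`, so expanding the square is Bessel's argument.
  have h1 := sq_nonneg ‖(∑ n ∈ F, (inner ℝ (e n) q.1 : ℝ) • g n) - q.2‖
  rw [norm_sub_sq_real, h.norm_sum_gradient_sq, h.inner_sum_eq F _ hq] at h1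
  have h2 : ∑ n ∈ F, lam n * inner ℝ (e n) q.1 * inner ℝ (e n) q.1
      = ∑ n ∈ F, lam n * inner ℝ (e n) q.1 ^ 2 :=
    Finset.sum_congr rfl fun n _ => by ring
  rw [h2] at h1
  linarith

/-- Contractions operate on the Dirichlet form. -/
lemma sum_lam_mul_softAbs_sq_le (h : IsEigenSystem e lam g) {δ : ℝ} (hδ : 0 < δ) (F : Finset ℕ)
    {q : Lp ℝ 2 (volume.restrict Ω) × Lp (Eucl d) 2 (volume.restrict Ω)}
    (hq : q ∈ (gradGraph Ω).topologicalClosure) :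
    ∑ n ∈ F, lam n * inner ℝ (e n) (softAbsLp hδ q.1) ^ 2 ≤ ‖q.2‖ ^ 2 := by
  have hJ := continuous_softAbsLp (Ω := Ω) hδ
  have hc : IsClosed {q : Lp ℝ 2 (volume.restrict Ω) × Lp (Eucl d) 2 (volume.restrict Ω) |
      ∑ n ∈ F, lam n * inner ℝ (e n) (softAbsLp hδ q.1) ^ 2 ≤ ‖q.2‖ ^ 2} :=
    isClosed_le (by fun_prop) (by fun_prop)
  refine closure_minimal (fun q hq => ?_) hc hq
  obtain ⟨a, ha, hle⟩ := exists_softAbsLp_mem_gradGraph hδ hq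
  refine (h.sum_lam_mul_sq_le F (Submodule.le_topologicalClosure _ ha)).trans ?_
  gcongr

/-- The `K`-functional of the couple of `L²` and `H_0^1` decreases under contractions. -/
lemma sum_kFunctional_softAbs_le (h : IsEigenSystem e lam g) (hlam : ∀ n, 0 < lam n) {δ : ℝ}
    (hδ : 0 < δ) (F F' : Finset ℕ) (c : ℕ → ℝ) {t : ℝ} (ht : 0 < t) :
    ∑ n ∈ F', lam n / (t + lam n) * inner ℝ (e n) (softAbsLp hδ (∑ m ∈ F, c m • e m)) ^ 2
      ≤ ∑ n ∈ F, lam n / (t + lam n) * c n ^ 2 := by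
  obtain ⟨u, hu⟩ : ∃ u, u = ∑ m ∈ F, c m • e m := ⟨_, rfl⟩
  -- The coefficient `b n` minimises `λ y² + t (c n - y)²` over `y` for `λ = lam n`, with minimum `t
  -- λ / (t + λ) * c n ^ 2`. So `v` is the optimal competitor for `u`, and `softAbsLp hδ v` is used
  -- as a competitor, not necessarily optimal, for `softAbsLp hδ u`.
  obtain ⟨b, hb⟩ : ∃ b : ℕ → ℝ, b = fun n => t / (t + lam n) * c n := ⟨_, rfl⟩
  obtain ⟨v, hv⟩ : ∃ v, v = ∑ m ∈ F, b m • e m := ⟨_, rfl⟩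
  rw [← hu]
  have hpt : ∀ l : ℝ, 0 < l → ∀ x y : ℝ,
      t * (l / (t + l) * x ^ 2) ≤ l * y ^ 2 + t * (x - y) ^ 2 := by
    intro l hl x y
    have h0 : 0 < t + l := by positivity
    have : l * y ^ 2 + t * (x - y) ^ 2 - t * (l / (t + l) * x ^ 2)
        = ((t + l) * y - t * x) ^ 2 / (t + l) := by
      field_simp
      ring
    have h1 : 0 ≤ ((t + l) * y - t * x) ^ 2 / (t + l) := by positivity
    linarith
  have hsub : ∀ n, (inner ℝ (e n) (softAbsLp hδ u) : ℝ) - inner ℝ (e n) (softAbsLp hδ v)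
      = inner ℝ (e n) (softAbsLp hδ u - softAbsLp hδ v) := fun n => (inner_sub_right _ _ _).symm
  have h1 : ∑ n ∈ F', lam n * inner ℝ (e n) (softAbsLp hδ v) ^ 2 ≤ ∑ n ∈ F, lam n * b n ^ 2 := by
    have h0 := h.sum_lam_mul_softAbs_sq_le hδ F' (h.sum_mem F b)
    dsimp only at h0
    rwa [h.norm_sum_gradient_sq, ← hv] at h0
  have h2 : ∑ n ∈ F', (inner ℝ (e n) (softAbsLp hδ u - softAbsLp hδ v) : ℝ) ^ 2
      ≤ ∑ n ∈ F, (c n - b n) ^ 2 := by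
    have h3 := h.orthonormal.sum_inner_products_le (s := F') (softAbsLp hδ u - softAbsLp hδ v)
    simp only [Real.norm_eq_abs, sq_abs] at h3
    refine h3.trans ?_
    rw [← h.norm_sum_sq F fun n => c n - b n]
    have h4 : ∑ n ∈ F, (c n - b n) • e n = u - v := by
      rw [hu, hv, ← Finset.sum_sub_distrib]
      simp only [sub_smul]
    rw [h4]
    gcongr
    exact norm_softAbsLp_sub_le hδ u v
  refine le_of_mul_le_mul_left ?_ ht
  rw [Finset.mul_sum, Finset.mul_sum]
  calc ∑ n ∈ F', t * (lam n / (t + lam n) * inner ℝ (e n) (softAbsLp hδ u) ^ 2)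
      ≤ ∑ n ∈ F', (lam n * inner ℝ (e n) (softAbsLp hδ v) ^ 2
        + t * (inner ℝ (e n) (softAbsLp hδ u - softAbsLp hδ v) : ℝ) ^ 2) := by
        refine Finset.sum_le_sum fun n _ => ?_
        rw [← hsub]
        exact hpt _ (hlam n) _ _
    _ ≤ ∑ n ∈ F, lam n * b n ^ 2 + t * ∑ n ∈ F, (c n - b n) ^ 2 := by
        rw [Finset.sum_add_distrib, ← Finset.mul_sum]
        gcongr
    _ = ∑ n ∈ F, t * (lam n / (t + lam n) * c n ^ 2) := by
        rw [Finset.mul_sum, ← Finset.sum_add_distrib]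
        refine Finset.sum_congr rfl fun n _ => ?_
        have h0 : t + lam n ≠ 0 := (add_pos ht (hlam n)).ne'
        simp only [hb]
        field_simp
        ring

/-- Contractions operate on the spectral form, for finite expansions. -/
lemma sum_rpow_softAbs_le (h : IsEigenSystem e lam g) (hlam : ∀ n, 0 < lam n) (hs0 : 0 < s)
    (hs1 : s < 1) {δ : ℝ} (hδ : 0 < δ) (F F' : Finset ℕ) (c : ℕ → ℝ) :
    ∑ n ∈ F', lam n ^ s * inner ℝ (e n) (softAbsLp hδ (∑ m ∈ F, c m • e m)) ^ 2
      ≤ ∑ n ∈ F, lam n ^ s * c n ^ 2 := by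
  have hs : s ∈ Ioo (0 : ℝ) 1 := ⟨hs0, hs1⟩
  -- `κ` normalises the representation of `λ ^ s` as an integral of `t ^ (s - 1) λ / (t + λ)` over
  -- `t > 0`; the inequality is then the integral over `t` of the one for the `K`-functional.
  set κ := (∫ t in Ioi 0, Real.rpowIntegrand₀₁ s t 1)⁻¹ with hκ
  have hκ0 : 0 < κ := inv_pos.2 (Real.integral_rpowIntegrand₀₁_one_pos hs)
  have hrep : ∀ (G : Finset ℕ) (a : ℕ → ℝ), ∑ n ∈ G, lam n ^ s * a n ^ 2
      = κ * ∫ t in Ioi 0, ∑ n ∈ G, Real.rpowIntegrand₀₁ s t (lam n) * a n ^ 2 := by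
    intro G a
    rw [integral_finsetSum _ fun n _ =>
      (Real.integrableOn_rpowIntegrand₀₁_Ioi hs (hlam n).le).mul_const _, Finset.mul_sum]
    refine Finset.sum_congr rfl fun n _ => ?_
    rw [integral_mul_const, ← mul_assoc, ← Real.rpow_eq_const_mul_integral hs (hlam n).le]
  have hint : ∀ (G : Finset ℕ) (a : ℕ → ℝ), IntegrableOn
      (fun t => ∑ n ∈ G, Real.rpowIntegrand₀₁ s t (lam n) * a n ^ 2) (Ioi 0) :=
    fun G a => integrable_finsetSum _ fun n _ =>
      (Real.integrableOn_rpowIntegrand₀₁_Ioi hs (hlam n).le).mul_const _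
  rw [hrep F', hrep F]
  refine mul_le_mul_of_nonneg_left ?_ hκ0.le
  refine setIntegral_mono_on (hint _ _) (hint _ _) measurableSet_Ioi fun t ht => ?_
  have ht0 : 0 < t := ht
  have hfac : ∀ (G : Finset ℕ) (a : ℕ → ℝ),
      ∑ n ∈ G, Real.rpowIntegrand₀₁ s t (lam n) * a n ^ 2
        = t ^ (s - 1) * ∑ n ∈ G, lam n / (t + lam n) * a n ^ 2 := by
    intro G a
    rw [Finset.mul_sum]
    refine Finset.sum_congr rfl fun n _ => ?_
    rw [Real.rpowIntegrand₀₁_eq_pow_div hs ht0.le (hlam n).le]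
    ring
  rw [hfac, hfac]
  exact mul_le_mul_of_nonneg_left (h.sum_kFunctional_softAbs_le hlam hδ F F' c ht0)
    (by positivity)

end IsEigenSystem

/-! ### The spectral form -/

lemma integral_mul_eq_inner {w : Eucl d → ℝ} (hw : MemLp w 2 (volume.restrict Ω))
    (f : Lp ℝ 2 (volume.restrict Ω)) : ∫ x in Ω, w x * f x = inner ℝ f (hw.toLp w) := by
  rw [L2.inner_def]
  refine integral_congr_ae ?_
  filter_upwards [hw.coeFn_toLp] with x hx
  rw [hx, RCLike.inner_apply]
  simp

lemma summable_and_tsum_le {f : ℕ → ℝ} {C : ℝ} (h0 : ∀ n, 0 ≤ f n)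
    (h : ∀ F : Finset ℕ, ∑ n ∈ F, f n ≤ C) : Summable f ∧ ∑' n, f n ≤ C := by
  have hs := summable_of_sum_le h0 h
  exact ⟨hs, hs.tsum_le_of_sum_le h⟩

lemma summable_mul_of_summable_sq {l a b : ℕ → ℝ} (hl : ∀ n, 0 ≤ l n)
    (ha : Summable fun n => l n * a n ^ 2) (hb : Summable fun n => l n * b n ^ 2) :
    Summable fun n => l n * a n * b n := by
  refine Summable.of_norm_bounded (ha.add hb) fun n => ?_
  rw [mul_assoc, norm_mul, Real.norm_of_nonneg (hl n), ← mul_add]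
  refine mul_le_mul_of_nonneg_left ?_ (hl n)
  rw [Real.norm_eq_abs, abs_le]
  constructor <;> nlinarith [sq_nonneg (a n + b n), sq_nonneg (a n - b n), sq_nonneg (a n),
    sq_nonneg (b n)]

lemma exists_isEigenSystem (e : HilbertBasis ℕ ℝ (Lp ℝ 2 (volume.restrict Ω))) (lam : ℕ → ℝ)
    (he : ∀ n, IsDirichletEigen Ω (e n) (lam n)) :
    ∃ g, IsEigenSystem (fun n => e n) lam g := by
  choose g h1 h2 using fun n => (he n).exists_gradient
  exact ⟨g, e.orthonormal, h1, h2⟩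

lemma memLp_softAbs {u : Eucl d → ℝ} (hu : MemLp u 2 (volume.restrict Ω)) {δ : ℝ} (hδ : 0 < δ) :
    MemLp (fun x => softAbs δ (u x)) 2 (volume.restrict Ω) :=
  hu.of_le ((continuous_softAbs δ).comp_aestronglyMeasurable hu.1) (Eventually.of_forall fun x => by
    rw [Real.norm_of_nonneg (softAbs_nonneg _ _)]
    exact softAbs_le_abs hδ _)

lemma softAbsLp_toLp {u : Eucl d → ℝ} (hu : MemLp u 2 (volume.restrict Ω)) {δ : ℝ} (hδ : 0 < δ) :
    softAbsLp hδ (hu.toLp u) = (memLp_softAbs hu hδ).toLp _ := by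
  refine Lp.ext ?_
  filter_upwards [coeFn_softAbsLp hδ (hu.toLp u), hu.coeFn_toLp,
    (memLp_softAbs hu hδ).coeFn_toLp] with x h1 h2 h3
  rw [h1, h2, h3]

/-- Contractions operate on the spectral form. -/
lemma sum_rpow_softAbs_le_tsum {e : HilbertBasis ℕ ℝ (Lp ℝ 2 (volume.restrict Ω))}
    {lam : ℕ → ℝ} {g : ℕ → Lp (Eucl d) 2 (volume.restrict Ω)}
    (h : IsEigenSystem (fun n => e n) lam g)
    (hlam : ∀ n, 0 < lam n) (hs0 : 0 < s) (hs1 : s < 1) {δ : ℝ} (hδ : 0 < δ)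
    {x : Lp ℝ 2 (volume.restrict Ω)} (hx : Summable fun n => lam n ^ s * inner ℝ (e n) x ^ 2)
    (F : Finset ℕ) : ∑ n ∈ F, lam n ^ s * inner ℝ (e n) (softAbsLp hδ x) ^ 2
      ≤ ∑' n, lam n ^ s * inner ℝ (e n) x ^ 2 := by
  -- The partial sums converge in `L²`. The left-hand side involves finitely many coefficients and
  -- is `L²`-continuous, while the right-hand sides stay below the full series.
  have hlim : Tendsto (fun N => ∑ n ∈ Finset.range N, (inner ℝ (e n) x : ℝ) • e n) atTop (𝓝 x) := by
    have := (e.hasSum_repr x).tendsto_sum_nat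
    simpa only [e.repr_apply_apply] using this
  have hcont : Continuous fun y : Lp ℝ 2 (volume.restrict Ω) =>
      ∑ n ∈ F, lam n ^ s * inner ℝ (e n) (softAbsLp hδ y) ^ 2 := by
    have := continuous_softAbsLp (Ω := Ω) hδ
    fun_prop
  refine le_of_tendsto ((hcont.tendsto x).comp hlim) (Eventually.of_forall fun N => ?_)
  exact (h.sum_rpow_softAbs_le hlam hs0 hs1 hδ (Finset.range N) F _).trans
    (hx.sum_le_tsum _ fun n _ => mul_nonneg (Real.rpow_nonneg (hlam n).le _) (sq_nonneg _))

lemma hasSum_sq (e : HilbertBasis ℕ ℝ (Lp ℝ 2 (volume.restrict Ω)))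
    (x : Lp ℝ 2 (volume.restrict Ω)) : HasSum (fun n => (inner ℝ (e n) x : ℝ) ^ 2) (‖x‖ ^ 2) := by
  have := e.hasSum_inner_mul_inner x x
  rw [real_inner_self_eq_norm_sq] at this
  simpa only [real_inner_comm x, ← sq] using this

/-- The spectral inner product is regular. -/
theorem isRegularForm_spectral (hd : 1 ≤ d) (hΩ : IsOpen Ω) (hb : Bornology.IsBounded Ω)
    (hs0 : 0 < s) (hs1 : s < 1) (hs : s ≠ 1 / 2)
    (e : HilbertBasis ℕ ℝ (Lp ℝ 2 (volume.restrict Ω))) (lam : ℕ → ℝ)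
    (he : ∀ n, IsDirichletEigen Ω (e n) (lam n)) :
    IsRegularForm (.spectral hs e lam he : InnerChoice Ω s) := by
  obtain ⟨g, h⟩ := exists_isEigenSystem e lam he
  obtain ⟨c, hc, hcl⟩ := h.exists_le_lam hd hb
  have hlam : ∀ n, 0 < lam n := fun n => hc.trans_le (hcl n)
  have hl : ∀ n, 0 ≤ lam n ^ s := fun n => Real.rpow_nonneg (hlam n).le _
  have hint : ∀ {u : Eucl d → ℝ}, MemLp u 2 (volume.restrict Ω) → ∀ n,
      Integrable (fun x => u x * e n x) (volume.restrict Ω) :=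
    fun hu n => hu.integrable_mul (Lp.memLp (e n))
  have hadd : ∀ {u v : Eucl d → ℝ}, MemLp u 2 (volume.restrict Ω) →
      MemLp v 2 (volume.restrict Ω) → ∀ n, ∫ x in Ω, (u + v) x * e n x
        = (∫ x in Ω, u x * e n x) + ∫ x in Ω, v x * e n x := by
    intro u v hu hv n
    rw [← integral_add (hint hu n) (hint hv n)]
    simp only [Pi.add_apply, add_mul]
  have hsmul : ∀ (r : ℝ) (u : Eucl d → ℝ) (n : ℕ), ∫ x in Ω, (r • u) x * e n x
      = r * ∫ x in Ω, u x * e n x := by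
    intro r u n
    rw [← integral_const_mul]
    simp only [Pi.smul_apply, smul_eq_mul, mul_assoc]
  have hnorm : ∀ u : Eucl d → ℝ, InnerChoice.normSq (.spectral hs e lam he : InnerChoice Ω s) u
      = ∑' n, lam n ^ s * (∫ x in Ω, u x * e n x) ^ 2 := by
    intro u
    refine tsum_congr fun n => ?_
    ring
  have hterm : ∀ (u : Eucl d → ℝ) n, 0 ≤ lam n ^ s * (∫ x in Ω, u x * e n x) ^ 2 :=
    fun u n => mul_nonneg (hl n) (sq_nonneg _)
  refine ⟨hΩ, hb.measure_lt_top.ne, fun hw => hw.1, ?_, ?_, ?_, ?_, ?_, ?_, ?_, ?_, ?_, ?_⟩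
  · rintro u v ⟨hu, hu'⟩ ⟨hv, hv'⟩
    refine ⟨hu.add hv, ?_⟩
    simp only [hadd hu hv]
    refine ((hu'.add ((summable_mul_of_summable_sq hl hu' hv').mul_left 2)).add hv').congr
      fun n => ?_
    ring
  · rintro r u ⟨hu, hu'⟩
    refine ⟨hu.const_smul r, ?_⟩
    simp only [hsmul]
    refine (hu'.mul_left (r ^ 2)).congr fun n => ?_
    ring
  · intro u v
    refine tsum_congr fun n => ?_
    ring
  · rintro u v w ⟨hu, hu'⟩ ⟨hv, hv'⟩ ⟨hw, hw'⟩
    change ∑' n, _ = (∑' n, _) + ∑' n, _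
    rw [← (summable_mul_of_summable_sq hl hu' hv').tsum_add
      (summable_mul_of_summable_sq hl hu' hw')]
    refine tsum_congr fun n => ?_
    rw [hadd hv hw]
    ring
  · rintro r u v - -
    change ∑' n, _ = r * ∑' n, _
    rw [← tsum_mul_left]
    refine tsum_congr fun n => ?_
    rw [hsmul]
    ring
  · intro u _
    rw [hnorm]
    exact tsum_nonneg (hterm u)
  -- Since `lam n ≥ c`, Parseval's identity gives `‖u‖² ≤ c ^ (-s)` times the energy.
  · refine ⟨√((c ^ s)⁻¹), by positivity, ?_⟩
    rintro u ⟨hu, hu'⟩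
    have hcs : 0 < c ^ s := by positivity
    rw [hnorm, ← Real.sqrt_mul (by positivity)]
    have h1 : eLpNorm u 2 (volume.restrict Ω) = ENNReal.ofReal ‖hu.toLp u‖ := by
      rw [Lp.norm_toLp, ENNReal.ofReal_toReal hu.2.ne]
    rw [h1]
    refine ENNReal.ofReal_le_ofReal (Real.le_sqrt_of_sq_le ?_)
    rw [← (hasSum_sq e (hu.toLp u)).tsum_eq, ← tsum_mul_left]
    refine (hasSum_sq e (hu.toLp u)).summable.tsum_le_tsum (fun n => ?_) (hu'.mul_left _)
    rw [integral_mul_eq_inner hu, ← mul_assoc]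
    refine le_mul_of_one_le_left (sq_nonneg _) ?_
    rw [inv_mul_eq_div, one_le_div hcs]
    exact Real.rpow_le_rpow hc.le (hcl n) hs0.le
  · intro f w C hf hC hw hlim
    have hLp : Tendsto (fun k => (hf k).1.toLp (f k)) atTop (𝓝 (hw.toLp w)) :=
      (Lp.tendsto_Lp_iff_tendsto_eLpNorm'' f (fun k => (hf k).1) w hw).2 hlim
    have hpart : ∀ F : Finset ℕ, ∑ n ∈ F, lam n ^ s * (∫ x in Ω, w x * e n x) ^ 2 ≤ C := by
      intro F
      have hcont : Continuous fun y : Lp ℝ 2 (volume.restrict Ω) =>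
          ∑ n ∈ F, lam n ^ s * inner ℝ (e n) y ^ 2 := by fun_prop
      simp only [integral_mul_eq_inner hw]
      refine le_of_tendsto ((hcont.tendsto _).comp hLp) (Eventually.of_forall fun k => ?_)
      have h1 := hC k
      rw [hnorm] at h1
      simp only [Function.comp, ← integral_mul_eq_inner (hf k).1]
      exact ((hf k).2.sum_le_tsum F fun n _ => hterm _ n).trans h1
    obtain ⟨h1, h2⟩ := summable_and_tsum_le (hterm w) hpart
    exact ⟨⟨hw, h1⟩, (hnorm w).trans_le h2⟩
  · intro φ hφ
    have hm := memLp_of_mem_testFunctions hφ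
    have hm' := memLp_gradient hφ
    have hq : (hm.toLp φ, hm'.toLp _) ∈ (gradGraph Ω).topologicalClosure :=
      Submodule.le_topologicalClosure _ ⟨φ, hφ, hm.coeFn_toLp, hm'.coeFn_toLp⟩
    -- From `λ ^ s ≤ 1 + λ` and Bessel's inequality, both in `L²` and for the gradients.
    refine ⟨hm, summable_of_sum_le (c := ‖hm.toLp φ‖ ^ 2 + ‖hm'.toLp _‖ ^ 2) (hterm φ)
      fun F => ?_⟩
    have h1 := h.sum_lam_mul_sq_le F hq
    have h2 := e.orthonormal.sum_inner_products_le (s := F) (hm.toLp φ)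
    simp only [Real.norm_eq_abs, sq_abs] at h2
    refine le_trans ?_ (add_le_add h2 h1)
    rw [← Finset.sum_add_distrib]
    refine Finset.sum_le_sum fun n _ => ?_
    rw [integral_mul_eq_inner hm, ← one_add_mul]
    refine mul_le_mul_of_nonneg_right ?_ (sq_nonneg _)
    rcases le_total (lam n) 1 with h3 | h3
    · linarith [Real.rpow_le_one (hlam n).le h3 hs0.le, hlam n]
    · have := Real.rpow_le_rpow_of_exponent_le h3 hs1.le
      rw [Real.rpow_one] at this
      linarith
  · rintro u δ hδ ⟨hu, hu'⟩
    have hm := memLp_softAbs hu hδ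
    have hu'' : Summable fun n => lam n ^ s * inner ℝ (e n) (hu.toLp u) ^ 2 := by
      simpa only [integral_mul_eq_inner hu] using hu'
    have hpart : ∀ F : Finset ℕ, ∑ n ∈ F, lam n ^ s * (∫ x in Ω, softAbs δ (u x) * e n x) ^ 2
        ≤ ∑' n, lam n ^ s * (∫ x in Ω, u x * e n x) ^ 2 := by
      intro F
      simp only [integral_mul_eq_inner hu, integral_mul_eq_inner hm, ← softAbsLp_toLp hu hδ]
      exact sum_rpow_softAbs_le_tsum h hlam hs0 hs1 hδ hu'' F
    obtain ⟨h1, h2⟩ := summable_and_tsum_le (hterm _) hpart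
    exact ⟨⟨hm, h1⟩, by rw [hnorm, hnorm]; exact h2⟩

/-- Every admissible inner product is regular. -/
theorem isRegularForm (hd : 1 ≤ d) (hΩ : IsBoundedLipschitzDomain Ω) (hs0 : 0 < s) (hs1 : s < 1)
    (p : InnerChoice Ω s) : IsRegularForm p := by
  cases p with
  | integral => exact isRegularForm_integral hd hΩ.isOpen hΩ.isBounded hs0 hs1
  | wholeSpace hs => exact isRegularForm_wholeSpace hd hΩ.isOpen hΩ.isBounded hs0 hs1 hs
  | spectral hs e lam he =>
    exact isRegularForm_spectral hd hΩ.isOpen hΩ.isBounded hs0 hs1 hs e lam he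

end FracCap

end

/-! ### The theorem for the three inner products -/

theorem mainTheorem2 {d : ℕ} (hd : 1 ≤ d) {Ω : Set (FracCap.Eucl d)}
    (hΩ : FracCap.IsBoundedLipschitzDomain Ω) {s : ℝ} (hs0 : 0 < s) (hs1 : s < 1)
    (p : FracCap.InnerChoice Ω s) (z : FracCap.Eucl d → ℝ) (hz : z ∈ FracCap.W p) :
    (z ∈ FracCap.K p ↔
      ∃ μ, FracCap.IsCapacitaryMeasure p μ ∧ FracCap.SolvesRelaxed p μ z) ∧
    (z ∈ FracCap.K p →
      ∃ η, FracCap.Represents p η z ∧ (∀ η', FracCap.Represents p η' z → η' = η) ∧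
      ∃ μ, (FracCap.IsCapacitaryMeasure p μ ∧ FracCap.SolvesRelaxed p μ z) ∧
        (∀ μ', FracCap.IsCapacitaryMeasure p μ' → FracCap.SolvesRelaxed p μ' z → μ' = μ) ∧
        ∀ B ⊆ Ω, MeasurableSet B →
          (FracCap.cap p (B ∩ {x | z x = 0}) = 0 →
            μ B = ∫⁻ x in B, (ENNReal.ofReal (z x))⁻¹ ∂η) ∧
          (0 < FracCap.cap p (B ∩ {x | z x = 0}) → μ B = ⊤) ∧
          η (B ∩ {x | 0 < z x}) = ∫⁻ x in B, ENNReal.ofReal (z x) ∂μ) :=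
  (FracCap.isRegularForm hd hΩ hs0 hs1 p).mem_K_iff_and_formula hz
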